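/- Let $\widetilde Q$ be the quiver with vertices $\infty,0,1$, one arrow $\infty\to 0$, arrows $a_1,a_2:0\to1$, $b_1,b_2:1\to0$, a loop $c$ at $0$ and a loop $d$ at $1$, with relations $I$: $$a_2b_ia_1=a_1b_ia_2,\quad b_2a_ib_1=b_1a_ib_2,\quad da_i=a_ic,\quad cb_i=b_id\qquad(i=1,2).$$ For $\Theta=(\theta_0,\theta_1)\in\mathbb R^2$ put $\Theta(V_0,V_1)=\theta_0\dim V_0+\theta_1\dim V_1$. A complex representation $(V_0,V_1,V_\infty=\mathbb C)$ of $(\widetilde Q,I)$ is $\Theta$-semistable if $\Theta(V_0',V_1')\le 0$ for every nonzero subrepresentation $(V_0',V_1',0)$ and $\Theta(V_0',V_1')\le\Theta(V_0,V_1)$ for every proper subrepresentation $(V_0',V_1',\mathbb C)$. For $\mathbf d=(d_0,d_1)\in(\mathbb Z_{\ge0})^2$ let $M^\Theta_{\mathbf d}(\widetilde Q,I)$ be the moduli space of $\Theta$-semistable representations with $\dim V_i=d_i$, that is, the quotient of the semistable locus in the scheme of representations by $GL(V_0)\times GL(V_1)$. The walls are the sets $$\{\theta_0<\theta_1,\ m\theta_0+(m-1)\theta_1=0\}\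 (m\ge1),\quad \{\theta_0<\theta_1,\ m\theta_0+(m+1)\theta_1=0\}\ (m\ge0),\quad \{\theta_0<\theta_1,\ \theta_0+\theta_1=0\}$$ and the three families obtained by replacing $\theta_0<\theta_1$ with $\theta_0>\theta_1$. If $\Theta\ne(0,0)$ lies on no wall, $M^\Theta_{\mathbf d}(\widetilde Q,I)$ is a fine moduli space; its closed points are the isomorphism classes of $\Theta$-semistable representations, and its Zariski tangent space at a closed point $p$ is the set of isomorphism classes of families over the dual numbers $\mathbb C[\varepsilon]$ whose reduction modulo $\varepsilon$ is $p$, the constant family being the zero vector. The torus $(\mathbb C^*)^5=\{(q_1,\dots,q_6)\in(\mathbb C^*)^6: q_5=q_6\}$ acts by scaling $a_1,a_2,b_1,b_2,c,d$ (and fixing the framing arrow). Its subgroup $\mathbb C^*=\{(q,q,q^{-1},q^{-1},1,1)\}$ acts trivially on isomorphism classes, so the quotient $\bar T=(\mathbb C^*)^5/\mathbb C^*$ acts on $M^\Theta_{\mathbf d}(\widetilde Q,I)$, as does the 3-dimensional subtorus $\bar T_0=\{q_1q_2q_3q_4q_5=1\}\subset\bar T$. **Proposition 3.1.** Let $\Theta\in\mathbb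 R^2\setminus\{(0,0)\}$ lie outside all walls and let $\mathbf d\in(\mathbb Z_{\ge0})^2$. Then $$M^\Theta_{\mathbf d}(\widetilde Q,I)^{\bar T_0}=M^\Theta_{\mathbf d}(\widetilde Q,I)^{\bar T}$$ as sets of closed points, and this set is finite. Moreover, for each point $p$ of it, the Zariski tangent space of $M^\Theta_{\mathbf d}(\widetilde Q,I)$ at $p$ has no nonzero $\bar T_0$-fixed vector. -/

import Mathlib

open scoped Matrix

namespace LocalConifold

/-! ## Representations of the framed quiver with relations

The quiver has vertices `∞, 0, 1`, one arrow `∞ → 0`, arrows `a₁, a₂ : 0 → 1`,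
`b₁, b₂ : 1 → 0`, and loops `c` at `0` and `d` at `1`. -/

/-- The `R`-points of the affine scheme of representations of the framed quiver with
relations, with dimension vector `(d₀, d₁)` at the vertices `0, 1` and dimension `1` at `∞`.
The vector `v` is the image of `1` under the framing arrow `∞ → 0`. -/
@[ext]
structure FramedRep (R : Type) [CommRing R] (d₀ d₁ : ℕ) where
  a : Fin 2 → Matrix (Fin d₁) (Fin d₀) R
  b : Fin 2 → Matrix (Fin d₀) (Fin d₁) R
  c : Matrix (Fin d₀) (Fin d₀) R
  d : Matrix (Fin d₁) (Fin d₁) R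
  v : Fin d₀ → R
  rel_a : ∀ i, a 1 * b i * a 0 = a 0 * b i * a 1
  rel_b : ∀ i, b 1 * a i * b 0 = b 0 * a i * b 1
  rel_da : ∀ i, d * a i = a i * c
  rel_cb : ∀ i, c * b i = b i * d

namespace FramedRep

variable {R S : Type} [CommRing R] [Algebra ℂ R] [CommRing S] [Algebra ℂ S] {d₀ d₁ : ℕ}

/-- Base change of a representation along a homomorphism of `ℂ`-algebras. -/
def map (f : R →ₐ[ℂ] S) (x : FramedRep R d₀ d₁) : FramedRep S d₀ d₁ where
  a i := (x.a i).map f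
  b i := (x.b i).map f
  c := x.c.map f
  d := x.d.map f
  v := fun k => f (x.v k)
  rel_a i := by simpa [Matrix.map_mul] using congrArg (fun m => m.map f) (x.rel_a i)
  rel_b i := by simpa [Matrix.map_mul] using congrArg (fun m => m.map f) (x.rel_b i)
  rel_da i := by simpa [Matrix.map_mul] using congrArg (fun m => m.map f) (x.rel_da i)
  rel_cb i := by simpa [Matrix.map_mul] using congrArg (fun m => m.map f) (x.rel_cb i)

/-- Isomorphism of framed representations that is the identity at `∞`: `x` and `y` lie in one
orbit of the gauge group `GL(V₀) × GL(V₁)`. -/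
def Iso (x y : FramedRep R d₀ d₁) : Prop :=
  ∃ (g₀ : GL (Fin d₀) R) (g₁ : GL (Fin d₁) R),
    (∀ i, g₁.val * x.a i = y.a i * g₀.val) ∧
    (∀ i, g₀.val * x.b i = y.b i * g₁.val) ∧
    g₀.val * x.c = y.c * g₀.val ∧
    g₁.val * x.d = y.d * g₁.val ∧
    g₀.val *ᵥ x.v = y.v

theorem Iso.refl (x : FramedRep R d₀ d₁) : Iso x x :=
  ⟨1, 1, fun i => (Matrix.one_mul _).trans (Matrix.mul_one _).symm,
    fun i => (Matrix.one_mul _).trans (Matrix.mul_one _).symm,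
    (Matrix.one_mul _).trans (Matrix.mul_one _).symm,
    (Matrix.one_mul _).trans (Matrix.mul_one _).symm, Matrix.one_mulVec _⟩

theorem inv_intertwine {R : Type} [CommRing R] {m n : ℕ} {g : GL (Fin m) R} {h : GL (Fin n) R}
    {X Y : Matrix (Fin m) (Fin n) R} (e : g.val * X = Y * h.val) :
    (g⁻¹).val * Y = X * (h⁻¹).val := by
  have h1 : (g⁻¹).val * g.val = 1 := Units.inv_mul g
  have h2 : h.val * (h⁻¹).val = 1 := Units.mul_inv h
  calc (g⁻¹).val * Y = (g⁻¹).val * (Y * (h.val * (h⁻¹).val)) := by rw [h2, Matrix.mul_one]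
    _ = (g⁻¹).val * (Y * h.val) * (h⁻¹).val := by simp only [Matrix.mul_assoc]
    _ = (g⁻¹).val * (g.val * X) * (h⁻¹).val := by rw [e]
    _ = X * (h⁻¹).val := by rw [← Matrix.mul_assoc, h1, Matrix.one_mul]

theorem Iso.symm {x y : FramedRep R d₀ d₁} (h : Iso x y) : Iso y x := by
  obtain ⟨g₀, g₁, ha, hb, hc, hd, hv⟩ := h
  refine ⟨g₀⁻¹, g₁⁻¹, fun i => inv_intertwine (ha i), fun i => inv_intertwine (hb i),
    inv_intertwine hc, inv_intertwine hd, ?_⟩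
  have h1 : (g₀⁻¹).val * g₀.val = 1 := Units.inv_mul g₀
  rw [← hv, Matrix.mulVec_mulVec, h1, Matrix.one_mulVec]

theorem mul_intertwine {R : Type} [CommRing R] {m n : ℕ} {g g' : GL (Fin m) R}
    {h h' : GL (Fin n) R} {X Y Z : Matrix (Fin m) (Fin n) R}
    (e : g.val * X = Y * h.val) (e' : g'.val * Y = Z * h'.val) :
    (g' * g).val * X = Z * (h' * h).val := by
  rw [Units.val_mul, Units.val_mul, Matrix.mul_assoc, e, ← Matrix.mul_assoc, e', Matrix.mul_assoc]

theorem Iso.trans {x y z : FramedRep R d₀ d₁} (h : Iso x y) (h' : Iso y z) : Iso x z := by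
  obtain ⟨g₀, g₁, ha, hb, hc, hd, hv⟩ := h
  obtain ⟨k₀, k₁, ha', hb', hc', hd', hv'⟩ := h'
  refine ⟨k₀ * g₀, k₁ * g₁, fun i => mul_intertwine (ha i) (ha' i),
    fun i => mul_intertwine (hb i) (hb' i), mul_intertwine hc hc', mul_intertwine hd hd', ?_⟩
  rw [Units.val_mul, ← Matrix.mulVec_mulVec, hv, hv']

theorem map_intertwine (f : R →ₐ[ℂ] S) {m n : ℕ} {g : GL (Fin m) R} {h : GL (Fin n) R}
    {X Y : Matrix (Fin m) (Fin n) R} (e : g.val * X = Y * h.val) :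
    g.val.map f * X.map f = Y.map f * h.val.map f := by
  rw [← Matrix.map_mul, ← Matrix.map_mul, e]

theorem Iso.map (f : R →ₐ[ℂ] S) {x y : FramedRep R d₀ d₁} (h : Iso x y) :
    Iso (x.map f) (y.map f) := by
  obtain ⟨g₀, g₁, ha, hb, hc, hd, hv⟩ := h
  refine ⟨Units.map (RingHom.mapMatrix (f : R →+* S)).toMonoidHom g₀,
    Units.map (RingHom.mapMatrix (f : R →+* S)).toMonoidHom g₁,
    fun i => ?_, fun i => ?_, ?_, ?_, ?_⟩
  · exact map_intertwine f (ha i)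
  · exact map_intertwine f (hb i)
  · exact map_intertwine f hc
  · exact map_intertwine f hd
  · funext k
    have := congrArg f (congrFun hv k)
    simpa [Matrix.mulVec, dotProduct, FramedRep.map] using this

/-! ## Stability -/

/-- `(U₀, U₁)` is closed under all arrows between the vertices `0` and `1`, so that
`(U₀, U₁, 0)` is a subrepresentation; `(U₀, U₁, ℂ)` is one as well exactly if `x.v ∈ U₀`. -/
structure IsSubrep (x : FramedRep ℂ d₀ d₁)
    (U₀ : Submodule ℂ (Fin d₀ → ℂ)) (U₁ : Submodule ℂ (Fin d₁ → ℂ)) : Prop where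
  a_mem : ∀ i, ∀ u ∈ U₀, x.a i *ᵥ u ∈ U₁
  b_mem : ∀ i, ∀ u ∈ U₁, x.b i *ᵥ u ∈ U₀
  c_mem : ∀ u ∈ U₀, x.c *ᵥ u ∈ U₀
  d_mem : ∀ u ∈ U₁, x.d *ᵥ u ∈ U₁

/-- `Θ(V₀, V₁) = θ₀ dim V₀ + θ₁ dim V₁`. -/
noncomputable def weight (Θ : ℝ × ℝ) {d₀ d₁ : ℕ}
    (U₀ : Submodule ℂ (Fin d₀ → ℂ)) (U₁ : Submodule ℂ (Fin d₁ → ℂ)) : ℝ :=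
  Θ.1 * (Module.finrank ℂ U₀ : ℝ) + Θ.2 * (Module.finrank ℂ U₁ : ℝ)

/-- King semistability of a framed representation with `V_∞ = ℂ`. -/
structure IsSemistable (Θ : ℝ × ℝ) (x : FramedRep ℂ d₀ d₁) : Prop where
  sub : ∀ U₀ U₁, x.IsSubrep U₀ U₁ → ¬ (U₀ = ⊥ ∧ U₁ = ⊥) → weight Θ U₀ U₁ ≤ 0
  framed : ∀ U₀ U₁, x.IsSubrep U₀ U₁ → x.v ∈ U₀ → ¬ (U₀ = ⊤ ∧ U₁ = ⊤) →
    weight Θ U₀ U₁ ≤ weight Θ (⊤ : Submodule ℂ (Fin d₀ → ℂ)) (⊤ : Submodule ℂ (Fin d₁ → ℂ))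

/-- An `R`-point of the representation scheme lies in the open semistable locus: its fibre at
each `ℂ`-point of `Spec R` is semistable. -/
def IsSemistableFamily (Θ : ℝ × ℝ) (x : FramedRep R d₀ d₁) : Prop :=
  ∀ f : R →ₐ[ℂ] ℂ, (x.map f).IsSemistable Θ

theorem IsSemistableFamily.map {Θ : ℝ × ℝ} (f : R →ₐ[ℂ] S) {x : FramedRep R d₀ d₁}
    (h : x.IsSemistableFamily Θ) : (x.map f).IsSemistableFamily Θ :=
  fun g => h (g.comp f)

end FramedRep

/-! ## The walls -/

/-- The union of the walls `L₋⁻(m)`, `L₋⁺(m)`, `L₋(∞)`, `L₊⁻(m)`, `L₊⁺(m)`, `L₊(∞)` in `ℝ²`. -/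
def walls : Set (ℝ × ℝ) :=
  {Θ | Θ.1 < Θ.2 ∧ ∃ m : ℕ, 1 ≤ m ∧ (m : ℝ) * Θ.1 + ((m : ℝ) - 1) * Θ.2 = 0} ∪
  {Θ | Θ.1 < Θ.2 ∧ ∃ m : ℕ, (m : ℝ) * Θ.1 + ((m : ℝ) + 1) * Θ.2 = 0} ∪
  {Θ | Θ.1 < Θ.2 ∧ Θ.1 + Θ.2 = 0} ∪
  {Θ | Θ.2 < Θ.1 ∧ ∃ m : ℕ, 1 ≤ m ∧ (m : ℝ) * Θ.1 + ((m : ℝ) - 1) * Θ.2 = 0} ∪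
  {Θ | Θ.2 < Θ.1 ∧ ∃ m : ℕ, (m : ℝ) * Θ.1 + ((m : ℝ) + 1) * Θ.2 = 0} ∪
  {Θ | Θ.2 < Θ.1 ∧ Θ.1 + Θ.2 = 0}

/-! ## The moduli space -/

/-- Isomorphism of semistable families. -/
def isoSetoid (Θ : ℝ × ℝ) (d₀ d₁ : ℕ) (R : Type) [CommRing R] [Algebra ℂ R] :
    Setoid {x : FramedRep R d₀ d₁ // x.IsSemistableFamily Θ} where
  r x y := FramedRep.Iso x.1 y.1
  iseqv := ⟨fun x => .refl x.1, fun h => h.symm, fun h h' => h.trans h'⟩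

/-- The functor of points of the moduli space `M^Θ_(d₀,d₁)`, evaluated on a local `ℂ`-algebra `R`
of finite type or artinian, such as `ℂ` or the dual numbers `ℂ[ε]`: isomorphism classes of
`Θ`-semistable families over `Spec R`, that is, `GL_{d₀}(R) × GL_{d₁}(R)`-orbits in the `R`-points
of the semistable locus. (All vector bundles on `Spec R` are trivial. For nonzero `Θ` off the walls,
where this is used, semistable representations are stable and have no automorphisms, and the GIT
quotient is a fine moduli space.) -/
def Moduli (Θ : ℝ × ℝ) (d₀ d₁ : ℕ) (R : Type) [CommRing R] [Algebra ℂ R] : Type :=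
  Quotient (isoSetoid Θ d₀ d₁ R)

/-- Pull-back of families. -/
def Moduli.map {Θ : ℝ × ℝ} {d₀ d₁ : ℕ} {R S : Type} [CommRing R] [Algebra ℂ R]
    [CommRing S] [Algebra ℂ S] (f : R →ₐ[ℂ] S) : Moduli Θ d₀ d₁ R → Moduli Θ d₀ d₁ S :=
  Quotient.map' (s₁ := isoSetoid Θ d₀ d₁ R) (s₂ := isoSetoid Θ d₀ d₁ S)
    (fun x => ⟨x.1.map f, x.2.map f⟩) (fun _ _ h => FramedRep.Iso.map f h)

/-- The (closed, that is, complex) points of the moduli space `M^Θ_(d₀,d₁)`. -/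
abbrev Points (Θ : ℝ × ℝ) (d₀ d₁ : ℕ) : Type := Moduli Θ d₀ d₁ ℂ

/-- The Zariski tangent space of the moduli space at `p`: the morphisms
`Spec ℂ[ε] → M^Θ_(d₀,d₁)` that send the closed point to `p`. -/
def tangentSpace {Θ : ℝ × ℝ} {d₀ d₁ : ℕ} (p : Points Θ d₀ d₁) :
    Set (Moduli Θ d₀ d₁ (DualNumber ℂ)) :=
  {ξ | Moduli.map (TrivSqZeroExt.fstHom ℂ ℂ ℂ) ξ = p}

/-- The zero tangent vector at `p`: the constant morphism `Spec ℂ[ε] → Spec ℂ → M^Θ_(d₀,d₁)`. -/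
def zeroTangent {Θ : ℝ × ℝ} {d₀ d₁ : ℕ} (p : Points Θ d₀ d₁) :
    Moduli Θ d₀ d₁ (DualNumber ℂ) :=
  Moduli.map (Algebra.ofId ℂ (DualNumber ℂ)) p

/-! ## The torus actions -/

/-- The subtorus `(ℂ*)⁵ = {q₅ = q₆}` of the torus `(ℂ*)⁶` scaling the arrows
`a₁, a₂, b₁, b₂, c, d` (numbered from `0` here). -/
def T : Subgroup (Fin 6 → ℂˣ) where
  carrier := {q | q 4 = q 5}
  one_mem' := rfl
  mul_mem' {x y} hx hy := by
    simp only [Set.mem_ofPred_eq, Pi.mul_apply] at hx hy ⊢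
    rw [hx, hy]
  inv_mem' {x} hx := by
    simp only [Set.mem_ofPred_eq, Pi.inv_apply] at hx ⊢
    rw [hx]

/-- The subgroup `ℂ* = {(q, q, q⁻¹, q⁻¹, 1, 1)}` of `(ℂ*)⁵`, as the image of a homomorphism. -/
def kHom : ℂˣ →* T where
  toFun q := ⟨![q, q, q⁻¹, q⁻¹, 1, 1], rfl⟩
  map_one' := by
    apply Subtype.ext; funext i; fin_cases i <;> simp
  map_mul' x y := by
    apply Subtype.ext; funext i; fin_cases i <;> simp [mul_comm]

/-- The torus `T̄ = (ℂ*)⁵ / ℂ*`. -/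
abbrev Tbar : Type := T ⧸ kHom.range

/-- The lift `{q₁ q₂ q₃ q₄ q₅ = 1}` of the Calabi-Yau torus to `(ℂ*)⁵`. -/
def T₀ : Subgroup T where
  carrier := {q | q.1 0 * q.1 1 * q.1 2 * q.1 3 * q.1 4 = 1}
  one_mem' := by simp
  mul_mem' {x y} hx hy := by
    simp only [Set.mem_ofPred_eq, Subgroup.coe_mul, Pi.mul_apply] at hx hy ⊢
    calc _ = (x.1 0 * x.1 1 * x.1 2 * x.1 3 * x.1 4) *
          (y.1 0 * y.1 1 * y.1 2 * y.1 3 * y.1 4) := by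
            simp only [mul_assoc, mul_left_comm]
      _ = 1 := by rw [hx, hy, one_mul]
  inv_mem' {x} hx := by
    simp only [Set.mem_ofPred_eq, Subgroup.coe_inv, Pi.inv_apply, ← mul_inv] at hx ⊢
    rw [hx, inv_one]

/-- The three-dimensional Calabi-Yau torus `T̄₀ = {q₁ q₂ q₃ q₄ q₅ = 1} / ℂ* ⊆ T̄`. -/
def Tbar₀ : Subgroup Tbar := T₀.map (QuotientGroup.mk' kHom.range)

namespace FramedRep

variable {R S : Type} [CommRing R] [Algebra ℂ R] [CommRing S] [Algebra ℂ S] {d₀ d₁ : ℕ}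

/-- The action of `(ℂ*)⁵` by scaling the arrows; the framing is not changed. -/
def scale (q : T) (x : FramedRep R d₀ d₁) : FramedRep R d₀ d₁ where
  a i := ((![q.1 0, q.1 1] i : ℂˣ) : ℂ) • x.a i
  b i := ((![q.1 2, q.1 3] i : ℂˣ) : ℂ) • x.b i
  c := ((q.1 4 : ℂˣ) : ℂ) • x.c
  d := ((q.1 5 : ℂˣ) : ℂ) • x.d
  v := x.v
  rel_a i := by
    simp only [Matrix.smul_mul, Matrix.mul_smul, smul_smul, x.rel_a i]
    congr 1; simp only [Matrix.cons_val_zero, Matrix.cons_val_one]; ring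
  rel_b i := by
    simp only [Matrix.smul_mul, Matrix.mul_smul, smul_smul, x.rel_b i]
    congr 1; simp only [Matrix.cons_val_zero, Matrix.cons_val_one]; ring
  rel_da i := by
    have h : q.1 4 = q.1 5 := q.2
    simp only [Matrix.smul_mul, Matrix.mul_smul, smul_smul, x.rel_da i, h, mul_comm]
  rel_cb i := by
    have h : q.1 4 = q.1 5 := q.2
    simp only [Matrix.smul_mul, Matrix.mul_smul, smul_smul, x.rel_cb i, h, mul_comm]

theorem scale_one (x : FramedRep R d₀ d₁) : scale 1 x = x := by
  ext i <;> first | rfl | (try fin_cases i) <;> simp [scale]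

theorem scale_mul (p q : T) (x : FramedRep R d₀ d₁) :
    scale (p * q) x = scale p (scale q x) := by
  ext i <;> first | rfl | (try fin_cases i) <;> simp [scale, smul_smul]

theorem map_scale (f : R →ₐ[ℂ] S) (q : T) (x : FramedRep R d₀ d₁) :
    (scale q x).map f = scale q (x.map f) := by
  ext i <;> simp [scale, FramedRep.map]

theorem Iso.scale (q : T) {x y : FramedRep R d₀ d₁} (h : Iso x y) :
    Iso (x.scale q) (y.scale q) := by
  obtain ⟨g₀, g₁, ha, hb, hc, hd, hv⟩ := h
  refine ⟨g₀, g₁, fun i => ?_, fun i => ?_, ?_, ?_, hv⟩ <;>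
    simp only [FramedRep.scale, Matrix.mul_smul, Matrix.smul_mul, ha, hb, hc, hd]

theorem IsSubrep.of_scale {q : T} {x : FramedRep ℂ d₀ d₁}
    {U₀ : Submodule ℂ (Fin d₀ → ℂ)} {U₁ : Submodule ℂ (Fin d₁ → ℂ)}
    (h : (x.scale q).IsSubrep U₀ U₁) : x.IsSubrep U₀ U₁ := by
  refine ⟨fun i u hu => ?_, fun i u hu => ?_, fun u hu => ?_, fun u hu => ?_⟩
  · have := h.a_mem i u hu
    rw [FramedRep.scale, Matrix.smul_mulVec] at this
    exact (U₁.smul_mem_iff (Units.ne_zero _)).1 this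
  · have := h.b_mem i u hu
    rw [FramedRep.scale, Matrix.smul_mulVec] at this
    exact (U₀.smul_mem_iff (Units.ne_zero _)).1 this
  · have := h.c_mem u hu
    rw [FramedRep.scale, Matrix.smul_mulVec] at this
    exact (U₀.smul_mem_iff (Units.ne_zero _)).1 this
  · have := h.d_mem u hu
    rw [FramedRep.scale, Matrix.smul_mulVec] at this
    exact (U₁.smul_mem_iff (Units.ne_zero _)).1 this

theorem IsSemistableFamily.scale {Θ : ℝ × ℝ} (q : T) {x : FramedRep R d₀ d₁}
    (h : x.IsSemistableFamily Θ) : (x.scale q).IsSemistableFamily Θ := by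
  intro f
  rw [map_scale]
  exact ⟨fun U₀ U₁ hU => (h f).sub U₀ U₁ hU.of_scale,
    fun U₀ U₁ hU => (h f).framed U₀ U₁ hU.of_scale⟩

theorem scale_kHom_iso (q : ℂˣ) (x : FramedRep R d₀ d₁) : Iso (x.scale (kHom q)) x := by
  let u : GL (Fin d₁) R := Units.map (algebraMap ℂ (Matrix (Fin d₁) (Fin d₁) R)).toMonoidHom q⁻¹
  have hu : (u : Matrix (Fin d₁) (Fin d₁) R) = ((q⁻¹ : ℂˣ) : ℂ) • 1 := by
    simp [u, Algebra.algebraMap_eq_smul_one]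
  refine ⟨1, u, fun i => ?_, fun i => ?_, ?_, ?_, ?_⟩
  · rw [hu, Units.val_one, Matrix.mul_one, Matrix.smul_mul, Matrix.one_mul]
    fin_cases i <;> simp [FramedRep.scale, kHom, smul_smul]
  · rw [hu, Units.val_one, Matrix.one_mul, Matrix.mul_smul, Matrix.mul_one]
    fin_cases i <;> simp [FramedRep.scale, kHom]
  · simp [FramedRep.scale, kHom]
  · rw [hu]; simp [FramedRep.scale, kHom]
  · simp [FramedRep.scale]

end FramedRep

section Action

variable {Θ : ℝ × ℝ} {d₀ d₁ : ℕ} {R : Type} [CommRing R] [Algebra ℂ R]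

/-- The action of `(ℂ*)⁵` on the moduli space. -/
instance : MulAction T (Moduli Θ d₀ d₁ R) where
  smul q := Quotient.map' (s₁ := isoSetoid Θ d₀ d₁ R) (s₂ := isoSetoid Θ d₀ d₁ R)
    (fun x => ⟨x.1.scale q, x.2.scale q⟩) (fun _ _ h => FramedRep.Iso.scale q h)
  one_smul p := by
    induction p using Quotient.inductionOn' with
    | h x => exact congrArg (Quotient.mk _) (Subtype.ext (FramedRep.scale_one x.1))
  mul_smul p q z := by
    induction z using Quotient.inductionOn' with
    | h x => exact congrArg (Quotient.mk _) (Subtype.ext (FramedRep.scale_mul p q x.1))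

theorem kHom_range_le_ker :
    kHom.range ≤ (MulAction.toPermHom T (Moduli Θ d₀ d₁ R)).ker := by
  rintro _ ⟨q, rfl⟩
  rw [MonoidHom.mem_ker]
  ext z
  induction z using Quotient.inductionOn' with
  | h x => exact Quotient.sound' (FramedRep.scale_kHom_iso q x.1)

/-- The induced action of the quotient torus `T̄ = (ℂ*)⁵ / ℂ*` on the moduli space. -/
instance : MulAction Tbar (Moduli Θ d₀ d₁ R) :=
  MulAction.compHom _ (QuotientGroup.lift kHom.range
    (MulAction.toPermHom T (Moduli Θ d₀ d₁ R)) kHom_range_le_ker)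

theorem mk_smul (q : T) (z : Moduli Θ d₀ d₁ R) : (QuotientGroup.mk q : Tbar) • z = q • z := rfl

end Action

end LocalConifold

set_option linter.unusedSectionVars false

/-! The products of an `a` and a `b`, together with the loops, act on a representation as central
elements. A probe of a representation is the cokernel of a difference map from tuples in `V₀` (of
length `n + 1` or `n - 1`) to `n`-tuples in `V₁`, formed with the two arrows `a`; for a sheaf on a
projective line it would be a cohomology group of a twist. It is a module over the central elements.
On suitable semistable representations two things hold: the difference map is injective, so the
probe is exact and its dimension is a linear form in the dimension vector (`Adm.finrank_probe`); and
the probe is generated over the centre by the framing vector (`Generated.span_val`). Both come from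
slope inequalities for preprojective and preinjective Kronecker modules. Off the walls there are two
such probes whose dimension forms are unimodular (`exists_probes`), so that together they lose
nothing.

Only one element of the Calabi-Yau torus is used, with weights 2, 3, 5, 7, 1/210. A point fixed by
it carries a twisted automorphism, for which the monomials in the `a`, `b` and the loop, applied to
the framing vector, are eigenvectors in the probe. The eigenvalue determines the exponent up to
multiples of (1,1,1,1,1), and every monomial is killed by some power of the product of all
variables. Hence the nonzero monomials are linearly independent (`IsVal.coeff_eq_zero`), and by
generation they form a basis of the probe. Their set of exponents, the support, is bounded in terms
of the dimension vector.

Two fixed points with equal supports are isomorphic: in the direct sum with the diagonal framing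
vector, a framed subrepresentation of maximal weight has a probe of the same dimension as that of
either summand, and both probes of its projection to a summand are isomorphisms; by unimodularity so
is the projection (`bijective_of_supp`). Finiteness follows, since there are finitely many supports.
Fixedness under the large torus follows because scaling the arrows does not change supports.

A tangent vector is a self-extension of the representation. If it is fixed, a monomial that vanishes
at the point still vanishes in the extension (`IsVal.eq_zero_of_deformation`): its first-order part
could only involve monomials that differ from it by a multiple of (1,1,1,1,1), and these are
excluded by induction on the exponent of the loop. The same comparison then splits the extension
compatibly with the framing, so the family is constant. -/

namespace LocalConifold
open Module

/-! ### Slope inequalities for Kronecker modules -/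

section KroneckerInequalities

variable {E : Type} [AddCommGroup E] [Module ℂ E] [FiniteDimensional ℂ E]

/-- Subrepresentations of a preinjective Kronecker module have at least its slope. -/
theorem finrank_le_of_drop (n : ℕ) (A : Submodule ℂ (Fin (n + 1) → E))
    (B : Submodule ℂ (Fin n → E))
    (h1 : ∀ f ∈ A, (fun i : Fin n => f i.succ) ∈ B)
    (h2 : ∀ f ∈ A, (fun i : Fin n => f i.castSucc) ∈ B) :
    n * finrank ℂ A ≤ (n + 1) * finrank ℂ B := by
  induction n with
  | zero => simp
  | succ n ih =>
    let r : (Fin (n + 2) → E) →ₗ[ℂ] (Fin (n + 1) → E) := LinearMap.funLeft ℂ E Fin.succ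
    let l : (Fin (n + 2) → E) →ₗ[ℂ] (Fin (n + 1) → E) := LinearMap.funLeft ℂ E Fin.castSucc
    let r' : (Fin (n + 1) → E) →ₗ[ℂ] (Fin n → E) := LinearMap.funLeft ℂ E Fin.succ
    let l' : (Fin (n + 1) → E) →ₗ[ℂ] (Fin n → E) := LinearMap.funLeft ℂ E Fin.castSucc
    -- `A` embeds in the pairs in `B` whose overlaps agree, so dim `A` ≤ 2 dim `B` − dim `C`;
    -- induction for `(B, C)` bounds dim `C` from below.
    let C : Submodule ℂ (Fin n → E) := B.map r' ⊔ B.map l'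
    have ihC := ih B C
      (fun f hf => Submodule.mem_sup_left (Submodule.mem_map_of_mem (f := r') hf))
      (fun f hf => Submodule.mem_sup_right (Submodule.mem_map_of_mem (f := l') hf))
    let φ : (B × B) →ₗ[ℂ] (Fin n → E) :=
      (l' ∘ₗ B.subtype).coprod (-(r' ∘ₗ B.subtype))
    have hφ : LinearMap.range φ = C := by
      rw [LinearMap.range_coprod, LinearMap.range_neg, LinearMap.range_comp, LinearMap.range_comp,
        Submodule.range_subtype, sup_comm]
    let ψ : A →ₗ[ℂ] (B × B) :=
      (LinearMap.codRestrict B (r ∘ₗ A.subtype) (fun f => h1 f f.2)).prod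
        (LinearMap.codRestrict B (l ∘ₗ A.subtype) (fun f => h2 f f.2))
    have hψ : Function.Injective ψ := by
      intro f g hfg
      have e1 : r f = r g := congrArg (fun p : B × B => (p.1 : Fin (n + 1) → E)) hfg
      have e2 : l f = l g := congrArg (fun p : B × B => (p.2 : Fin (n + 1) → E)) hfg
      ext i
      refine Fin.cases ?_ (fun j => ?_) i
      · exact congrFun e2 0
      · exact congrFun e1 j
    have hle : LinearMap.range ψ ≤ LinearMap.ker φ := by
      rintro _ ⟨f, rfl⟩
      rw [LinearMap.mem_ker]
      change l' (r f) + -(r' (l f)) = 0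
      rw [add_neg_eq_zero]
      rfl
    have d1 := Submodule.finrank_mono hle
    rw [LinearMap.finrank_range_of_inj hψ] at d1
    have d2 := LinearMap.finrank_range_add_finrank_ker φ
    rw [hφ, Module.finrank_prod] at d2
    nlinarith

/-- Subrepresentations of a preprojective Kronecker module have at least its slope. -/
theorem finrank_le_of_extend (k : ℕ) (A : Submodule ℂ (Fin k → E))
    (B : Submodule ℂ (Fin (k + 1) → E))
    (h1 : ∀ f ∈ A, (Fin.cons 0 f : Fin (k + 1) → E) ∈ B)
    (h2 : ∀ f ∈ A, (Fin.snoc f 0 : Fin (k + 1) → E) ∈ B) :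
    (k + 1) * finrank ℂ A ≤ k * finrank ℂ B := by
  induction k with
  | zero =>
    have : finrank ℂ A = 0 := by
      rw [Submodule.finrank_eq_zero]
      exact Subsingleton.elim _ _
    simp [this]
  | succ k ih =>
    let cz (m : ℕ) : (Fin m → E) →ₗ[ℂ] (Fin (m + 1) → E) :=
      { toFun := fun f => Fin.cons 0 f
        map_add' := fun f g => by ext i; refine Fin.cases ?_ (fun j => ?_) i <;> simp
        map_smul' := fun c g => by ext i; refine Fin.cases ?_ (fun j => ?_) i <;> simp }
    let sz (m : ℕ) : (Fin m → E) →ₗ[ℂ] (Fin (m + 1) → E) :=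
      { toFun := fun f => Fin.snoc f 0
        map_add' := fun f g => by ext i; refine Fin.lastCases ?_ (fun j => ?_) i <;> simp
        map_smul' := fun c g => by ext i; refine Fin.lastCases ?_ (fun j => ?_) i <;> simp }
    -- Dually, the two copies of `A` in `B` overlap in a space that embeds in `A'`, so 2 dim `A` ≤
    -- dim `B` + dim `A'`; induction is applied to `(A', A)`.
    let A' : Submodule ℂ (Fin k → E) := A.comap (cz k) ⊓ A.comap (sz k)
    have ihA := ih A' A (fun f hf => hf.1) (fun f hf => hf.2)
    let φ : (A × A) →ₗ[ℂ] (Fin (k + 2) → E) :=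
      (cz (k + 1) ∘ₗ A.subtype).coprod (-(sz (k + 1) ∘ₗ A.subtype))
    have hφ : LinearMap.range φ ≤ B := by
      rintro _ ⟨⟨f, g⟩, rfl⟩
      exact B.add_mem (h1 f f.2) (B.neg_mem (h2 g g.2))
    have key : ∀ p : A × A, φ p = 0 → ∃ h : Fin k → E, (p.1 : Fin (k + 1) → E) = sz k h ∧
        (p.2 : Fin (k + 1) → E) = cz k h := by
      rintro ⟨⟨f, hf⟩, ⟨g, hg⟩⟩ h0
      have h0' : (Fin.cons 0 f : Fin (k + 2) → E) = Fin.snoc g 0 := by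
        have : cz (k + 1) f + -(sz (k + 1) g) = 0 := h0
        exact add_neg_eq_zero.1 this
      refine ⟨fun i => f i.castSucc, ?_, ?_⟩
      · ext i
        refine Fin.lastCases ?_ (fun j => ?_) i
        · have := congrFun h0' (Fin.last (k + 1))
          rw [Fin.snoc_last, ← Fin.succ_last, Fin.cons_succ] at this
          simpa [sz] using this
        · simp [sz]
      · ext i
        refine Fin.cases ?_ (fun j => ?_) i
        · have := congrFun h0' (Fin.castSucc 0)
          rw [Fin.snoc_castSucc, Fin.castSucc_zero, Fin.cons_zero] at this
          simpa [cz] using this.symm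
        · have := congrFun h0' (Fin.castSucc j.succ)
          rw [Fin.snoc_castSucc, ← Fin.succ_castSucc, Fin.cons_succ] at this
          simpa [cz] using this.symm
    let ψ : LinearMap.ker φ →ₗ[ℂ] (Fin k → E) :=
      LinearMap.funLeft ℂ E Fin.castSucc ∘ₗ A.subtype ∘ₗ LinearMap.fst ℂ A A ∘ₗ
        (LinearMap.ker φ).subtype
    have hψ : ∀ p : LinearMap.ker φ, (p.1.1 : Fin (k + 1) → E) = sz k (ψ p) ∧
        (p.1.2 : Fin (k + 1) → E) = cz k (ψ p) := by
      intro p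
      obtain ⟨h, e1, e2⟩ := key p.1 p.2
      have : ψ p = h := by
        ext i
        change (p.1.1 : Fin (k + 1) → E) i.castSucc = h i
        rw [e1]; simp [sz]
      rw [this]; exact ⟨e1, e2⟩
    have hker : finrank ℂ (LinearMap.ker φ) ≤ finrank ℂ A' := by
      have hr : ∀ p, ψ p ∈ A' := fun p => by
        refine ⟨?_, ?_⟩
        · change cz k (ψ p) ∈ A
          rw [← (hψ p).2]; exact p.1.2.2
        · change sz k (ψ p) ∈ A
          rw [← (hψ p).1]; exact p.1.1.2
      refine LinearMap.finrank_le_finrank_of_injective (f := LinearMap.codRestrict A' ψ hr) ?_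
      intro p p' hpp
      have e : ψ p = ψ p' := congrArg Subtype.val hpp
      apply Subtype.ext
      apply Prod.ext <;> apply Subtype.ext
      · rw [(hψ p).1, (hψ p').1, e]
      · rw [(hψ p).2, (hψ p').2, e]
    have d1 := Submodule.finrank_mono hφ
    have d2 := LinearMap.finrank_range_add_finrank_ker φ
    rw [Module.finrank_prod] at d2
    nlinarith

end KroneckerInequalities

/-! ### Linear representations, semistability and probes -/

/-- Representations of the unframed quiver with relations on complex vector spaces. -/
structure LinRep (V₀ V₁ : Type) [AddCommGroup V₀] [Module ℂ V₀] [AddCommGroup V₁]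
    [Module ℂ V₁] where
  a : Fin 2 → V₀ →ₗ[ℂ] V₁
  b : Fin 2 → V₁ →ₗ[ℂ] V₀
  c : V₀ →ₗ[ℂ] V₀
  d : V₁ →ₗ[ℂ] V₁
  rel_a : ∀ i w, a 1 (b i (a 0 w)) = a 0 (b i (a 1 w))
  rel_b : ∀ i u, b 1 (a i (b 0 u)) = b 0 (a i (b 1 u))
  rel_da : ∀ i w, d (a i w) = a i (c w)
  rel_cb : ∀ i u, c (b i u) = b i (d u)

/-- `Θ(d₀, d₁)`. -/
def wt (Θ : ℝ × ℝ) (d₀ d₁ : ℕ) : ℝ := Θ.1 * d₀ + Θ.2 * d₁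

theorem wt_swap (Θ : ℝ × ℝ) (d₀ d₁ : ℕ) : wt Θ.swap d₀ d₁ = wt Θ d₁ d₀ := by
  simp [wt, add_comm]

/-- The vector `v`, which sits at one of the two vertices, lies in `(U₀, U₁)`. -/
def FrameMem {V₀ V₁ : Type} [AddCommGroup V₀] [Module ℂ V₀] [AddCommGroup V₁] [Module ℂ V₁]
    (v : V₀ ⊕ V₁) (U₀ : Submodule ℂ V₀) (U₁ : Submodule ℂ V₁) : Prop :=
  Sum.elim (· ∈ U₀) (· ∈ U₁) v

/-- Tuples of `n + 1` vectors; their first and last entries have to vanish unless `pt`. -/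
def bdry (pt : Bool) (n : ℕ) (V : Type) [AddCommGroup V] [Module ℂ V] :
    Submodule ℂ (Fin (n + 1) → V) where
  carrier := {w | pt = false → w 0 = 0 ∧ w (Fin.last n) = 0}
  zero_mem' _ := ⟨rfl, rfl⟩
  add_mem' {x y} hx hy h := by
    simp [hx h, hy h]
  smul_mem' t x hx h := by
    simp [hx h]

theorem mem_bdry {pt : Bool} {n : ℕ} {V : Type} [AddCommGroup V] [Module ℂ V]
    {w : Fin (n + 1) → V} :
    w ∈ bdry pt n V ↔ (pt = false → w 0 = 0 ∧ w (Fin.last n) = 0) := Iff.rfl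

namespace LinRep

variable {V₀ V₁ : Type} [AddCommGroup V₀] [Module ℂ V₀] [AddCommGroup V₁] [Module ℂ V₁]

/-- The symmetry of the quiver that exchanges the vertices `0` and `1`. -/
def swap (M : LinRep V₀ V₁) : LinRep V₁ V₀ :=
  ⟨M.b, M.a, M.d, M.c, M.rel_b, M.rel_a, M.rel_cb, M.rel_da⟩

/-- `(U₀, U₁)` is a subrepresentation. -/
structure IsSub (M : LinRep V₀ V₁) (U₀ : Submodule ℂ V₀) (U₁ : Submodule ℂ V₁) : Prop where
  a_mem : ∀ i, ∀ w ∈ U₀, M.a i w ∈ U₁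
  b_mem : ∀ i, ∀ u ∈ U₁, M.b i u ∈ U₀
  c_mem : ∀ w ∈ U₀, M.c w ∈ U₀
  d_mem : ∀ u ∈ U₁, M.d u ∈ U₁

theorem IsSub.swap {M : LinRep V₀ V₁} {U₀ : Submodule ℂ V₀} {U₁ : Submodule ℂ V₁}
    (h : M.IsSub U₀ U₁) : M.swap.IsSub U₁ U₀ :=
  ⟨h.b_mem, h.a_mem, h.d_mem, h.c_mem⟩

/-- No subrepresentation has positive weight. -/
def Nonpos (Θ : ℝ × ℝ) (M : LinRep V₀ V₁) : Prop :=
  ∀ U₀ U₁, M.IsSub U₀ U₁ → wt Θ (finrank ℂ U₀) (finrank ℂ U₁) ≤ 0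

/-- Semistability of the representation framed by `v`. -/
structure Semi (Θ : ℝ × ℝ) (M : LinRep V₀ V₁) (v : V₀ ⊕ V₁) : Prop where
  nonpos : M.Nonpos Θ
  framed : ∀ U₀ U₁, M.IsSub U₀ U₁ → FrameMem v U₀ U₁ →
    wt Θ (finrank ℂ U₀) (finrank ℂ U₁) ≤ wt Θ (finrank ℂ V₀) (finrank ℂ V₁)

theorem Nonpos.swap {Θ : ℝ × ℝ} {M : LinRep V₀ V₁} (h : M.Nonpos Θ) :
    M.swap.Nonpos Θ.swap := fun U₀ U₁ hU => by
  rw [wt_swap]; exact h U₁ U₀ hU.swap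

theorem Semi.swap {Θ : ℝ × ℝ} {M : LinRep V₀ V₁} {v : V₀ ⊕ V₁} (h : M.Semi Θ v) :
    M.swap.Semi Θ.swap v.swap :=
  ⟨h.nonpos.swap, fun U₀ U₁ hU hv => by
    rw [wt_swap, wt_swap]
    exact h.framed U₁ U₀ hU.swap (by cases v <;> exact hv)⟩

/-- The action of the central element `aₖ bₗ`. -/
def x (M : LinRep V₀ V₁) (k l : Fin 2) : V₁ →ₗ[ℂ] V₁ := M.a k ∘ₗ M.b l

theorem x_apply (M : LinRep V₀ V₁) (k l : Fin 2) (u : V₁) : M.x k l u = M.a k (M.b l u) := rfl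

theorem a_b_a (M : LinRep V₀ V₁) (i j k : Fin 2) (w : V₀) :
    M.a i (M.b j (M.a k w)) = M.a k (M.b j (M.a i w)) := by
  fin_cases i <;> fin_cases k <;> first | rfl | exact M.rel_a j w | exact (M.rel_a j w).symm

theorem b_a_b (M : LinRep V₀ V₁) (i j k : Fin 2) (w : V₁) :
    M.b i (M.a j (M.b k w)) = M.b k (M.a j (M.b i w)) := by
  fin_cases i <;> fin_cases k <;> first | rfl | exact M.rel_b j w | exact (M.rel_b j w).symm

/-- The difference map whose cokernel computes a cohomology group of a twist. -/
def diff (M : LinRep V₀ V₁) (n : ℕ) : (Fin (n + 1) → V₀) →ₗ[ℂ] (Fin n → V₁) :=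
  LinearMap.pi fun i => M.a 0 ∘ₗ LinearMap.proj i.succ - M.a 1 ∘ₗ LinearMap.proj i.castSucc

theorem diff_apply (M : LinRep V₀ V₁) (n : ℕ) (w : Fin (n + 1) → V₀) (i : Fin n) :
    M.diff n w i = M.a 0 (w i.succ) - M.a 1 (w i.castSucc) := rfl

/-- The relations that define `probe`. -/
def rel (M : LinRep V₀ V₁) (pt : Bool) (n : ℕ) : Submodule ℂ (Fin n → V₁) :=
  (bdry pt n V₀).map (M.diff n)

/-- For a representation that is a sheaf on `ℙ¹`, this is `H⁰` (or `H¹` if `pt`) of a twist. -/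
abbrev probe (M : LinRep V₀ V₁) (pt : Bool) (n : ℕ) : Type := (Fin n → V₁) ⧸ M.rel pt n

/-- The difference map is injective on tuples with the right boundary values. -/
def DiffInj (M : LinRep V₀ V₁) (pt : Bool) (n : ℕ) : Prop :=
  ∀ w ∈ bdry pt n V₀, M.diff n w = 0 → w = 0

/-! ### Exactness of probes from stability -/

section Injectivity

/-- Tuples in the kernel of the difference map. -/
def chains (M : LinRep V₀ V₁) (pt : Bool) (n : ℕ) : Submodule ℂ (Fin (n + 1) → V₀) :=
  bdry pt n V₀ ⊓ LinearMap.ker (M.diff n)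

theorem chains_step {M : LinRep V₀ V₁} {pt : Bool} {n : ℕ} {w : Fin (n + 1) → V₀}
    (hw : w ∈ M.chains pt n) (i : Fin n) : M.a 0 (w i.succ) = M.a 1 (w i.castSucc) :=
  sub_eq_zero.1 (congrFun (LinearMap.mem_ker.1 hw.2) i)

theorem mem_chains_of_step {M : LinRep V₀ V₁} {pt : Bool} {n : ℕ} {w : Fin (n + 1) → V₀}
    (hb : w ∈ bdry pt n V₀) (h : ∀ i : Fin n, M.a 0 (w i.succ) = M.a 1 (w i.castSucc)) :
    w ∈ M.chains pt n :=
  ⟨hb, LinearMap.mem_ker.2 (funext fun i => sub_eq_zero.2 (h i))⟩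

/-- The span of the entries of the tuples in the kernel of the difference map. -/
def entries (M : LinRep V₀ V₁) (pt : Bool) (n : ℕ) : Submodule ℂ V₀ :=
  ⨆ i : Fin (n + 1), (M.chains pt n).map (LinearMap.proj i)

theorem mem_entries {M : LinRep V₀ V₁} {pt : Bool} {n : ℕ} {w : Fin (n + 1) → V₀}
    (hw : w ∈ M.chains pt n) (i : Fin (n + 1)) : w i ∈ M.entries pt n :=
  Submodule.mem_iSup_of_mem i (Submodule.mem_map_of_mem (f := LinearMap.proj i) hw)

theorem entries_le {M : LinRep V₀ V₁} {pt : Bool} {n : ℕ} {U : Submodule ℂ V₀}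
    (h : ∀ w ∈ M.chains pt n, ∀ i, w i ∈ U) : M.entries pt n ≤ U :=
  iSup_le fun i => by
    rintro _ ⟨w, hw, rfl⟩
    exact h w hw i

/-- The image of the entries under the arrows `0 → 1`. -/
def entryImages (M : LinRep V₀ V₁) (pt : Bool) (n : ℕ) : Submodule ℂ V₁ :=
  (M.entries pt n).map (M.a 0) ⊔ (M.entries pt n).map (M.a 1)

theorem mem_entryImages {M : LinRep V₀ V₁} {pt : Bool} {n : ℕ} {w : V₀}
    (hw : w ∈ M.entries pt n) (k : Fin 2) : M.a k w ∈ M.entryImages pt n := by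
  fin_cases k
  · exact Submodule.mem_sup_left (Submodule.mem_map_of_mem (f := M.a 0) hw)
  · exact Submodule.mem_sup_right (Submodule.mem_map_of_mem (f := M.a 1) hw)

theorem entryImages_le {M : LinRep V₀ V₁} {pt : Bool} {n : ℕ} {U : Submodule ℂ V₁}
    (h : ∀ w ∈ M.entries pt n, ∀ k, M.a k w ∈ U) : M.entryImages pt n ≤ U := by
  refine sup_le ?_ ?_
  · rintro _ ⟨w, hw, rfl⟩
    exact h w hw 0
  · rintro _ ⟨w, hw, rfl⟩
    exact h w hw 1

/-- The operators `b a` and `c` on `V₀` are central, so applied entrywise they map chains to chains.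
Thus the obstruction to injectivity of the difference map generates a subrepresentation that needs
no closure beyond one application of the arrows `a`. -/
theorem entries_isSub (M : LinRep V₀ V₁) (pt : Bool) (n : ℕ) :
    M.IsSub (M.entries pt n) (M.entryImages pt n) := by
  have hba : ∀ k l, M.entries pt n ≤ (M.entries pt n).comap (M.b k ∘ₗ M.a l) := by
    intro k l
    refine entries_le fun w hw i => ?_
    have hw' : (fun i => M.b k (M.a l (w i))) ∈ M.chains pt n := by
      refine mem_chains_of_step (fun hp => ?_) (fun i => ?_)
      · simp [hw.1 hp]
      · rw [M.a_b_a 0 k l, M.a_b_a 1 k l, chains_step hw i]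
    exact mem_entries hw' i
  have hc : M.entries pt n ≤ (M.entries pt n).comap M.c := by
    refine entries_le fun w hw i => ?_
    have hw' : (fun i => M.c (w i)) ∈ M.chains pt n := by
      refine mem_chains_of_step (fun hp => ?_) (fun i => ?_)
      · simp [hw.1 hp]
      · rw [← M.rel_da, ← M.rel_da, chains_step hw i]
    exact mem_entries hw' i
  refine ⟨fun i w hw => mem_entryImages hw i, fun i u hu => ?_, fun w hw => hc hw, fun u hu => ?_⟩
  · have : M.entryImages pt n ≤ (M.entries pt n).comap (M.b i) :=
      entryImages_le fun w hw k => hba i k hw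
    exact this hu
  · have : M.entryImages pt n ≤ (M.entryImages pt n).comap M.d :=
      entryImages_le fun w hw k => by
        change M.d (M.a k w) ∈ M.entryImages pt n
        rw [M.rel_da]
        exact mem_entryImages (hc hw) k
    exact this hu

theorem diffInj_of_entries {M : LinRep V₀ V₁} {pt : Bool} {n : ℕ}
    (h : M.entries pt n = ⊥) : M.DiffInj pt n := by
  intro w hw hd
  ext i
  have := mem_entries (M := M) ⟨hw, LinearMap.mem_ker.2 hd⟩ i
  rwa [h] at this

variable [FiniteDimensional ℂ V₀] [FiniteDimensional ℂ V₁]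

/-- A chain of length `n + 1` is a homomorphism from the preprojective Kronecker module of dimension
`(n + 1, n + 2)`. So the subrepresentation of entries is, as a Kronecker module, a quotient of
copies of it, and the slope inequality for the kernel of that quotient map becomes the reverse one
for the image. -/
theorem finrank_entryImages_le_true (M : LinRep V₀ V₁) (n : ℕ) :
    (n + 1) * finrank ℂ (M.entryImages true n) ≤ (n + 2) * finrank ℂ (M.entries true n) := by
  set E := M.chains true n with hE
  let α : (Fin (n + 1) → E) →ₗ[ℂ] V₀ :=
    ∑ i, LinearMap.proj i ∘ₗ E.subtype ∘ₗ LinearMap.proj i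
  let β : (Fin (n + 2) → E) →ₗ[ℂ] V₁ :=
    (∑ i : Fin (n + 1), M.a 0 ∘ₗ LinearMap.proj i ∘ₗ E.subtype ∘ₗ LinearMap.proj i.castSucc) +
      M.a 1 ∘ₗ LinearMap.proj (Fin.last n) ∘ₗ E.subtype ∘ₗ LinearMap.proj (Fin.last (n + 1))
  have hα : ∀ f, α f = ∑ i, (f i : Fin (n + 1) → V₀) i := fun f => by simp [α]
  have hβ : ∀ f, β f = (∑ i : Fin (n + 1), M.a 0 ((f i.castSucc : Fin (n + 1) → V₀) i)) +
      M.a 1 ((f (Fin.last (n + 1)) : Fin (n + 1) → V₀) (Fin.last n)) := fun f => by simp [β]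
  have h0 : ∀ f, M.a 0 (α f) = β (Fin.snoc f 0) := by
    intro f
    rw [hα, hβ, map_sum]
    simp
  have h1 : ∀ f, M.a 1 (α f) = β (Fin.cons 0 f) := by
    intro f
    rw [hα, hβ, map_sum, Fin.sum_univ_castSucc, Fin.sum_univ_succ, ← Fin.succ_last, Fin.cons_succ]
    simpa using Finset.sum_congr rfl fun i _ => (chains_step (f (Fin.castSucc i)).2 i).symm
  have rα : LinearMap.range α = M.entries true n := by
    apply le_antisymm
    · rintro _ ⟨f, rfl⟩
      rw [hα]
      exact Submodule.sum_mem _ fun i _ => mem_entries (f i).2 i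
    · refine entries_le fun w hw i => ⟨Pi.single i ⟨w, hw⟩, ?_⟩
      rw [hα, Finset.sum_eq_single i]
      · simp
      · intro j _ hj
        simp [hj]
      · simp
  have rβ : LinearMap.range β = M.entryImages true n := by
    apply le_antisymm
    · rintro _ ⟨f, rfl⟩
      rw [hβ]
      exact Submodule.add_mem _ (Submodule.sum_mem _ fun i _ =>
        mem_entryImages (mem_entries (f _).2 i) 0) (mem_entryImages (mem_entries (f _).2 _) 1)
    · refine entryImages_le fun w hw k => ?_
      rw [← rα] at hw
      obtain ⟨f, rfl⟩ := hw
      fin_cases k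
      · exact ⟨_, (h0 f).symm⟩
      · exact ⟨_, (h1 f).symm⟩
  have key := finrank_le_of_extend (n + 1) (LinearMap.ker α) (LinearMap.ker β)
    (fun f hf => by rw [LinearMap.mem_ker, ← h1, LinearMap.mem_ker.1 hf, map_zero])
    (fun f hf => by rw [LinearMap.mem_ker, ← h0, LinearMap.mem_ker.1 hf, map_zero])
  have dα := LinearMap.finrank_range_add_finrank_ker α
  have dβ := LinearMap.finrank_range_add_finrank_ker β
  rw [rα, Module.finrank_pi_fintype] at dα
  rw [rβ, Module.finrank_pi_fintype] at dβ
  simp only [Finset.sum_const, Finset.card_univ, Fintype.card_fin, smul_eq_mul] at dα dβ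
  nlinarith

/-- With vanishing ends only `m + 1` interior entries remain, and both outer images under the arrows
vanish. The entries are therefore a quotient of copies of the preinjective module of dimension `(m +
1, m)`. -/
theorem finrank_entryImages_le_false (M : LinRep V₀ V₁) (m : ℕ) :
    (m + 1) * finrank ℂ (M.entryImages false (m + 2)) ≤
      m * finrank ℂ (M.entries false (m + 2)) := by
  set E := M.chains false (m + 2) with hE
  let α : (Fin (m + 1) → E) →ₗ[ℂ] V₀ :=
    ∑ i : Fin (m + 1), LinearMap.proj i.castSucc.succ ∘ₗ E.subtype ∘ₗ LinearMap.proj i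
  let β : (Fin m → E) →ₗ[ℂ] V₁ :=
    ∑ i : Fin m, M.a 0 ∘ₗ LinearMap.proj i.succ.castSucc.succ ∘ₗ E.subtype ∘ₗ LinearMap.proj i
  have hα : ∀ f, α f = ∑ i : Fin (m + 1), (f i : Fin (m + 3) → V₀) i.castSucc.succ :=
    fun f => by simp [α]
  have hβ : ∀ f, β f = ∑ i : Fin m, M.a 0 ((f i : Fin (m + 3) → V₀) i.succ.castSucc.succ) :=
    fun f => by simp [β]
  have h0 : ∀ f, M.a 0 (α f) = β (fun i => f i.succ) := by
    intro f
    rw [hα, hβ, map_sum, Fin.sum_univ_succ]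
    have e := chains_step (f 0).2 0
    rw [Fin.castSucc_zero, ((f 0).2.1 rfl).1, map_zero] at e
    rw [Fin.castSucc_zero, e, zero_add]
  have h1 : ∀ f, M.a 1 (α f) = β (fun i => f i.castSucc) := by
    intro f
    rw [hα, hβ, map_sum, Fin.sum_univ_castSucc]
    have e := chains_step (f (Fin.last m)).2 (Fin.last (m + 1))
    rw [Fin.succ_last, ((f (Fin.last m)).2.1 rfl).2, map_zero] at e
    have e2 : (Fin.last m).castSucc.succ = (Fin.last (m + 1)).castSucc := by
      ext; simp
    rw [e2, ← e, add_zero]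
    refine Finset.sum_congr rfl fun i _ => ?_
    have e := chains_step (f i.castSucc).2 i.succ.castSucc
    rw [e]
    congr 1
  have rα : LinearMap.range α = M.entries false (m + 2) := by
    apply le_antisymm
    · rintro _ ⟨f, rfl⟩
      rw [hα]
      exact Submodule.sum_mem _ fun i _ => mem_entries (f i).2 _
    · refine entries_le fun w hw i => ?_
      refine Fin.cases ?_ (fun j => ?_) i
      · rw [(hw.1 rfl).1]; exact Submodule.zero_mem _
      refine Fin.lastCases ?_ (fun i => ?_) j
      · rw [Fin.succ_last, (hw.1 rfl).2]; exact Submodule.zero_mem _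
      refine ⟨Pi.single i ⟨w, hw⟩, ?_⟩
      rw [hα, Finset.sum_eq_single i]
      · simp
      · intro j _ hj
        simp [hj]
      · simp
  have rβ : LinearMap.range β = M.entryImages false (m + 2) := by
    apply le_antisymm
    · rintro _ ⟨f, rfl⟩
      rw [hβ]
      exact Submodule.sum_mem _ fun i _ => mem_entryImages (mem_entries (f _).2 _) 0
    · refine entryImages_le fun w hw k => ?_
      rw [← rα] at hw
      obtain ⟨f, rfl⟩ := hw
      fin_cases k
      · exact ⟨_, (h0 f).symm⟩
      · exact ⟨_, (h1 f).symm⟩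
  have key := finrank_le_of_drop m (LinearMap.ker α) (LinearMap.ker β)
    (fun f hf => by rw [LinearMap.mem_ker, ← h0, LinearMap.mem_ker.1 hf, map_zero])
    (fun f hf => by rw [LinearMap.mem_ker, ← h1, LinearMap.mem_ker.1 hf, map_zero])
  have dα := LinearMap.finrank_range_add_finrank_ker α
  have dβ := LinearMap.finrank_range_add_finrank_ker β
  rw [rα, Module.finrank_pi_fintype] at dα
  rw [rβ, Module.finrank_pi_fintype] at dβ
  simp only [Finset.sum_const, Finset.card_univ, Fintype.card_fin, smul_eq_mul] at dα dβ
  nlinarith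

/-- If the kernel were nonzero, the entries would span a subrepresentation of positive weight, by
the slope bound and the hypothesis on `Θ`. -/
theorem Nonpos.diffInj_true {Θ : ℝ × ℝ} {M : LinRep V₀ V₁} (h : M.Nonpos Θ) {n : ℕ}
    (h1 : Θ.2 < 0) (h2 : 0 < (n + 1 : ℝ) * Θ.1 + (n + 2 : ℝ) * Θ.2) : M.DiffInj true n := by
  refine diffInj_of_entries (Submodule.finrank_eq_zero.1 ?_)
  have k1 := h _ _ (M.entries_isSub true n)
  have k2 : ((n + 1) * finrank ℂ (M.entryImages true n) : ℝ) ≤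
      (n + 2) * finrank ℂ (M.entries true n) := by
    exact_mod_cast M.finrank_entryImages_le_true n
  rw [wt] at k1
  by_contra h0
  have k3 : (0 : ℝ) < finrank ℂ (M.entries true n) := by
    exact_mod_cast Nat.pos_of_ne_zero h0
  have k4 : (0 : ℝ) < n + 1 := by positivity
  nlinarith [mul_pos k3 h2, mul_le_mul_of_nonpos_left k2 h1.le, mul_nonpos_of_nonneg_of_nonpos k4.le k1]

theorem diffInj_false_one (M : LinRep V₀ V₁) : M.DiffInj false 1 := by
  intro w hw _
  ext i
  fin_cases i
  · exact (hw rfl).1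
  · exact (hw rfl).2

theorem Nonpos.diffInj_false {Θ : ℝ × ℝ} {M : LinRep V₀ V₁} (h : M.Nonpos Θ) {m : ℕ}
    (h1 : Θ.2 < 0) (h2 : 0 < (m + 1 : ℝ) * Θ.1 + (m : ℝ) * Θ.2) : M.DiffInj false (m + 2) := by
  refine diffInj_of_entries (Submodule.finrank_eq_zero.1 ?_)
  have k1 := h _ _ (M.entries_isSub false (m + 2))
  have k2 : ((m + 1) * finrank ℂ (M.entryImages false (m + 2)) : ℝ) ≤
      m * finrank ℂ (M.entries false (m + 2)) := by
    exact_mod_cast M.finrank_entryImages_le_false m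
  rw [wt] at k1
  by_contra h0
  have k3 : (0 : ℝ) < finrank ℂ (M.entries false (m + 2)) := by
    exact_mod_cast Nat.pos_of_ne_zero h0
  have k4 : (0 : ℝ) < m + 1 := by positivity
  nlinarith [mul_pos k3 h2, mul_le_mul_of_nonpos_left k2 h1.le, mul_nonpos_of_nonneg_of_nonpos k4.le k1]

end Injectivity

end LinRep
namespace LinRep

variable {V₀ V₁ : Type} [AddCommGroup V₀] [Module ℂ V₀] [AddCommGroup V₁] [Module ℂ V₁]

/-! ### Generation of probes by the framing -/

section Slots

variable {n : ℕ}

/-- Vectors at the vertex `1` all of whose copies lie in `N`. -/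
def slots₁ (N : Submodule ℂ (Fin n → V₁)) : Submodule ℂ V₁ :=
  ⨅ i, N.comap (LinearMap.single ℂ (fun _ => V₁) i)

theorem mem_slots₁ {N : Submodule ℂ (Fin n → V₁)} {u : V₁} :
    u ∈ slots₁ N ↔ ∀ i, Pi.single i u ∈ N := by
  simp [slots₁]

/-- Vectors at the vertex `0` that are mapped to `slots₁ N`. -/
def slots₀ (M : LinRep V₀ V₁) (N : Submodule ℂ (Fin n → V₁)) : Submodule ℂ V₀ :=
  ⨅ k, (slots₁ N).comap (M.a k)

theorem mem_slots₀ {M : LinRep V₀ V₁} {N : Submodule ℂ (Fin n → V₁)} {w : V₀} :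
    w ∈ M.slots₀ N ↔ ∀ k, M.a k w ∈ slots₁ N := by
  simp only [slots₀, Submodule.mem_iInf, Submodule.mem_comap]

/-- `N` is stable under the central elements of the path algebra. -/
structure CentralStable (M : LinRep V₀ V₁) (N : Submodule ℂ (Fin n → V₁)) : Prop where
  x_mem : ∀ k l, ∀ F ∈ N, (fun i => M.x k l (F i)) ∈ N
  d_mem : ∀ F ∈ N, (fun i => M.d (F i)) ∈ N

theorem comp_single (f : V₁ →ₗ[ℂ] V₁) (i : Fin n) (u : V₁) :
    (fun j => f ((Pi.single i u : Fin n → V₁) j)) = Pi.single i (f u) := by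
  ext j
  by_cases h : j = i
  · subst h; simp
  · simp [h]

/-- This turns a central submodule of tuples into a subrepresentation, to which the framed stability
inequality applies. -/
theorem CentralStable.isSub {M : LinRep V₀ V₁} {N : Submodule ℂ (Fin n → V₁)}
    (h : M.CentralStable N) : M.IsSub (M.slots₀ N) (slots₁ N) := by
  have hd : ∀ u ∈ slots₁ N, M.d u ∈ slots₁ N := fun u hu => mem_slots₁.2 fun i => by
    rw [← comp_single M.d]
    exact h.d_mem _ (mem_slots₁.1 hu i)
  refine ⟨fun i w hw => mem_slots₀.1 hw i, fun l u hu => mem_slots₀.2 fun k => ?_,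
    fun w hw => mem_slots₀.2 fun k => ?_, hd⟩
  · refine mem_slots₁.2 fun i => ?_
    rw [← M.x_apply, ← comp_single (M.x k l)]
    exact h.x_mem k l _ (mem_slots₁.1 hu i)
  · rw [← M.rel_da]
    exact hd _ (mem_slots₀.1 hw k)

theorem eq_top_of_slots₁ {N : Submodule ℂ (Fin n → V₁)} (h : slots₁ N = ⊤) : N = ⊤ := by
  rw [eq_top_iff]
  intro F _
  have : F = ∑ i, Pi.single i (F i) := (Finset.univ_sum_single F).symm
  rw [this]
  exact Submodule.sum_mem _ fun i _ => mem_slots₁.1 (h ▸ Submodule.mem_top : F i ∈ slots₁ N) i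

theorem diff_single_interior (M : LinRep V₀ V₁) (w : V₀) (j : Fin n) :
    M.diff (n + 1) (Pi.single j.castSucc.succ w) =
      Pi.single j.castSucc (M.a 0 w) - Pi.single j.succ (M.a 1 w) := by
  ext i
  rw [diff_apply, Pi.sub_apply]
  congr 1
  · by_cases h : i = j.castSucc
    · subst h; simp
    · rw [Pi.single_eq_of_ne h, Pi.single_eq_of_ne, map_zero]
      exact fun e => h (Fin.succ_injective _ e)
  · by_cases h : i = j.succ
    · subst h; rw [← Fin.succ_castSucc]; simp
    · rw [Pi.single_eq_of_ne h, Pi.single_eq_of_ne, map_zero]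
      rw [Fin.succ_castSucc]
      exact fun e => h (Fin.castSucc_injective _ e)

theorem single_interior_mem (pt : Bool) (w : V₀) (j : Fin n) :
    Pi.single j.castSucc.succ w ∈ bdry pt (n + 1) V₀ := fun _ => by
  refine ⟨Pi.single_eq_of_ne (Fin.succ_ne_zero _).symm _, Pi.single_eq_of_ne ?_ _⟩
  rw [← Fin.succ_last]
  exact fun e => (Fin.castSucc_lt_last j).ne' (Fin.succ_injective _ e)

theorem single_interior_sub_mem_rel (M : LinRep V₀ V₁) (pt : Bool) (w : V₀) (j : Fin n) :
    Pi.single j.castSucc (M.a 0 w) - Pi.single j.succ (M.a 1 w) ∈ M.rel pt (n + 1) :=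
  ⟨_, single_interior_mem pt w j, M.diff_single_interior w j⟩

theorem single_zero_mem_rel (M : LinRep V₀ V₁) (w : V₀) :
    Pi.single 0 (M.a 1 w) ∈ M.rel true (n + 1) := by
  refine ⟨Pi.single 0 (-w), fun h => by simp at h, ?_⟩
  ext i
  rw [diff_apply]
  refine Fin.cases ?_ (fun i => ?_) i
  · simp
  · rw [← Fin.succ_castSucc]; simp

theorem single_last_mem_rel (M : LinRep V₀ V₁) (w : V₀) :
    Pi.single (Fin.last n) (M.a 0 w) ∈ M.rel true (n + 1) := by
  refine ⟨Pi.single (Fin.last (n + 1)) w, fun h => by simp at h, ?_⟩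
  ext i
  rw [diff_apply]
  refine Fin.lastCases ?_ (fun i => ?_) i
  · rw [Fin.succ_last, Pi.single_eq_same, Pi.single_eq_same, Pi.single_eq_of_ne, map_zero, sub_zero]
    exact (Fin.castSucc_lt_last _).ne
  · rw [Fin.succ_castSucc, Pi.single_eq_of_ne (Fin.castSucc_lt_last _).ne,
      Pi.single_eq_of_ne (Fin.castSucc_lt_last _).ne,
      Pi.single_eq_of_ne (Fin.castSucc_lt_last _).ne, map_zero, map_zero, sub_zero]

variable [FiniteDimensional ℂ V₀] [FiniteDimensional ℂ V₁]

/-- A vector at the vertex `1` as a tuple of its copies modulo `N`. -/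
def slotMap (N : Submodule ℂ (Fin n → V₁)) : V₁ →ₗ[ℂ] (Fin n → (Fin n → V₁) ⧸ N) :=
  LinearMap.pi fun i => N.mkQ ∘ₗ LinearMap.single ℂ (fun _ => V₁) i

theorem slotMap_apply (N : Submodule ℂ (Fin n → V₁)) (u : V₁) (i : Fin n) :
    slotMap N u i = N.mkQ (Pi.single i u) := rfl

theorem slotMap_eq_zero {N : Submodule ℂ (Fin n → V₁)} {u : V₁} :
    slotMap N u = 0 ↔ u ∈ slots₁ N := by
  rw [mem_slots₁, funext_iff]
  exact forall_congr' fun i => by rw [slotMap_apply, Pi.zero_apply, Submodule.mkQ_apply,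
    Submodule.Quotient.mk_eq_zero]

theorem finrank_slots₁ (N : Submodule ℂ (Fin n → V₁)) :
    finrank ℂ (LinearMap.range (slotMap N)) + finrank ℂ (slots₁ N) = finrank ℂ V₁ := by
  rw [show slots₁ N = LinearMap.ker (slotMap N) from
    Submodule.ext fun u => slotMap_eq_zero.symm]
  exact LinearMap.finrank_range_add_finrank_ker (slotMap N)

theorem mkQ_interior (M : LinRep V₀ V₁) {pt : Bool} {N : Submodule ℂ (Fin (n + 1) → V₁)}
    (hN : M.rel pt (n + 1) ≤ N) (w : V₀) (j : Fin n) :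
    N.mkQ (Pi.single j.castSucc (M.a 0 w)) = N.mkQ (Pi.single j.succ (M.a 1 w)) := by
  rw [← sub_eq_zero, ← map_sub, Submodule.mkQ_apply, Submodule.Quotient.mk_eq_zero]
  exact hN (M.single_interior_sub_mem_rel pt w j)

/-- The relations in `N` identify the `a 0`-image in one slot with the `a 1`-image in the next. So a
vector of `V₀` is recorded by `n + 2` classes, and the quotient by the slots embeds in copies of the
preinjective module of dimension `(n + 2, n + 1)`. -/
theorem finrank_slots_false (M : LinRep V₀ V₁) {N : Submodule ℂ (Fin (n + 1) → V₁)}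
    (hN : M.rel false (n + 1) ≤ N) :
    (n + 1) * ((finrank ℂ V₀ : ℝ) - finrank ℂ (M.slots₀ N)) ≤
      (n + 2) * ((finrank ℂ V₁ : ℝ) - finrank ℂ (slots₁ N)) := by
  let s : V₀ →ₗ[ℂ] (Fin (n + 2) → (Fin (n + 1) → V₁) ⧸ N) :=
    LinearMap.pi (Fin.cases (N.mkQ ∘ₗ LinearMap.single ℂ (fun _ => V₁) 0 ∘ₗ M.a 1)
      (fun i => N.mkQ ∘ₗ LinearMap.single ℂ (fun _ => V₁) i ∘ₗ M.a 0))
  have e0 : ∀ w i, s w (Fin.succ i) = slotMap N (M.a 0 w) i := fun w i => rfl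
  have e1 : ∀ w i, s w (Fin.castSucc i) = slotMap N (M.a 1 w) i := by
    intro w i
    refine Fin.cases rfl (fun j => ?_) i
    rw [← Fin.succ_castSucc, e0, slotMap_apply, slotMap_apply]
    exact M.mkQ_interior hN w j
  have hs : M.slots₀ N = LinearMap.ker s := by
    ext w
    rw [mem_slots₀, LinearMap.mem_ker]
    constructor
    · intro h
      ext i
      refine Fin.cases ?_ (fun j => ?_) i
      · exact (e1 w 0).trans (congrFun (slotMap_eq_zero.2 (h 1)) 0)
      · exact (e0 w j).trans (congrFun (slotMap_eq_zero.2 (h 0)) j)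
    · intro h k
      rw [← slotMap_eq_zero]
      ext i
      fin_cases k
      · exact (e0 w i).symm.trans (congrFun h _)
      · exact (e1 w i).symm.trans (congrFun h _)
  have key := finrank_le_of_drop (n + 1) (LinearMap.range s) (LinearMap.range (slotMap N))
    (by rintro _ ⟨w, rfl⟩; exact ⟨M.a 0 w, funext fun i => (e0 w i).symm⟩)
    (by rintro _ ⟨w, rfl⟩; exact ⟨M.a 1 w, funext fun i => (e1 w i).symm⟩)
  have d0 := LinearMap.finrank_range_add_finrank_ker s
  rw [← hs] at d0
  rw [← d0, ← finrank_slots₁ N]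
  push_cast
  have : ((n + 1) * finrank ℂ (LinearMap.range s) : ℝ) ≤
      (n + 1 + 1) * finrank ℂ (LinearMap.range (slotMap N)) := by exact_mod_cast key
  linarith

/-- Here the two extreme classes vanish as well, leaving `n` of them; the quotient embeds in copies
of the preprojective module of dimension `(n, n + 1)`. -/
theorem finrank_slots_true (M : LinRep V₀ V₁) {N : Submodule ℂ (Fin (n + 1) → V₁)}
    (hN : M.rel true (n + 1) ≤ N) :
    (n + 1) * ((finrank ℂ V₀ : ℝ) - finrank ℂ (M.slots₀ N)) ≤
      n * ((finrank ℂ V₁ : ℝ) - finrank ℂ (slots₁ N)) := by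
  let s : V₀ →ₗ[ℂ] (Fin n → (Fin (n + 1) → V₁) ⧸ N) :=
    LinearMap.pi fun i => N.mkQ ∘ₗ LinearMap.single ℂ (fun _ => V₁) i.castSucc ∘ₗ M.a 0
  have e0 : ∀ w, slotMap N (M.a 0 w) = Fin.snoc (s w) 0 := by
    intro w
    ext i
    refine Fin.lastCases ?_ (fun j => ?_) i
    · rw [slotMap_apply, Fin.snoc_last, Submodule.mkQ_apply, Submodule.Quotient.mk_eq_zero]
      exact hN (M.single_last_mem_rel w)
    · rw [Fin.snoc_castSucc]; rfl
  have e1 : ∀ w, slotMap N (M.a 1 w) = Fin.cons 0 (s w) := by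
    intro w
    ext i
    refine Fin.cases ?_ (fun j => ?_) i
    · rw [slotMap_apply, Fin.cons_zero, Submodule.mkQ_apply, Submodule.Quotient.mk_eq_zero]
      exact hN (M.single_zero_mem_rel w)
    · rw [Fin.cons_succ, slotMap_apply]
      exact (M.mkQ_interior hN w j).symm
  have hs : M.slots₀ N = LinearMap.ker s := by
    ext w
    rw [mem_slots₀, LinearMap.mem_ker]
    constructor
    · intro h
      ext j
      have := congrFun (slotMap_eq_zero.2 (h 0)) j.castSucc
      rw [e0, Fin.snoc_castSucc] at this
      exact this
    · intro h k
      rw [← slotMap_eq_zero]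
      fin_cases k
      · exact (e0 w).trans (by
          rw [h]; ext i; refine Fin.lastCases ?_ (fun j => ?_) i <;> simp)
      · exact (e1 w).trans (by
          rw [h]; ext i; refine Fin.cases ?_ (fun j => ?_) i <;> simp)
  have key := finrank_le_of_extend n (LinearMap.range s) (LinearMap.range (slotMap N))
    (by rintro _ ⟨w, rfl⟩; exact ⟨M.a 1 w, e1 w⟩)
    (by rintro _ ⟨w, rfl⟩; exact ⟨M.a 0 w, e0 w⟩)
  have d0 := LinearMap.finrank_range_add_finrank_ker s
  rw [← hs] at d0
  rw [← d0, ← finrank_slots₁ N]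
  push_cast
  have : ((n + 1) * finrank ℂ (LinearMap.range s) : ℝ) ≤
      n * finrank ℂ (LinearMap.range (slotMap N)) := by exact_mod_cast key
  linarith

/-- The probe of `M` is generated over the centre by the image of the framing. -/
def Generated (M : LinRep V₀ V₁) (v : V₀ ⊕ V₁) (pt : Bool) (n : ℕ) : Prop :=
  ∀ N : Submodule ℂ (Fin n → V₁), M.rel pt n ≤ N → M.CentralStable N →
    FrameMem v (M.slots₀ N) (slots₁ N) → N = ⊤

/-- Framed semistability makes the weight of the quotient by the slots nonnegative, while the slope
bound makes it negative unless its part at the vertex `1` is zero. -/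
theorem Semi.generated_false {Θ : ℝ × ℝ} {M : LinRep V₀ V₁} {v : V₀ ⊕ V₁} (h : M.Semi Θ v)
    (h1 : Θ.2 < 0) (h2 : (n + 2 : ℝ) * Θ.1 + (n + 1 : ℝ) * Θ.2 < 0) :
    M.Generated v false (n + 1) := by
  intro N hN hc hv
  have k1 := h.framed _ _ hc.isSub hv
  have k2 := M.finrank_slots_false hN
  have k3 : (finrank ℂ (slots₁ N) : ℝ) ≤ finrank ℂ V₁ := by
    exact_mod_cast Submodule.finrank_le _
  have k5 : (finrank ℂ (M.slots₀ N) : ℝ) ≤ finrank ℂ V₀ := by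
    exact_mod_cast Submodule.finrank_le _
  rw [wt, wt] at k1
  refine eq_top_of_slots₁ (Submodule.eq_top_of_finrank_eq ?_)
  by_contra hne
  have k4 : (finrank ℂ (slots₁ N) : ℝ) < finrank ℂ V₁ :=
    lt_of_le_of_ne k3 (by exact_mod_cast hne)
  set A := (finrank ℂ V₀ : ℝ) - finrank ℂ (M.slots₀ N)
  set B := (finrank ℂ V₁ : ℝ) - finrank ℂ (slots₁ N)
  have hA : 0 ≤ A := sub_nonneg.2 k5
  have hB : 0 < B := sub_pos.2 k4
  have k6 : 0 ≤ Θ.1 * A + Θ.2 * B := by simp only [A, B]; linarith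
  have hn : (0 : ℝ) < n + 1 := by positivity
  -- The slope bound helps only for positive `Θ.1`; otherwise both terms of the weight have the
  -- right sign already.
  rcases le_or_gt Θ.1 0 with ht | ht
  · nlinarith [mul_neg_of_neg_of_pos h1 hB, mul_nonneg_of_nonpos_of_nonpos ht (neg_nonpos.2 hA)]
  · nlinarith [mul_le_mul_of_nonneg_left k2 ht.le, mul_neg_of_neg_of_pos h2 hB,
      mul_nonneg hn.le k6]

theorem Semi.generated_true {Θ : ℝ × ℝ} {M : LinRep V₀ V₁} {v : V₀ ⊕ V₁} (h : M.Semi Θ v)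
    (h1 : 0 < Θ.1) (h2 : (n - 1 : ℝ) * Θ.1 + n * Θ.2 < 0) :
    M.Generated v true n := by
  intro N hN hc hv
  rcases n with _ | n
  · exact Subsingleton.elim _ _
  have k1 := h.framed _ _ hc.isSub hv
  have k2 := M.finrank_slots_true hN
  have k3 : (finrank ℂ (slots₁ N) : ℝ) ≤ finrank ℂ V₁ := by
    exact_mod_cast Submodule.finrank_le _
  rw [wt, wt] at k1
  push_cast at h2
  refine eq_top_of_slots₁ (Submodule.eq_top_of_finrank_eq ?_)
  by_contra hne
  have k4 : (finrank ℂ (slots₁ N) : ℝ) < finrank ℂ V₁ :=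
    lt_of_le_of_ne k3 (by exact_mod_cast hne)
  set A := (finrank ℂ V₀ : ℝ) - finrank ℂ (M.slots₀ N)
  set B := (finrank ℂ V₁ : ℝ) - finrank ℂ (slots₁ N)
  have hB : 0 < B := sub_pos.2 k4
  have k6 : 0 ≤ Θ.1 * A + Θ.2 * B := by simp only [A, B]; linarith
  have hn : (0 : ℝ) < n + 1 := by positivity
  nlinarith [mul_le_mul_of_nonneg_left k2 h1.le, mul_neg_of_neg_of_pos h2 hB, mul_nonneg hn.le k6]

end Slots

/-! ### Dimension of an exact probe -/

section Dimension

variable [FiniteDimensional ℂ V₀] [FiniteDimensional ℂ V₁]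

theorem finrank_bdry_true (n : ℕ) (V : Type) [AddCommGroup V] [Module ℂ V]
    [FiniteDimensional ℂ V] : finrank ℂ (bdry true n V) = (n + 1) * finrank ℂ V := by
  have : bdry true n V = ⊤ := eq_top_iff.2 fun w _ h => by simp at h
  rw [this, finrank_top, Module.finrank_pi_fintype]
  simp

theorem finrank_bdry_false (n : ℕ) (V : Type) [AddCommGroup V] [Module ℂ V]
    [FiniteDimensional ℂ V] : finrank ℂ (bdry false (n + 1) V) = n * finrank ℂ V := by
  let e : (Fin (n + 2) → V) →ₗ[ℂ] V × V :=
    (LinearMap.proj 0).prod (LinearMap.proj (Fin.last (n + 1)))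
  have h : bdry false (n + 1) V = LinearMap.ker e := by
    ext w
    simp [mem_bdry, e]
  have hs : LinearMap.range e = ⊤ := by
    rw [LinearMap.range_eq_top]
    rintro ⟨x, y⟩
    refine ⟨Fin.cons x (fun _ => y), ?_⟩
    simp [e, ← Fin.succ_last]
  have := LinearMap.finrank_range_add_finrank_ker e
  rw [← h, hs, finrank_top, Module.finrank_prod, Module.finrank_pi_fintype] at this
  simp only [Finset.sum_const, Finset.card_univ, Fintype.card_fin, smul_eq_mul] at this
  linarith

theorem DiffInj.finrank_probe {M : LinRep V₀ V₁} {pt : Bool} {n : ℕ} (h : M.DiffInj pt n) :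
    finrank ℂ (M.probe pt n) + finrank ℂ (bdry pt n V₀) = n * finrank ℂ V₁ := by
  have h1 : finrank ℂ (M.rel pt n) = finrank ℂ (bdry pt n V₀) := by
    have hi : Function.Injective (M.diff n ∘ₗ (bdry pt n V₀).subtype) := by
      rw [← LinearMap.ker_eq_bot, LinearMap.ker_eq_bot']
      rintro ⟨w, hw⟩ h0
      exact Subtype.ext (h w hw h0)
    rw [← LinearMap.finrank_range_of_inj hi, LinearMap.range_comp, Submodule.range_subtype, rel]
  rw [← h1, Submodule.finrank_quotient_add_finrank, Module.finrank_pi_fintype]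
  simp

end Dimension
end LinRep

/-! ### Exponents of monomials -/

section Exponents

/-- The exponent vector of `aₖ bₗ`. -/
def shX (k l : Fin 2) : Fin 5 → ℕ := ![![1, 0] k, ![0, 1] k, ![1, 0] l, ![0, 1] l, 0]

/-- The exponent vector of the central loop. -/
def shZ : Fin 5 → ℕ := ![0, 0, 0, 0, 1]

/-- The exponent vectors of monomials in `a₁, a₂, b₁, b₂, z` with `q - 1` more factors `a` than
factors `b`. -/
def Deg (q : ℕ) (e : Fin 5 → ℕ) : Prop := 0 < q ∧ e 0 + e 1 + 1 = q + e 2 + e 3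

theorem deg_add_shX {q : ℕ} {k l : Fin 2} {e : Fin 5 → ℕ} : Deg q (e + shX k l) ↔ Deg q e := by
  fin_cases k <;> fin_cases l <;> simp [Deg, shX] <;> intros <;> omega

theorem deg_add_shZ {q : ℕ} {e : Fin 5 → ℕ} : Deg q (e + shZ) ↔ Deg q e := by
  simp [Deg, shZ]

theorem ext5 {e e' : Fin 5 → ℕ} (h0 : e 0 = e' 0) (h1 : e 1 = e' 1) (h2 : e 2 = e' 2)
    (h3 : e 3 = e' 3) (h4 : e 4 = e' 4) : e = e' := by
  ext i; fin_cases i <;> assumption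

/-- Every such monomial is a product of central elements with a pure monomial of degree `q - 1` in
the `a`: the degree condition always provides a factor `a` to pair with a factor `b`. -/
theorem deg_induction {q : ℕ} {P : (Fin 5 → ℕ) → Prop}
    (hg : ∀ i < q, P ![i, q - 1 - i, 0, 0, 0])
    (hx : ∀ k l e, Deg q e → P e → P (e + shX k l))
    (hz : ∀ e, Deg q e → P e → P (e + shZ)) : ∀ e, Deg q e → P e := by
  suffices ∀ n e, e 2 + e 3 + e 4 = n → Deg q e → P e from fun e => this _ e rfl
  intro n
  induction n with
  | zero =>
    intro e hn he
    have : e = ![e 0, q - 1 - e 0, 0, 0, 0] := by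
      unfold Deg at he
      apply ext5 <;> simp <;> omega
    rw [this]
    refine hg _ ?_
    unfold Deg at he
    omega
  | succ n ih =>
    intro e hn he
    by_cases h4 : e 4 = 0
    · have hk : ∃ k : Fin 2, ∃ l : Fin 2, ∃ e', e = e' + shX k l := by
        unfold Deg at he
        by_cases h2 : e 2 = 0
        · by_cases h0 : e 0 = 0
          · refine ⟨1, 1, ![e 0, e 1 - 1, e 2, e 3 - 1, e 4], ?_⟩
            apply ext5 <;> simp [shX] <;> omega
          · refine ⟨0, 1, ![e 0 - 1, e 1, e 2, e 3 - 1, e 4], ?_⟩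
            apply ext5 <;> simp [shX] <;> omega
        · by_cases h0 : e 0 = 0
          · refine ⟨1, 0, ![e 0, e 1 - 1, e 2 - 1, e 3, e 4], ?_⟩
            apply ext5 <;> simp [shX] <;> omega
          · refine ⟨0, 0, ![e 0 - 1, e 1, e 2 - 1, e 3, e 4], ?_⟩
            apply ext5 <;> simp [shX] <;> omega
      obtain ⟨k, l, e', rfl⟩ := hk
      rw [deg_add_shX] at he
      refine hx k l e' he (ih e' ?_ he)
      fin_cases k <;> fin_cases l <;> simp [shX] at hn ⊢ <;> omega
    · obtain ⟨e', rfl⟩ : ∃ e', e = e' + shZ := by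
        refine ⟨![e 0, e 1, e 2, e 3, e 4 - 1], ?_⟩
        apply ext5 <;> simp [shZ] <;> omega
      rw [deg_add_shZ] at he
      refine hz e' he (ih e' ?_ he)
      simp [shZ] at hn ⊢
      omega

/-- The value of a monomial. -/
def mon (s : Fin 5 → ℂ) (e : Fin 5 → ℕ) : ℂ := ∏ i, s i ^ e i

theorem mon_add (s : Fin 5 → ℂ) (e f : Fin 5 → ℕ) : mon s (e + f) = mon s e * mon s f := by
  simp [mon, pow_add, Finset.prod_mul_distrib]

theorem mon_one (e : Fin 5 → ℕ) : mon 1 e = 1 := by simp [mon]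

/-- The torus element `s` separates monomials up to powers of the product of all variables. -/
def Generic (s : Fin 5 → ℂ) : Prop :=
  ∀ e e', mon s e = mon s e' → ∀ i j, e i + e' j = e' i + e j

/-- Powers of the product of all variables are central; this is the direction in which the weights
of the Calabi-Yau torus are blind. -/
theorem deg_one_const (m : ℕ) : Deg 1 (fun _ => m) := by simp [Deg]; omega

end Exponents

/-! ### Well-defined action of monomials on the generators -/

section Words

/-- Monomials in the central elements, applied to generators, depend only on their degree. -/
theorem word_unique {R W : Type} [CommRing R] [AddCommGroup W] [Module R W]
    {x00 x01 x10 x11 : R} (hx : x00 * x11 = x01 * x10) {g : ℕ → W} {q : ℕ}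
    (h0 : ∀ i, i + 1 < q → x10 • g (i + 1) = x00 • g i)
    (h1 : ∀ i, i + 1 < q → x11 • g (i + 1) = x01 • g i) (k : ℕ) :
    ∀ i a b c d i' a' b' c' d', i = i' + k → i < q → i + a + b = i' + a' + b' →
      a + c = a' + c' → b + d = b' + d' →
      (x00 ^ a * x01 ^ b * x10 ^ c * x11 ^ d) • g i =
        (x00 ^ a' * x01 ^ b' * x10 ^ c' * x11 ^ d') • g i' := by
  induction k with
  | zero =>
    -- On one and the same generator, two words of equal degree differ by exchanging `x00 * x11` and
    -- `x01 * x10` some number `t` of times.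
    have aux : ∀ t a b c d : ℕ, x00 ^ (a + t) * x01 ^ b * x10 ^ c * x11 ^ (d + t) =
        x00 ^ a * x01 ^ (b + t) * x10 ^ (c + t) * x11 ^ d := by
      intro t a b c d
      calc _ = x00 ^ a * x01 ^ b * x10 ^ c * x11 ^ d * (x00 * x11) ^ t := by ring
        _ = x00 ^ a * x01 ^ b * x10 ^ c * x11 ^ d * (x01 * x10) ^ t := by rw [hx]
        _ = _ := by ring
    intro i a b c d i' a' b' c' d' hi _ e1 e2 e3
    obtain rfl : i = i' := hi
    congr 1
    rcases le_total a a' with h | h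
    · obtain ⟨t, rfl⟩ := Nat.exists_eq_add_of_le h
      obtain rfl : b = b' + t := by omega
      obtain rfl : c = c' + t := by omega
      obtain rfl : d' = d + t := by omega
      exact (aux t a b' c' d).symm
    · obtain ⟨t, rfl⟩ := Nat.exists_eq_add_of_le h
      obtain rfl : b' = b + t := by omega
      obtain rfl : c' = c + t := by omega
      obtain rfl : d = d' + t := by omega
      exact aux t a' b c d'
  | succ k ih =>
    intro i a b c d i' a' b' c' d' hi hq e1 e2 e3
    obtain rfl : i = i' + k + 1 := by omega
    -- Equality of degrees forces `c + d > 0`, so a factor `x10` or `x11` is available to lower the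
    -- index of the generator by one.
    by_cases hc : c = 0
    · obtain ⟨d, rfl⟩ : ∃ d₁, d = d₁ + 1 := ⟨d - 1, by omega⟩
      rw [← ih (i' + k) a (b + 1) c d i' a' b' c' d' (by omega) (by omega) (by omega) (by omega)
        (by omega)]
      rw [pow_succ x11, ← mul_assoc, mul_smul, h1 _ hq, ← mul_smul]
      congr 1; ring
    · obtain ⟨c, rfl⟩ : ∃ c₁, c = c₁ + 1 := ⟨c - 1, by omega⟩
      rw [← ih (i' + k) (a + 1) b c d i' a' b' c' d' (by omega) (by omega) (by omega) (by omega)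
        (by omega)]
      rw [show x00 ^ a * x01 ^ b * x10 ^ (c + 1) * x11 ^ d =
        (x00 ^ a * x01 ^ b * x10 ^ c * x11 ^ d) * x10 by ring, mul_smul, h0 _ hq, ← mul_smul]
      congr 1; ring

theorem word_unique' {R W : Type} [CommRing R] [AddCommGroup W] [Module R W]
    {x00 x01 x10 x11 : R} (hx : x00 * x11 = x01 * x10) {g : ℕ → W} {q : ℕ}
    (h0 : ∀ i, i + 1 < q → x10 • g (i + 1) = x00 • g i)
    (h1 : ∀ i, i + 1 < q → x11 • g (i + 1) = x01 • g i)
    {i a b c d i' a' b' c' d' : ℕ} (hi : i < q) (hi' : i' < q) (e1 : i + a + b = i' + a' + b')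
    (e2 : a + c = a' + c') (e3 : b + d = b' + d') :
    (x00 ^ a * x01 ^ b * x10 ^ c * x11 ^ d) • g i =
      (x00 ^ a' * x01 ^ b' * x10 ^ c' * x11 ^ d') • g i' := by
  rcases le_total i' i with h | h
  · exact word_unique hx h0 h1 (i - i') i a b c d i' a' b' c' d' (by omega) hi e1 e2 e3
  · exact (word_unique hx h0 h1 (i' - i) i' a' b' c' d' i a b c d (by omega) hi' e1.symm e2.symm
      e3.symm).symm

/-- A family of vectors indexed by monomials, on which central elements act by multiplication of
monomials. -/
structure IsVal {W : Type} [AddCommGroup W] [Module ℂ W] (X : Fin 2 → Fin 2 → W →ₗ[ℂ] W)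
    (Z : W →ₗ[ℂ] W) (q : ℕ) (val : (Fin 5 → ℕ) → W) : Prop where
  shift_x : ∀ k l e, X k l (val e) = val (e + shX k l)
  shift_z : ∀ e, Z (val e) = val (e + shZ)
  deg : ∀ e, val e ≠ 0 → Deg q e

/-- The value of a monomial is that of any word representing it; `word_unique'` makes the choice
immaterial, which is what yields the shift rules. -/
theorem exists_val_of_ring {R W : Type} [CommRing R] [AddCommGroup W] [Module R W]
    {x : Fin 2 → Fin 2 → R} {z : R} (hx : x 0 0 * x 1 1 = x 0 1 * x 1 0) {g : ℕ → W} {q : ℕ}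
    (hg : ∀ i, i + 1 < q → ∀ l, x 1 l • g (i + 1) = x 0 l • g i) :
    ∃ val : (Fin 5 → ℕ) → W, (∀ k l e, x k l • val e = val (e + shX k l)) ∧
      (∀ e, z • val e = val (e + shZ)) ∧ (∀ e, val e ≠ 0 → Deg q e) ∧
      ∀ i < q, val ![i, q - 1 - i, 0, 0, 0] = g i := by
  classical
  rcases Nat.eq_zero_or_pos q with rfl | hq
  · exact ⟨fun _ => 0, by simp, by simp, by simp, by simp⟩
  let w (i a b c d γ : ℕ) : W :=
    z ^ γ • (x 0 0 ^ a * x 0 1 ^ b * x 1 0 ^ c * x 1 1 ^ d) • g i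
  have hw : ∀ {i a b c d γ i' a' b' c' d'}, i < q → i' < q → i + a + b = i' + a' + b' →
      a + c = a' + c' → b + d = b' + d' → w i a b c d γ = w i' a' b' c' d' γ := by
    intro i a b c d γ i' a' b' c' d' hi hi' e1 e2 e3
    change z ^ γ • _ = z ^ γ • _
    rw [word_unique' hx (fun i hi => hg i hi 0) (fun i hi => hg i hi 1) hi hi' e1 e2 e3]
  -- A greedy normal form: the largest possible generator, then as many factors `x 0 0` as possible.
  -- The degree condition keeps the remaining exponents nonnegative.
  let I (e : Fin 5 → ℕ) : ℕ := min (e 0) (q - 1)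
  let A (e : Fin 5 → ℕ) : ℕ := min (e 0 - I e) (e 2)
  let val (e : Fin 5 → ℕ) : W := if Deg q e then
    w (I e) (A e) (e 0 - I e - A e) (e 2 - A e) (e 3 - (e 0 - I e - A e)) (e 4) else 0
  have key : ∀ e i a b c d, Deg q e → i < q → i + a + b = e 0 → a + c = e 2 → b + d = e 3 →
      val e = w i a b c d (e 4) := by
    intro e i a b c d he hi e1 e2 e3
    simp only [val, if_pos he]
    unfold Deg at he
    apply hw <;> (try simp only [I, A]) <;> omega
  have ex : ∀ e, Deg q e → ∃ i a b c d, i < q ∧ i + a + b = e 0 ∧ a + c = e 2 ∧ b + d = e 3 := by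
    intro e he
    refine ⟨I e, A e, e 0 - I e - A e, e 2 - A e, e 3 - (e 0 - I e - A e), ?_⟩
    unfold Deg at he
    simp only [I, A]
    omega
  have hz : ∀ e, ¬ Deg q e → val e = 0 := fun e he => if_neg he
  refine ⟨val, fun k l e => ?_, fun e => ?_, fun e => not_imp_comm.1 (hz e), fun i hi => ?_⟩
  · by_cases he : Deg q e
    · obtain ⟨i, a, b, c, d, hi, e1, e2, e3⟩ := ex e he
      have he' : Deg q (e + shX k l) := deg_add_shX.2 he
      rw [key e i a b c d he hi e1 e2 e3]
      have hsw : x k l • w i a b c d (e 4) =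
          z ^ e 4 • (x k l * (x 0 0 ^ a * x 0 1 ^ b * x 1 0 ^ c * x 1 1 ^ d)) • g i := by
        simp only [w, smul_smul]
        congr 1; ring
      rw [hsw]
      fin_cases k <;> fin_cases l
      · rw [key _ i (a + 1) b c d he' hi (by simp [shX]; omega) (by simp [shX]; omega)
          (by simp [shX]; omega)]
        simp only [w]
        congr 2
        simp; ring
      · rw [key _ i a (b + 1) c d he' hi (by simp [shX]; omega) (by simp [shX]; omega)
          (by simp [shX]; omega)]
        simp only [w]
        congr 2
        simp; ring
      · rw [key _ i a b (c + 1) d he' hi (by simp [shX]; omega) (by simp [shX]; omega)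
          (by simp [shX]; omega)]
        simp only [w]
        congr 2
        simp; ring
      · rw [key _ i a b c (d + 1) he' hi (by simp [shX]; omega) (by simp [shX]; omega)
          (by simp [shX]; omega)]
        simp only [w]
        congr 2
        simp; ring
    · rw [hz _ he, hz _ (fun h => he (deg_add_shX.1 h)), smul_zero]
  · by_cases he : Deg q e
    · obtain ⟨i, a, b, c, d, hi, e1, e2, e3⟩ := ex e he
      rw [key e i a b c d he hi e1 e2 e3, key (e + shZ) i a b c d (deg_add_shZ.2 he) hi
        (by simpa [shZ] using e1) (by simpa [shZ] using e2) (by simpa [shZ] using e3)]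
      simp only [w, smul_smul]
      congr 1
      simp [shZ]
      ring
    · rw [hz _ he, hz _ (fun h => he (deg_add_shZ.1 h)), smul_zero]
  · rw [key _ i 0 0 0 0 (by simp [Deg]; omega) hi (by simp) (by simp) (by simp)]
    simp [w]

theorem exists_val {W : Type} [AddCommGroup W] [Module ℂ W]
    {X : Fin 2 → Fin 2 → W →ₗ[ℂ] W} {Z : W →ₗ[ℂ] W}
    (hXX : ∀ k l k' l', X k l * X k' l' = X k' l' * X k l) (hXZ : ∀ k l, X k l * Z = Z * X k l)
    (hx : X 0 0 * X 1 1 = X 0 1 * X 1 0) {g : ℕ → W} {q : ℕ}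
    (hg : ∀ i, i + 1 < q → ∀ l, X 1 l (g (i + 1)) = X 0 l (g i)) :
    ∃ val : (Fin 5 → ℕ) → W, IsVal X Z q val ∧ ∀ i < q, val ![i, q - 1 - i, 0, 0, 0] = g i := by
  -- The commuting operators generate a commutative algebra over which `W` is a module, so the
  -- commutative version applies.
  let S : Set (Module.End ℂ W) := insert Z (Set.range fun p : Fin 2 × Fin 2 => X p.1 p.2)
  have hS : ∀ a ∈ S, ∀ b ∈ S, a * b = b * a := by
    rintro _ (rfl | ⟨p, rfl⟩) _ (rfl | ⟨p', rfl⟩)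
    · rfl
    · exact (hXZ _ _).symm
    · exact hXZ _ _
    · exact hXX _ _ _ _
  have := Algebra.isMulCommutative_adjoin ℂ hS
  let _ : CommRing (Algebra.adjoin ℂ S) :=
    { (inferInstance : Ring (Algebra.adjoin ℂ S)) with mul_comm := this.is_comm.comm }
  let mod : Module (Algebra.adjoin ℂ S) W :=
    Module.compHom W ((Algebra.adjoin ℂ S).val.toRingHom)
  let x (k l : Fin 2) : Algebra.adjoin ℂ S :=
    ⟨X k l, Algebra.subset_adjoin (Or.inr ⟨(k, l), rfl⟩)⟩
  let z : Algebra.adjoin ℂ S := ⟨Z, Algebra.subset_adjoin (Or.inl rfl)⟩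
  obtain ⟨val, h1, h2, h3, h4⟩ := exists_val_of_ring (x := x) (z := z) (g := g) (q := q)
    (Subtype.ext hx) hg
  exact ⟨val, ⟨h1, h2, h3⟩, h4⟩

end Words

/-! ### Independence and deformation of monomials -/

namespace IsVal

variable {W : Type} [AddCommGroup W] [Module ℂ W] {X : Fin 2 → Fin 2 → W →ₗ[ℂ] W}
  {Z : W →ₗ[ℂ] W} {q : ℕ} {val : (Fin 5 → ℕ) → W}

theorem exists_shift (h : IsVal X Z q val) {f : Fin 5 → ℕ} (hf : Deg 1 f) :
    ∃ A : W →ₗ[ℂ] W, ∀ e, A (val e) = val (e + f) := by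
  refine deg_induction (P := fun f => ∃ A : W →ₗ[ℂ] W, ∀ e, A (val e) = val (e + f))
    (fun i hi => ?_) (fun k l f _ ⟨A, hA⟩ => ?_) (fun f _ ⟨A, hA⟩ => ?_) f hf
  · obtain rfl : i = 0 := by omega
    refine ⟨LinearMap.id, fun e => ?_⟩
    have : (![0, 1 - 1 - 0, 0, 0, 0] : Fin 5 → ℕ) = 0 := by
      apply ext5 <;> rfl
    rw [this, add_zero]; rfl
  · exact ⟨X k l ∘ₗ A, fun e => by rw [LinearMap.comp_apply, hA, h.shift_x, add_assoc]⟩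
  · exact ⟨Z ∘ₗ A, fun e => by rw [LinearMap.comp_apply, hA, h.shift_z, add_assoc]⟩

/-- Multiplication by a monomial of balanced degree is linear, so the vanishing monomials are closed
under it. This ideal property drives all later arguments. -/
theorem add_eq_zero (h : IsVal X Z q val) {e f : Fin 5 → ℕ} (hf : Deg 1 f) (he : val e = 0) :
    val (e + f) = 0 := by
  obtain ⟨A, hA⟩ := h.exists_shift hf
  rw [← hA, he, map_zero]

/-- In a direction `f` that is not constant, the monomials have pairwise distinct eigenvalues, and a
finite-dimensional space has no infinite family of nonzero eigenvectors of this kind. -/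
theorem exists_smul_eq_zero [FiniteDimensional ℂ W] {Φ : W →ₗ[ℂ] W} {s : Fin 5 → ℂ}
    (hΦ : ∀ e, Φ (val e) = mon s e • val e) (hs : Generic s) {f : Fin 5 → ℕ} {i j : Fin 5}
    (hij : f i ≠ f j) (e : Fin 5 → ℕ) : ∃ m : ℕ, val (e + m • f) = 0 := by
  by_contra! hne
  have hinj : Function.Injective fun m : ℕ => mon s (e + m • f) := by
    intro m m' hm
    have h1 := hs _ _ hm i j
    simp only [Pi.add_apply, Pi.smul_apply, smul_eq_mul] at h1
    zify at h1
    have h2 : ((m : ℤ) - m') * (f i - f j) = 0 := by linarith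
    rcases mul_eq_zero.1 h2 with h3 | h3
    · exact_mod_cast sub_eq_zero.1 h3
    · exact absurd (by exact_mod_cast sub_eq_zero.1 h3) hij
  have hli := Module.End.eigenvectors_linearIndependent' Φ (fun m : ℕ => mon s (e + m • f)) hinj
    (fun m => val (e + m • f)) (fun m => ⟨Module.End.mem_eigenspace_iff.2 (hΦ _), hne m⟩)
  have := hli.finite
  exact not_finite ℕ

theorem eq_add_const {s : Fin 5 → ℂ} (hs : Generic s) {e e' : Fin 5 → ℕ}
    (h : mon s e = mon s e') (h4 : e 4 ≤ e' 4) : e' = e + fun _ => e' 4 - e 4 := by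
  ext i
  have := hs _ _ h i 4
  simp only [Pi.add_apply]
  omega

/-- Distinct eigenvalues are separated by `Φ`. Monomials with a common eigenvalue lie on one line in
the direction (1,1,1,1,1), where multiplication by a power of the product of all variables can kill
all but the lowest. -/
theorem coeff_eq_zero [FiniteDimensional ℂ W] (h : IsVal X Z q val) {Φ : W →ₗ[ℂ] W}
    {s : Fin 5 → ℂ} (hΦ : ∀ e, Φ (val e) = mon s e • val e) (hs : Generic s) {ι : Type}
    (S : Finset ι) : ∀ (φ : ι → Fin 5 → ℕ) (c : ι → ℂ), Set.InjOn φ S →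
      (∀ i ∈ S, val (φ i) ≠ 0) → ∑ i ∈ S, c i • val (φ i) = 0 → ∀ i ∈ S, c i = 0 := by
  classical
  induction hn : S.card generalizing S with
  | zero =>
    intro φ c _ _ _ i hi
    rw [Finset.card_eq_zero] at hn
    simp [hn] at hi
  | succ n ih =>
    intro φ c hφ hne hsum
    have step : ∀ i ∈ S, c i = 0 → ∀ j ∈ S, c j = 0 := by
      intro i hi hci j hj
      by_cases hji : j = i
      · rw [hji, hci]
      refine ih (S.erase i) (by rw [Finset.card_erase_of_mem hi, hn]; rfl) φ c
        (hφ.mono (by simp)) (fun j hj => hne j (Finset.mem_of_mem_erase hj)) ?_ j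
        (Finset.mem_erase.2 ⟨hji, hj⟩)
      rw [← Finset.add_sum_erase S _ hi, hci, zero_smul, zero_add] at hsum
      exact hsum
    by_cases hall : ∀ i ∈ S, ∀ j ∈ S, mon s (φ i) = mon s (φ j)
    · have hSne : S.Nonempty := Finset.card_pos.1 (by omega)
      -- The lowest monomial on the common line; below, `m` is the last power of the product of all
      -- variables that does not kill it.
      obtain ⟨i, hi, hmin⟩ := S.exists_min_image (fun i => φ i 4) hSne
      refine step i hi ?_
      have hex : ∃ m : ℕ, val (φ i + fun _ => m) = 0 := by
        obtain ⟨m, hm⟩ := exists_smul_eq_zero hΦ hs (f := shZ) (i := 4) (j := 0)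
          (by simp [shZ]) (φ i)
        refine ⟨m, ?_⟩
        have := h.add_eq_zero (f := ![m, m, m, m, 0]) (by simp [Deg]; omega) hm
        rw [← this, add_assoc]
        congr 2
        apply ext5 <;> simp [shZ]
      obtain ⟨m, hm⟩ : ∃ m, Nat.find hex = m + 1 := by
        refine Nat.exists_eq_succ_of_ne_zero fun h0 => hne i hi ?_
        have := Nat.find_spec hex
        rw [h0] at this
        exact this
      have hm0 : val (φ i + fun _ => m) ≠ 0 := Nat.find_min hex (by omega)
      have hm1 : val (φ i + fun _ => m + 1) = 0 := hm ▸ Nat.find_spec hex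
      obtain ⟨A, hA⟩ := h.exists_shift (deg_one_const m)
      have h2 := congrArg A hsum
      rw [map_sum, map_zero, Finset.sum_eq_single_of_mem i hi] at h2
      · rw [map_smul, hA] at h2
        exact (smul_eq_zero.1 h2).resolve_right hm0
      · intro j hj hji
        rw [map_smul, hA]
        have e1 := eq_add_const hs (hall i hi j hj) (hmin j hj)
        have hlt : φ i 4 < φ j 4 := by
          refine lt_of_le_of_ne (hmin j hj) fun he => hji (hφ hj hi ?_)
          rw [e1, he, Nat.sub_self]
          exact add_zero _
        -- Every other monomial starts at least one step further along the line, hence is moved to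
        -- the first zero or beyond.
        have := h.add_eq_zero (deg_one_const (φ j 4 - φ i 4 - 1)) hm1
        rw [show φ j + (fun _ => m) = φ i + (fun _ => m + 1) + fun _ => φ j 4 - φ i 4 - 1 by
          conv_lhs => rw [e1]
          ext k
          simp only [Pi.add_apply]
          omega, this, smul_zero]
    · push Not at hall
      obtain ⟨i, hi, j, hj, hij⟩ := hall
      refine step j hj ?_
      -- Applying `Φ` minus the eigenvalue at `i` removes the term `i` but keeps the term `j`, whose
      -- eigenvalue is different.
      have h2 : ∑ k ∈ S.erase i, (c k * (mon s (φ k) - mon s (φ i))) • val (φ k) = 0 := by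
        have e1 : ∑ k ∈ S, (c k * (mon s (φ k) - mon s (φ i))) • val (φ k) = 0 := by
          have e2 := congrArg Φ hsum
          have e3 := congrArg (fun y => mon s (φ i) • y) hsum
          simp only [map_sum, map_smul, map_zero, hΦ, smul_zero, Finset.smul_sum] at e2 e3
          rw [← sub_zero (0 : W)]
          nth_rewrite 1 [← e2]
          rw [← e3, ← Finset.sum_sub_distrib]
          refine Finset.sum_congr rfl fun k _ => ?_
          rw [smul_smul, smul_smul, ← sub_smul]
          congr 1; ring
        rw [← Finset.add_sum_erase S _ hi, sub_self, mul_zero, zero_smul, zero_add] at e1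
        exact e1
      have h3 := ih (S.erase i) (by rw [Finset.card_erase_of_mem hi, hn]; rfl) φ _
        (hφ.mono (by simp)) (fun j hj => hne j (Finset.mem_of_mem_erase hj)) h2 j
        (Finset.mem_erase.2 ⟨fun e => hij (by rw [e]), hj⟩)
      exact (mul_eq_zero.1 h3).resolve_right fun h0 => hij (sub_eq_zero.1 h0).symm

theorem linearIndependent [FiniteDimensional ℂ W] (h : IsVal X Z q val) {Φ : W →ₗ[ℂ] W}
    {s : Fin 5 → ℂ} (hΦ : ∀ e, Φ (val e) = mon s e • val e) (hs : Generic s) :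
    LinearIndependent ℂ fun e : {e // val e ≠ 0} => val e := by
  rw [linearIndependent_iff']
  intro S c hc
  exact h.coeff_eq_zero hΦ hs S (fun e => e.1) c (Subtype.val_injective.injOn)
    (fun e _ => e.2) hc

/-- The dimension depends on the support only, which makes different representations comparable. -/
theorem finrank_span [FiniteDimensional ℂ W] (h : IsVal X Z q val) {Φ : W →ₗ[ℂ] W}
    {s : Fin 5 → ℂ} (hΦ : ∀ e, Φ (val e) = mon s e • val e) (hs : Generic s) :
    finrank ℂ (Submodule.span ℂ (Set.range val)) = Nat.card {e // val e ≠ 0} := by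
  have hli := h.linearIndependent hΦ hs
  have := hli.finite
  have := Fintype.ofFinite {e // val e ≠ 0}
  rw [Nat.card_eq_fintype_card, ← finrank_span_eq_card hli]
  have e : Submodule.span ℂ (Set.range val) =
      Submodule.span ℂ (Set.range fun e : {e // val e ≠ 0} => val e) := by
    apply le_antisymm
    · rw [Submodule.span_le]
      rintro _ ⟨e, rfl⟩
      by_cases he : val e = 0
      · rw [he]; exact Submodule.zero_mem _
      · exact Submodule.subset_span ⟨⟨e, he⟩, rfl⟩
    · apply Submodule.span_mono
      rintro _ ⟨e, rfl⟩
      exact ⟨e, rfl⟩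
  rw [e]

/-- Stripping central factors one by one from a nonzero monomial leaves nonzero monomials; with
their independence this bounds the exponents. -/
theorem exists_chain (h : IsVal X Z q val) : ∀ e, Deg q e → val e ≠ 0 →
    ∃ S : Finset (Fin 5 → ℕ), S.card = e 2 + e 3 + e 4 + 1 ∧
      ∀ f ∈ S, val f ≠ 0 ∧ f 2 + f 3 + f 4 ≤ e 2 + e 3 + e 4 := by
  classical
  refine deg_induction (fun i _ hv => ⟨{![i, q - 1 - i, 0, 0, 0]}, by simp, by simpa using hv⟩)
    (fun k l e _ ih hv => ?_) (fun e _ ih hv => ?_)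
  · obtain ⟨S, hc, hS⟩ := ih fun h0 => hv (by rw [← h.shift_x, h0, map_zero])
    have hl : (e + shX k l) 2 + (e + shX k l) 3 + (e + shX k l) 4 = e 2 + e 3 + e 4 + 1 := by
      fin_cases k <;> fin_cases l <;> simp [shX] <;> omega
    refine ⟨insert (e + shX k l) S, ?_, ?_⟩
    · rw [Finset.card_insert_of_notMem, hc, hl]
      intro hm
      have := (hS _ hm).2
      omega
    · intro f hf
      rcases Finset.mem_insert.1 hf with rfl | hf
      · exact ⟨hv, le_rfl⟩
      · exact ⟨(hS f hf).1, by have := (hS f hf).2; omega⟩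
  · obtain ⟨S, hc, hS⟩ := ih fun h0 => hv (by rw [← h.shift_z, h0, map_zero])
    have hl : (e + shZ) 2 + (e + shZ) 3 + (e + shZ) 4 = e 2 + e 3 + e 4 + 1 := by
      simp [shZ]; omega
    refine ⟨insert (e + shZ) S, ?_, ?_⟩
    · rw [Finset.card_insert_of_notMem, hc, hl]
      intro hm
      have := (hS _ hm).2
      omega
    · intro f hf
      rcases Finset.mem_insert.1 hf with rfl | hf
      · exact ⟨hv, le_rfl⟩
      · exact ⟨(hS f hf).1, by have := (hS f hf).2; omega⟩

theorem degree_lt [FiniteDimensional ℂ W] (h : IsVal X Z q val) {Φ : W →ₗ[ℂ] W}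
    {s : Fin 5 → ℂ} (hΦ : ∀ e, Φ (val e) = mon s e • val e) (hs : Generic s)
    {e : Fin 5 → ℕ} (he : val e ≠ 0) : e 2 + e 3 + e 4 < finrank ℂ W := by
  obtain ⟨S, hc, hS⟩ := h.exists_chain e (h.deg e he) he
  have hli := (h.linearIndependent hΦ hs).comp
    (fun f : S => (⟨f.1, (hS f f.2).1⟩ : {e // val e ≠ 0}))
    (fun f g hfg => Subtype.ext (congrArg (fun x : {e // val e ≠ 0} => x.1) hfg))
  have := hli.fintype_card_le_finrank
  rw [Fintype.card_coe, hc] at this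
  omega

/-- By independence only monomials with the eigenvalue of `e` occur, so they lie on its line in the
direction (1,1,1,1,1). Those at or above `e` vanish together with `e`. -/
theorem eq_sum_of_eigenvector [FiniteDimensional ℂ W] (h : IsVal X Z q val) {Φ : W →ₗ[ℂ] W}
    {s : Fin 5 → ℂ} (hΦ : ∀ e, Φ (val e) = mon s e • val e) (hs : Generic s)
    (hspan : Submodule.span ℂ (Set.range val) = ⊤) {e : Fin 5 → ℕ} (he : val e = 0) {y : W}
    (hy : Φ y = mon s e • y) :
    ∃ (S : Finset (Fin 5 → ℕ)) (c : (Fin 5 → ℕ) → ℂ), y = ∑ f ∈ S, c f • val f ∧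
      ∀ f ∈ S, val f ≠ 0 ∧ f 4 < e 4 ∧ e = f + fun _ => e 4 - f 4 := by
  classical
  have hyS : y ∈ Submodule.span ℂ (Set.range val) := hspan ▸ Submodule.mem_top
  obtain ⟨c, rfl⟩ := (Finsupp.mem_span_range_iff_exists_finsupp).1 hyS
  rw [Finsupp.sum] at hy ⊢
  set S₁ := c.support.filter fun f => val f ≠ 0 with hS₁
  have e1 : ∀ c' : (Fin 5 → ℕ) → ℂ,
      ∑ f ∈ c.support, c' f • val f = ∑ f ∈ S₁, c' f • val f := by
    intro c'
    refine (Finset.sum_subset (Finset.filter_subset _ _) fun f hf hf' => ?_).symm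
    have : val f = 0 := by
      by_contra h0
      exact hf' (Finset.mem_filter.2 ⟨hf, h0⟩)
    rw [this, smul_zero]
  have e2 : ∑ f ∈ S₁, (c f * (mon s f - mon s e)) • val f = 0 := by
    rw [← e1]
    simp only [mul_sub, sub_smul, mul_smul, Finset.sum_sub_distrib]
    rw [sub_eq_zero]
    simp only [map_sum, map_smul, hΦ, Finset.smul_sum] at hy
    rw [hy]
    exact Finset.sum_congr rfl fun f _ => smul_comm _ _ _
  have e3 := h.coeff_eq_zero hΦ hs S₁ id _ Function.injective_id.injOn
    (fun f hf => (Finset.mem_filter.1 hf).2) e2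
  refine ⟨S₁, c, e1 _, fun f hf => ?_⟩
  obtain ⟨hf1, hf2⟩ := Finset.mem_filter.1 hf
  have hm : mon s f = mon s e :=
    sub_eq_zero.1 ((mul_eq_zero.1 (e3 f hf)).resolve_left (Finsupp.mem_support_iff.1 hf1))
  have hlt : f 4 < e 4 := by
    by_contra hle
    have := eq_add_const hs hm.symm (not_lt.1 hle)
    exact hf2 (this ▸ h.add_eq_zero (deg_one_const _) he)
  exact ⟨hf2, hlt, eq_add_const hs hm hlt.le⟩

/-- An infinitesimal deformation that is compatible with a generic element of the Calabi-Yau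
torus does not move the monomials that vanish. -/
theorem eq_zero_of_deformation [FiniteDimensional ℂ W] (h : IsVal X Z q val) {Φ : W →ₗ[ℂ] W}
    {s : Fin 5 → ℂ} (hΦ : ∀ e, Φ (val e) = mon s e • val e) (hs : Generic s)
    (hspan : Submodule.span ℂ (Set.range val) = ⊤)
    {W' : Type} [AddCommGroup W'] [Module ℂ W'] {X' : Fin 2 → Fin 2 → W' →ₗ[ℂ] W'}
    {Z' : W' →ₗ[ℂ] W'} {val' : (Fin 5 → ℕ) → W'} (h' : IsVal X' Z' q val') {Φ' : W' →ₗ[ℂ] W'}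
    (hΦ' : ∀ e, Φ' (val' e) = mon s e • val' e) {ε : W →ₗ[ℂ] W'} (hε : Function.Injective ε)
    (hεX : ∀ k l y, ε (X k l y) = X' k l (ε y)) (hεΦ : ∀ y, ε (Φ y) = Φ' (ε y))
    (hdef : ∀ e, val e = 0 → val' e ∈ LinearMap.range ε) :
    ∀ e, val e = 0 → val' e = 0 := by
  classical
  suffices ∀ n e, e 4 = n → val e = 0 → val' e = 0 from fun e => this _ e rfl
  have hX0 : ∀ p : ℕ, ∀ e, ((X 0 0) ^ p) (val e) = val (e + p • shX 0 0) := by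
    intro p
    induction p with
    | zero => intro e; simp
    | succ p ih => intro e; rw [pow_succ', Module.End.mul_apply, ih, h.shift_x, add_assoc, succ_nsmul]
  have hX0' : ∀ p : ℕ, ∀ e, ((X' 0 0) ^ p) (val' e) = val' (e + p • shX 0 0) := by
    intro p
    induction p with
    | zero => intro e; simp
    | succ p ih => intro e; rw [pow_succ', Module.End.mul_apply, ih, h'.shift_x, add_assoc, succ_nsmul]
  have hεXp : ∀ p : ℕ, ∀ y, ε (((X 0 0) ^ p) y) = ((X' 0 0) ^ p) (ε y) := by
    intro p
    induction p with
    | zero => intro e; simp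
    | succ p ih => intro y; rw [pow_succ', Module.End.mul_apply, hεX, ih, pow_succ', Module.End.mul_apply]
  intro n
  induction n with
  -- No exponent lies strictly below `e` on its line, as the loop exponent would be negative.
  | zero =>
    intro e h4 he
    obtain ⟨y, hy⟩ := hdef e he
    have hΦy : Φ y = mon s e • y := hε (by rw [hεΦ, hy, hΦ', map_smul, hy])
    obtain ⟨S, c, hyS, hS⟩ := h.eq_sum_of_eigenvector hΦ hs hspan he hΦy
    rw [← hy, hyS, Finset.sum_eq_zero, map_zero]
    intro f hf
    have := (hS f hf).2.1
    omega
  | succ n ih =>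
    intro e h4 he
    obtain ⟨y, hy⟩ := hdef e he
    have hΦy : Φ y = mon s e • y := hε (by rw [hεΦ, hy, hΦ', map_smul, hy])
    obtain ⟨S, c, hyS, hS⟩ := h.eq_sum_of_eigenvector hΦ hs hspan he hΦy
    obtain ⟨e, rfl⟩ : ∃ e₁, e = e₁ + shZ := by
      refine ⟨![e 0, e 1, e 2, e 3, e 4 - 1], ?_⟩
      apply ext5 <;> simp [shZ]
      omega
    have hn : e 4 = n := by simpa [shZ] using h4
    -- With one loop factor removed, `e` itself may be nonzero, but multiplying by `p` factors `X 0
    -- 0` makes it vanish; there the induction hypothesis applies. Hence the `p`-th power of `X 0 0`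
    -- annihilates the first-order part `y`.
    have hex : ∃ p : ℕ, val (e + p • shX 0 0) = 0 :=
      exists_smul_eq_zero hΦ hs (i := 0) (j := 1) (by simp [shX]) e
    obtain ⟨p, hp, hmin⟩ : ∃ p, val (e + p • shX 0 0) = 0 ∧
        ∀ p' < p, val (e + p' • shX 0 0) ≠ 0 :=
      ⟨Nat.find hex, Nat.find_spec hex, fun p' => Nat.find_min hex⟩
    have hp' := ih (e + p • shX 0 0) (by simp [shX, hn]) hp
    have hpz : val' (e + shZ + p • shX 0 0) = 0 := by
      rw [add_right_comm, ← h'.shift_z, hp', map_zero]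
    rw [← hX0', ← hy, ← hεXp, map_eq_zero_iff ε hε, hyS, map_sum] at hpz
    simp only [map_smul, hX0] at hpz
    rcases Nat.eq_zero_or_pos p with h0 | hpos
    · rw [← h'.shift_z, ih e hn (by simpa [h0] using hp), map_zero]
    -- If none of the shifted monomials vanishes, independence kills all coefficients of `y`.
    have hc := h.coeff_eq_zero hΦ hs S (fun f => f + p • shX 0 0) c
      (fun f _ g _ hfg => add_right_cancel hfg) (fun f hf h0 => ?_) hpz
    · rw [← hy, hyS, Finset.sum_eq_zero, map_zero]
      intro f hf
      rw [hc f hf, zero_smul]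
    · obtain ⟨-, hlt, hef⟩ := hS f hf
      refine hmin (p - 1) (by omega) ?_
      set j := (e + shZ) 4 - f 4 with hj
      -- If a shifted `f` vanished, so would its multiple `e + (p - 1) • shX 0 0`, against the
      -- minimality of `p`. This uses `e + shZ = f + (j,j,j,j,j)` with `j ≥ 1`.
      have := h.add_eq_zero (f := ![j - 1, j, j - 1, j, j - 1]) (by simp [Deg]; omega) h0
      rw [← this]
      congr 1
      have hj1 : 1 ≤ j := by omega
      have hv : ∀ i, (e + (p - 1) • shX 0 0) i =
          (f + p • shX 0 0 + ![j - 1, j, j - 1, j, j - 1] : Fin 5 → ℕ) i := by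
        have hx : (shX 0 0 : Fin 5 → ℕ) = ![1, 0, 1, 0, 0] := rfl
        rw [hx]
        have hk : ∀ i, e i + shZ i = f i + j := fun i => congrFun hef i
        intro i
        have hki := hk i
        simp only [Pi.add_apply, Pi.smul_apply, smul_eq_mul]
        generalize f i = fi at *
        generalize e i = ei at *
        clear_value j
        fin_cases i <;> simp [shZ] at hki ⊢ <;> omega
      exact funext hv

end IsVal
-- Twisted homomorphisms and the central action on probes
namespace LinRep

variable {V₀ V₁ : Type} [AddCommGroup V₀] [Module ℂ V₀] [AddCommGroup V₁] [Module ℂ V₁]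
variable {V₀' V₁' : Type} [AddCommGroup V₀'] [Module ℂ V₀'] [AddCommGroup V₁'] [Module ℂ V₁']
variable {V₀'' V₁'' : Type} [AddCommGroup V₀''] [Module ℂ V₀''] [AddCommGroup V₁'']
  [Module ℂ V₁'']

/-- A homomorphism from `M` to `M'` with its arrows scaled by `s`. -/
structure IsTw (s : Fin 5 → ℂ) (M : LinRep V₀ V₁) (M' : LinRep V₀' V₁') (f₀ : V₀ →ₗ[ℂ] V₀')
    (f₁ : V₁ →ₗ[ℂ] V₁') : Prop where
  a : ∀ k w, f₁ (M.a k w) = ![s 0, s 1] k • M'.a k (f₀ w)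
  b : ∀ k u, f₀ (M.b k u) = ![s 2, s 3] k • M'.b k (f₁ u)
  c : ∀ w, f₀ (M.c w) = s 4 • M'.c (f₀ w)
  d : ∀ u, f₁ (M.d u) = s 4 • M'.d (f₁ u)

/-- The effect of exchanging the vertices on torus elements. -/
def swapT (s : Fin 5 → ℂ) : Fin 5 → ℂ := ![s 2, s 3, s 0, s 1, s 4]

theorem swapT_one : swapT 1 = 1 := by
  ext i; fin_cases i <;> rfl

theorem IsTw.swap {s : Fin 5 → ℂ} {M : LinRep V₀ V₁} {M' : LinRep V₀' V₁'}
    {f₀ : V₀ →ₗ[ℂ] V₀'} {f₁ : V₁ →ₗ[ℂ] V₁'} (h : IsTw s M M' f₀ f₁) :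
    IsTw (swapT s) M.swap M'.swap f₁ f₀ := ⟨h.b, h.a, h.d, h.c⟩

theorem isTw_one {M : LinRep V₀ V₁} {M' : LinRep V₀' V₁'}
    {f₀ : V₀ →ₗ[ℂ] V₀'} {f₁ : V₁ →ₗ[ℂ] V₁'} (ha : ∀ k w, f₁ (M.a k w) = M'.a k (f₀ w))
    (hb : ∀ k u, f₀ (M.b k u) = M'.b k (f₁ u)) (hc : ∀ w, f₀ (M.c w) = M'.c (f₀ w))
    (hd : ∀ u, f₁ (M.d u) = M'.d (f₁ u)) : IsTw 1 M M' f₀ f₁ :=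
  ⟨fun k w => by rw [ha]; fin_cases k <;> simp, fun k w => by rw [hb]; fin_cases k <;> simp,
    fun w => by rw [hc]; simp, fun w => by rw [hd]; simp⟩

theorem IsTw.a_one {M : LinRep V₀ V₁} {M' : LinRep V₀' V₁'}
    {f₀ : V₀ →ₗ[ℂ] V₀'} {f₁ : V₁ →ₗ[ℂ] V₁'} (h : IsTw 1 M M' f₀ f₁) (k w) :
    f₁ (M.a k w) = M'.a k (f₀ w) := by
  rw [h.a]; fin_cases k <;> simp

/-- The map on tuples induced by a twisted homomorphism. -/
def tupleMap (s : Fin 5 → ℂ) (n : ℕ) (f₁ : V₁ →ₗ[ℂ] V₁') : (Fin n → V₁) →ₗ[ℂ] (Fin n → V₁') :=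
  LinearMap.pi fun i => (s 0 ^ (i : ℕ) * s 1 ^ (n - 1 - i)) • (f₁ ∘ₗ LinearMap.proj i)

theorem tupleMap_apply (s : Fin 5 → ℂ) (n : ℕ) (f₁ : V₁ →ₗ[ℂ] V₁') (F : Fin n → V₁) (i : Fin n) :
    tupleMap s n f₁ F i = (s 0 ^ (i : ℕ) * s 1 ^ (n - 1 - i)) • f₁ (F i) := rfl

/-- Slot `i` plays the role of the monomial with `i` factors `a 0` and `n - 1 - i` factors `a 1`;
weighting the slots accordingly makes a twisted map respect the relations. -/
theorem IsTw.rel_le {s : Fin 5 → ℂ} {M : LinRep V₀ V₁} {M' : LinRep V₀' V₁'}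
    {f₀ : V₀ →ₗ[ℂ] V₀'} {f₁ : V₁ →ₗ[ℂ] V₁'} (h : IsTw s M M' f₀ f₁) (pt : Bool) (n : ℕ) :
    M.rel pt n ≤ (M'.rel pt n).comap (tupleMap s n f₁) := by
  rintro _ ⟨w, hw, rfl⟩
  refine ⟨fun i => (s 0 ^ (i : ℕ) * s 1 ^ (n - i)) • f₀ (w i), fun hp => ?_, ?_⟩
  · simp [(hw hp).1, (hw hp).2]
  · ext i
    have hi : n - i = n - 1 - i + 1 := by have := i.2; omega
    have hi' : n - (i + 1) = n - 1 - i := by omega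
    rw [tupleMap_apply, diff_apply, diff_apply, map_sub, h.a, h.a, map_smul, map_smul, smul_sub,
      smul_smul, smul_smul]
    simp only [Fin.val_succ, Fin.val_castSucc, hi, hi', Matrix.cons_val_zero, Matrix.cons_val_one]
    congr 2 <;> ring

/-- The map on probes induced by a twisted homomorphism. -/
def probeMap {s : Fin 5 → ℂ} {M : LinRep V₀ V₁} {M' : LinRep V₀' V₁'}
    {f₀ : V₀ →ₗ[ℂ] V₀'} {f₁ : V₁ →ₗ[ℂ] V₁'} (h : IsTw s M M' f₀ f₁) (pt : Bool) (n : ℕ) :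
    M.probe pt n →ₗ[ℂ] M'.probe pt n :=
  Submodule.mapQ _ _ (tupleMap s n f₁) (h.rel_le pt n)

theorem probeMap_mk {s : Fin 5 → ℂ} {M : LinRep V₀ V₁} {M' : LinRep V₀' V₁'}
    {f₀ : V₀ →ₗ[ℂ] V₀'} {f₁ : V₁ →ₗ[ℂ] V₁'} (h : IsTw s M M' f₀ f₁) (pt : Bool) (n : ℕ)
    (F : Fin n → V₁) :
    probeMap h pt n (Submodule.Quotient.mk F) = Submodule.Quotient.mk (tupleMap s n f₁ F) := rfl

theorem x_isTw (M : LinRep V₀ V₁) (k l : Fin 2) :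
    IsTw 1 M M (M.b l ∘ₗ M.a k) (M.x k l) := by
  refine isTw_one (fun i w => ?_) (fun i w => ?_) (fun w => ?_) (fun w => ?_)
  · exact M.a_b_a k l i w
  · exact (M.b_a_b l k i w)
  · simp only [LinearMap.comp_apply]
    rw [← M.rel_da, ← M.rel_cb]
  · rw [x_apply, x_apply, M.rel_da, M.rel_cb]

theorem d_isTw (M : LinRep V₀ V₁) : IsTw 1 M M M.c M.d :=
  isTw_one (fun i w => M.rel_da i w) (fun i w => M.rel_cb i w) (fun _ => rfl) (fun _ => rfl)

theorem tupleMap_one (n : ℕ) (f₁ : V₁ →ₗ[ℂ] V₁') (F : Fin n → V₁) :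
    tupleMap 1 n f₁ F = fun i => f₁ (F i) := by
  ext i; simp [tupleMap_apply]

/-- The action of a central element on the probe. -/
def opX (M : LinRep V₀ V₁) (pt : Bool) (n : ℕ) (k l : Fin 2) : M.probe pt n →ₗ[ℂ] M.probe pt n :=
  probeMap (M.x_isTw k l) pt n

/-- The action of the central loops on the probe. -/
def opZ (M : LinRep V₀ V₁) (pt : Bool) (n : ℕ) : M.probe pt n →ₗ[ℂ] M.probe pt n :=
  probeMap M.d_isTw pt n

theorem opX_mk (M : LinRep V₀ V₁) (pt : Bool) (n : ℕ) (k l : Fin 2) (F : Fin n → V₁) :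
    M.opX pt n k l (Submodule.Quotient.mk F) = Submodule.Quotient.mk fun i => M.x k l (F i) := by
  rw [opX, probeMap_mk, tupleMap_one]

theorem opZ_mk (M : LinRep V₀ V₁) (pt : Bool) (n : ℕ) (F : Fin n → V₁) :
    M.opZ pt n (Submodule.Quotient.mk F) = Submodule.Quotient.mk fun i => M.d (F i) := by
  rw [opZ, probeMap_mk, tupleMap_one]

theorem x_comm (M : LinRep V₀ V₁) (k l k' l' : Fin 2) (u : V₁) :
    M.x k l (M.x k' l' u) = M.x k' l' (M.x k l u) := by
  simp only [x_apply]
  rw [M.b_a_b l k' l', M.a_b_a k l' k']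

theorem opX_comm (M : LinRep V₀ V₁) (pt : Bool) (n : ℕ) (k l k' l' : Fin 2) :
    M.opX pt n k l * M.opX pt n k' l' = M.opX pt n k' l' * M.opX pt n k l := by
  refine LinearMap.ext fun y => ?_
  obtain ⟨F, rfl⟩ := Submodule.Quotient.mk_surjective _ y
  simp only [Module.End.mul_apply, opX_mk, M.x_comm k l k' l']

theorem opX_opZ_comm (M : LinRep V₀ V₁) (pt : Bool) (n : ℕ) (k l : Fin 2) :
    M.opX pt n k l * M.opZ pt n = M.opZ pt n * M.opX pt n k l := by
  refine LinearMap.ext fun y => ?_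
  obtain ⟨F, rfl⟩ := Submodule.Quotient.mk_surjective _ y
  simp only [Module.End.mul_apply, opX_mk, opZ_mk, x_apply, M.rel_da, M.rel_cb]

theorem opX_det (M : LinRep V₀ V₁) (pt : Bool) (n : ℕ) :
    M.opX pt n 0 0 * M.opX pt n 1 1 = M.opX pt n 0 1 * M.opX pt n 1 0 := by
  refine LinearMap.ext fun y => ?_
  obtain ⟨F, rfl⟩ := Submodule.Quotient.mk_surjective _ y
  simp only [Module.End.mul_apply, opX_mk, x_apply, M.b_a_b 0 1 1]

theorem probeMap_opX {s : Fin 5 → ℂ} {M : LinRep V₀ V₁} {M' : LinRep V₀' V₁'}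
    {f₀ : V₀ →ₗ[ℂ] V₀'} {f₁ : V₁ →ₗ[ℂ] V₁'} (h : IsTw s M M' f₀ f₁) (pt : Bool) (n : ℕ)
    (k l : Fin 2) (y : M.probe pt n) :
    probeMap h pt n (M.opX pt n k l y) =
      (![s 0, s 1] k * ![s 2, s 3] l) • M'.opX pt n k l (probeMap h pt n y) := by
  obtain ⟨F, rfl⟩ := Submodule.Quotient.mk_surjective _ y
  rw [opX_mk, probeMap_mk, probeMap_mk, opX_mk, ← Submodule.Quotient.mk_smul]
  congr 1
  ext i
  simp only [tupleMap_apply, Pi.smul_apply, x_apply, h.a, h.b, map_smul, smul_smul]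
  congr 1; ring

theorem probeMap_opZ {s : Fin 5 → ℂ} {M : LinRep V₀ V₁} {M' : LinRep V₀' V₁'}
    {f₀ : V₀ →ₗ[ℂ] V₀'} {f₁ : V₁ →ₗ[ℂ] V₁'} (h : IsTw s M M' f₀ f₁) (pt : Bool) (n : ℕ)
    (y : M.probe pt n) :
    probeMap h pt n (M.opZ pt n y) = s 4 • M'.opZ pt n (probeMap h pt n y) := by
  obtain ⟨F, rfl⟩ := Submodule.Quotient.mk_surjective _ y
  rw [opZ_mk, probeMap_mk, probeMap_mk, opZ_mk, ← Submodule.Quotient.mk_smul]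
  congr 1
  ext i
  simp only [tupleMap_apply, Pi.smul_apply, h.d, map_smul, smul_smul]
  congr 1; ring

/-! ### Monomials applied to the framing -/

section Frame

/-- The tuple with the entry `u` at the place `i`. -/
def put (n i : ℕ) (u : V₁) : Fin n → V₁ := fun m => if (m : ℕ) = i then u else 0

theorem put_eq_single {n : ℕ} (i : Fin n) (u : V₁) : put n i u = Pi.single i u := by
  ext m
  simp only [put, Pi.single_apply, Fin.ext_iff]

theorem comp_put {n i : ℕ} (f : V₁ →ₗ[ℂ] V₁') (u : V₁) :
    (fun m => f (put n i u m)) = put n i (f u) := by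
  ext m
  simp only [put]
  split_ifs <;> simp

theorem tupleMap_put (s : Fin 5 → ℂ) {n i : ℕ} (f₁ : V₁ →ₗ[ℂ] V₁') (u : V₁) :
    tupleMap s n f₁ (put n i u) = (s 0 ^ i * s 1 ^ (n - 1 - i)) • put n i (f₁ u) := by
  ext m
  simp only [tupleMap_apply, put, Pi.smul_apply]
  split_ifs with h
  · rw [h]
  · simp

theorem mk_put_step (M : LinRep V₀ V₁) (pt : Bool) {n i : ℕ} (hi : i + 1 < n) (w : V₀) :
    (Submodule.Quotient.mk (put n (i + 1) (M.a 1 w)) : M.probe pt n) =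
      Submodule.Quotient.mk (put n i (M.a 0 w)) := by
  obtain ⟨n, rfl⟩ : ∃ m, n = m + 1 := ⟨n - 1, by omega⟩
  let j : Fin n := ⟨i, by omega⟩
  symm
  rw [Submodule.Quotient.eq]
  have := M.single_interior_sub_mem_rel pt w j
  rw [← put_eq_single, ← put_eq_single] at this
  exact this

/-- The number of generators that the framing provides. -/
def frameLen (v : V₀ ⊕ V₁) (n : ℕ) : ℕ := Sum.elim (fun _ => n + 1) (fun _ => n) v

/-- The generators of the probe that the framing provides. -/
def frameTuple (M : LinRep V₀ V₁) (v : V₀ ⊕ V₁) (n i : ℕ) : Fin n → V₁ :=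
  Sum.elim (fun w => if i < n then put n i (M.a 1 w) else put n (n - 1) (M.a 0 w))
    (fun u => put n i u) v

/-- The generators behave like the monomials in `a 0`, `a 1` of fixed degree times the framing
vector. For a framing at the vertex `0` there is one more generator than slots; the last one is the
`a 0`-image in the last slot. -/
theorem opX_frameTuple (M : LinRep V₀ V₁) (v : V₀ ⊕ V₁) (pt : Bool) (n i : ℕ)
    (hi : i + 1 < frameLen v n) (l : Fin 2) :
    M.opX pt n 1 l (Submodule.Quotient.mk (M.frameTuple v n (i + 1))) =
      M.opX pt n 0 l (Submodule.Quotient.mk (M.frameTuple v n i)) := by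
  rw [opX_mk, opX_mk]
  rcases v with w | u
  · simp only [frameLen, Sum.elim_inl] at hi
    simp only [frameTuple, Sum.elim_inl]
    rw [if_pos (by omega : i < n), comp_put]
    split_ifs with h
    · rw [comp_put, x_apply, x_apply, mk_put_step M pt h]
    · rw [comp_put, x_apply, x_apply, M.a_b_a 1]
      congr 2; omega
  · simp only [frameLen, Sum.elim_inr] at hi
    simp only [frameTuple, Sum.elim_inr, comp_put]
    rw [x_apply, x_apply, mk_put_step M pt hi]

theorem exists_frameVal (M : LinRep V₀ V₁) (v : V₀ ⊕ V₁) (pt : Bool) (n : ℕ) :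
    ∃ val : (Fin 5 → ℕ) → M.probe pt n,
      IsVal (M.opX pt n) (M.opZ pt n) (frameLen v n) val ∧
      ∀ i < frameLen v n, val ![i, frameLen v n - 1 - i, 0, 0, 0] =
        Submodule.Quotient.mk (M.frameTuple v n i) :=
  exists_val (M.opX_comm pt n) (M.opX_opZ_comm pt n) (M.opX_det pt n)
    (M.opX_frameTuple v pt n)

/-- The image of a monomial under the framing. -/
noncomputable def val (M : LinRep V₀ V₁) (v : V₀ ⊕ V₁) (pt : Bool) (n : ℕ) :
    (Fin 5 → ℕ) → M.probe pt n := (M.exists_frameVal v pt n).choose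

theorem isVal (M : LinRep V₀ V₁) (v : V₀ ⊕ V₁) (pt : Bool) (n : ℕ) :
    IsVal (M.opX pt n) (M.opZ pt n) (frameLen v n) (M.val v pt n) :=
  (M.exists_frameVal v pt n).choose_spec.1

theorem val_gen (M : LinRep V₀ V₁) (v : V₀ ⊕ V₁) (pt : Bool) (n i : ℕ) (hi : i < frameLen v n) :
    M.val v pt n ![i, frameLen v n - 1 - i, 0, 0, 0] =
      Submodule.Quotient.mk (M.frameTuple v n i) :=
  (M.exists_frameVal v pt n).choose_spec.2 i hi

theorem IsTw.tupleMap_frameTuple {s : Fin 5 → ℂ} {M : LinRep V₀ V₁} {M' : LinRep V₀' V₁'}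
    {f₀ : V₀ →ₗ[ℂ] V₀'} {f₁ : V₁ →ₗ[ℂ] V₁'} (h : IsTw s M M' f₀ f₁) (v : V₀ ⊕ V₁) (n i : ℕ)
    (hi : i < frameLen v n) :
    tupleMap s n f₁ (M.frameTuple v n i) =
      (s 0 ^ i * s 1 ^ (frameLen v n - 1 - i)) • M'.frameTuple (v.map f₀ f₁) n i := by
  rcases v with w | u
  · simp only [frameLen, Sum.elim_inl] at hi ⊢
    simp only [frameTuple, Sum.elim_inl, Sum.map_inl]
    split_ifs with hin
    · rw [tupleMap_put, h.a]
      ext m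
      simp only [put, Pi.smul_apply]
      split_ifs
      · simp only [Matrix.cons_val_one, Matrix.cons_val_zero, smul_smul]
        rw [show n + 1 - 1 - i = n - 1 - i + 1 by omega]
        congr 1; ring
      · simp
    · rcases Nat.eq_zero_or_pos n with rfl | hn
      · exact Subsingleton.elim _ _
      obtain rfl : i = n := by omega
      rw [tupleMap_put, h.a]
      ext m
      simp only [put, Pi.smul_apply]
      split_ifs
      · simp only [Matrix.cons_val_zero, smul_smul]
        rw [show i + 1 - 1 - i = 0 by omega, show i - 1 - (i - 1) = 0 by omega]
        congr 1
        obtain ⟨j, rfl⟩ : ∃ j, i = j + 1 := ⟨i - 1, by omega⟩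
        simp [pow_succ]
      · simp
  · simp only [frameLen, Sum.elim_inr, frameTuple, Sum.map_inr]
    exact tupleMap_put s f₁ u

theorem frameLen_map (v : V₀ ⊕ V₁) (f₀ : V₀ → V₀') (f₁ : V₁ → V₁') (n : ℕ)  :
    frameLen (v.map f₀ f₁) n = frameLen v n := by
  cases v <;> rfl

theorem mon_shX (s : Fin 5 → ℂ) (k l : Fin 2) :
    mon s (shX k l) = ![s 0, s 1] k * ![s 2, s 3] l := by
  fin_cases k <;> fin_cases l <;> simp [mon, shX, Fin.prod_univ_succ]

theorem mon_shZ (s : Fin 5 → ℂ) : mon s shZ = s 4 := by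
  simp [mon, shZ, Fin.prod_univ_succ]

/-- For a twisted automorphism that fixes the framing this is the eigenvector property; for `s = 1`
it is naturality of the monomials. -/
theorem probeMap_val {s : Fin 5 → ℂ} {M : LinRep V₀ V₁} {M' : LinRep V₀' V₁'}
    {f₀ : V₀ →ₗ[ℂ] V₀'} {f₁ : V₁ →ₗ[ℂ] V₁'} (h : IsTw s M M' f₀ f₁) {v : V₀ ⊕ V₁}
    {v' : V₀' ⊕ V₁'} (hv : v.map f₀ f₁ = v') (pt : Bool) (n : ℕ) (e : Fin 5 → ℕ) :
    probeMap h pt n (M.val v pt n e) = mon s e • M'.val v' pt n e := by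
  subst hv
  by_cases he : Deg (frameLen v n) e
  · revert e
    refine deg_induction (fun i hi => ?_) (fun k l e _ ih => ?_) (fun e _ ih => ?_)
    · have := M'.val_gen (v.map f₀ f₁) pt n i
      rw [frameLen_map] at this
      rw [M.val_gen v pt n i hi, this hi, probeMap_mk, h.tupleMap_frameTuple v n i hi,
        Submodule.Quotient.mk_smul]
      congr 1
      simp [mon, Fin.prod_univ_succ]
    · rw [← (M.isVal v pt n).shift_x, probeMap_opX, ih, map_smul, (M'.isVal _ pt n).shift_x,
        smul_smul, mon_add, mon_shX, mul_comm]
    · rw [← (M.isVal v pt n).shift_z, probeMap_opZ, ih, map_smul, (M'.isVal _ pt n).shift_z,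
        smul_smul, mon_add, mon_shZ, mul_comm]
  · have h1 : M.val v pt n e = 0 := by
      by_contra h0
      exact he ((M.isVal v pt n).deg e h0)
    have h2 : M'.val (v.map f₀ f₁) pt n e = 0 := by
      by_contra h0
      have := (M'.isVal _ pt n).deg e h0
      rw [frameLen_map] at this
      exact he this
    rw [h1, h2, map_zero, smul_zero]

/-- The preimage of the span in the tuples contains the relations and the framing and is stable
under the centre, so generation applies to it. -/
theorem Generated.span_val {M : LinRep V₀ V₁} {v : V₀ ⊕ V₁} {pt : Bool} {n : ℕ}
    (h : M.Generated v pt n) : Submodule.span ℂ (Set.range (M.val v pt n)) = ⊤ := by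
  set P := Submodule.span ℂ (Set.range (M.val v pt n)) with hP
  have hX : ∀ k l, P ≤ P.comap (M.opX pt n k l) := by
    intro k l
    rw [hP, Submodule.span_le]
    rintro _ ⟨e, rfl⟩
    exact Submodule.subset_span ⟨_, ((M.isVal v pt n).shift_x k l e).symm⟩
  have hZ : P ≤ P.comap (M.opZ pt n) := by
    rw [hP, Submodule.span_le]
    rintro _ ⟨e, rfl⟩
    exact Submodule.subset_span ⟨_, ((M.isVal v pt n).shift_z e).symm⟩
  have hgen : ∀ i < frameLen v n, Submodule.Quotient.mk (M.frameTuple v n i) ∈ P := by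
    intro i hi
    rw [← M.val_gen v pt n i hi]
    exact Submodule.subset_span ⟨_, rfl⟩
  have hN : P.comap (M.rel pt n).mkQ = ⊤ := by
    refine h _ (fun F hF => ?_) ⟨fun k l F hF => ?_, fun F hF => ?_⟩ ?_
    · rw [Submodule.mem_comap, Submodule.mkQ_apply, (Submodule.Quotient.mk_eq_zero _).2 hF]
      exact Submodule.zero_mem _
    · rw [Submodule.mem_comap, Submodule.mkQ_apply, ← opX_mk]
      exact hX k l hF
    · rw [Submodule.mem_comap, Submodule.mkQ_apply, ← opZ_mk]
      exact hZ hF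
    · rcases v with w | u
      · refine mem_slots₀.2 fun k => mem_slots₁.2 fun i => ?_
        rw [← put_eq_single]
        change Submodule.Quotient.mk (put n i (M.a k w)) ∈ P
        have hi := i.2
        fin_cases k
        · by_cases h' : (i : ℕ) + 1 < n
          · have := hgen (i + 1) (by simp [frameLen])
            simp only [frameTuple, Sum.elim_inl, if_pos h'] at this
            rwa [mk_put_step M pt h'] at this
          · have := hgen (i + 1) (by simp [frameLen])
            simp only [frameTuple, Sum.elim_inl, if_neg h'] at this
            rwa [show n - 1 = i by omega] at this
        · have := hgen i (by simp only [frameLen, Sum.elim_inl]; omega)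
          simp only [frameTuple, Sum.elim_inl, if_pos hi] at this
          exact this
      · refine mem_slots₁.2 fun i => ?_
        rw [← put_eq_single]
        exact hgen i i.2
  rw [eq_top_iff]
  intro y _
  obtain ⟨F, rfl⟩ := Submodule.Quotient.mk_surjective _ y
  have : F ∈ P.comap (M.rel pt n).mkQ := hN ▸ Submodule.mem_top
  exact this

end Frame

/-! ### Exactness of probes -/

section Exactness

variable {M' : LinRep V₀' V₁'} {M : LinRep V₀ V₁} {M'' : LinRep V₀'' V₁''}
  {i₀ : V₀' →ₗ[ℂ] V₀} {i₁ : V₁' →ₗ[ℂ] V₁} {p₀ : V₀ →ₗ[ℂ] V₀''} {p₁ : V₁ →ₗ[ℂ] V₁''}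

/-- The snake lemma: the obstruction is the kernel of the difference map of `M''`. Neither
surjectivity of the second map nor exactness at the vertex `1` is needed, so it serves for kernels
of arbitrary homomorphisms. -/
theorem probeMap_injective (hi : IsTw 1 M' M i₀ i₁) (hp : IsTw 1 M M'' p₀ p₁)
    (hi₀ : Function.Injective i₀) (hi₁ : Function.Injective i₁)
    (h₀ : LinearMap.ker p₀ ≤ LinearMap.range i₀) (h₁ : ∀ u, p₁ (i₁ u) = 0) {pt : Bool} {n : ℕ}
    (hD : M''.DiffInj pt n) : Function.Injective (probeMap hi pt n) := by
  rw [← LinearMap.ker_eq_bot, LinearMap.ker_eq_bot']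
  intro y hy
  obtain ⟨F, rfl⟩ := Submodule.Quotient.mk_surjective _ y
  rw [probeMap_mk, Submodule.Quotient.mk_eq_zero, tupleMap_one] at hy
  obtain ⟨w, hw, hwF⟩ := hy
  have hF : ∀ j, M.diff n w j = i₁ (F j) := fun j => congrFun hwF j
  have hpw : (fun j => p₀ (w j)) = 0 := by
    refine hD _ (fun hpt => ?_) ?_
    · simp [(hw hpt).1, (hw hpt).2]
    · ext j
      rw [diff_apply, ← hp.a_one, ← hp.a_one, ← map_sub, ← diff_apply, hF, h₁]
      rfl
  have hex : ∀ j, ∃ w', i₀ w' = w j := fun j => h₀ (LinearMap.mem_ker.2 (congrFun hpw j))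
  choose w' hw' using hex
  rw [Submodule.Quotient.mk_eq_zero]
  refine ⟨w', fun hpt => ⟨hi₀ ?_, hi₀ ?_⟩, ?_⟩
  · rw [hw', map_zero, (hw hpt).1]
  · rw [hw', map_zero, (hw hpt).2]
  · ext j
    apply hi₁
    rw [← hF, diff_apply, diff_apply, map_sub, hi.a_one, hi.a_one, hw', hw']

theorem ker_probeMap_le (hi : IsTw 1 M' M i₀ i₁) (hp : IsTw 1 M M'' p₀ p₁)
    (hp₀ : Function.Surjective p₀) (h₁ : LinearMap.ker p₁ ≤ LinearMap.range i₁) (pt : Bool)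
    (n : ℕ) : LinearMap.ker (probeMap hp pt n) ≤ LinearMap.range (probeMap hi pt n) := by
  intro y hy
  obtain ⟨F, rfl⟩ := Submodule.Quotient.mk_surjective _ y
  rw [LinearMap.mem_ker, probeMap_mk, Submodule.Quotient.mk_eq_zero, tupleMap_one] at hy
  obtain ⟨w, hw, hwF⟩ := hy
  obtain ⟨σ, hσ⟩ := p₀.exists_rightInverse_of_surjective (LinearMap.range_eq_top.2 hp₀)
  have hσ' : ∀ x, p₀ (σ x) = x := fun x => LinearMap.congr_fun hσ x
  have hk : ∀ j, ∃ u, i₁ u = F j - M.diff n (fun j => σ (w j)) j := fun j => by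
    refine h₁ ?_
    rw [LinearMap.mem_ker, map_sub, diff_apply, map_sub, hp.a_one, hp.a_one, hσ', hσ', sub_eq_zero]
    exact (congrFun hwF j).symm
  choose u hu using hk
  refine ⟨Submodule.Quotient.mk u, ?_⟩
  rw [probeMap_mk, tupleMap_one, Submodule.Quotient.eq]
  refine ⟨fun j => - σ (w j), fun hpt => by simp [(hw hpt).1, (hw hpt).2], ?_⟩
  ext j
  rw [Pi.sub_apply, hu, diff_apply, diff_apply]
  simp only [map_neg]
  abel

end Exactness

end LinRep
namespace LinRep

variable {V₀ V₁ : Type} [AddCommGroup V₀] [Module ℂ V₀] [AddCommGroup V₁] [Module ℂ V₁]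
variable {V₀' V₁' : Type} [AddCommGroup V₀'] [Module ℂ V₀'] [AddCommGroup V₁'] [Module ℂ V₁']

/-! ### Subrepresentations, quotients and maximal framed subrepresentations -/

section SubQuot

variable {M : LinRep V₀ V₁} {U₀ : Submodule ℂ V₀} {U₁ : Submodule ℂ V₁}

/-- A subrepresentation as a representation. -/
def restrict (M : LinRep V₀ V₁) (h : M.IsSub U₀ U₁) : LinRep U₀ U₁ where
  a i := (M.a i).restrict (h.a_mem i)
  b i := (M.b i).restrict (h.b_mem i)
  c := M.c.restrict h.c_mem
  d := M.d.restrict h.d_mem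
  rel_a i w := Subtype.ext (M.rel_a i w)
  rel_b i w := Subtype.ext (M.rel_b i w)
  rel_da i w := Subtype.ext (M.rel_da i w)
  rel_cb i w := Subtype.ext (M.rel_cb i w)

theorem subtype_isTw (h : M.IsSub U₀ U₁) : IsTw 1 (M.restrict h) M U₀.subtype U₁.subtype :=
  isTw_one (fun _ _ => rfl) (fun _ _ => rfl) (fun _ => rfl) (fun _ => rfl)

/-- The quotient by a subrepresentation. -/
def quot (M : LinRep V₀ V₁) (h : M.IsSub U₀ U₁) : LinRep (V₀ ⧸ U₀) (V₁ ⧸ U₁) where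
  a i := U₀.mapQ U₁ (M.a i) (h.a_mem i)
  b i := U₁.mapQ U₀ (M.b i) (h.b_mem i)
  c := U₀.mapQ U₀ M.c h.c_mem
  d := U₁.mapQ U₁ M.d h.d_mem
  rel_a i w := by
    obtain ⟨w, rfl⟩ := Submodule.Quotient.mk_surjective _ w
    exact congrArg Submodule.Quotient.mk (M.rel_a i w)
  rel_b i w := by
    obtain ⟨w, rfl⟩ := Submodule.Quotient.mk_surjective _ w
    exact congrArg Submodule.Quotient.mk (M.rel_b i w)
  rel_da i w := by
    obtain ⟨w, rfl⟩ := Submodule.Quotient.mk_surjective _ w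
    exact congrArg Submodule.Quotient.mk (M.rel_da i w)
  rel_cb i w := by
    obtain ⟨w, rfl⟩ := Submodule.Quotient.mk_surjective _ w
    exact congrArg Submodule.Quotient.mk (M.rel_cb i w)

theorem mkQ_isTw (h : M.IsSub U₀ U₁) : IsTw 1 M (M.quot h) U₀.mkQ U₁.mkQ :=
  isTw_one (fun _ _ => rfl) (fun _ _ => rfl) (fun _ => rfl) (fun _ => rfl)

theorem IsSub.map_subtype (h : M.IsSub U₀ U₁) {A₀ : Submodule ℂ U₀} {A₁ : Submodule ℂ U₁}
    (hA : (M.restrict h).IsSub A₀ A₁) : M.IsSub (A₀.map U₀.subtype) (A₁.map U₁.subtype) := by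
  refine ⟨fun i w hw => ?_, fun i w hw => ?_, fun w hw => ?_, fun w hw => ?_⟩ <;>
    obtain ⟨w, hw, rfl⟩ := hw
  · exact ⟨_, hA.a_mem i w hw, rfl⟩
  · exact ⟨_, hA.b_mem i w hw, rfl⟩
  · exact ⟨_, hA.c_mem w hw, rfl⟩
  · exact ⟨_, hA.d_mem w hw, rfl⟩

theorem Nonpos.restrict {Θ : ℝ × ℝ} (hM : M.Nonpos Θ) (h : M.IsSub U₀ U₁) :
    (M.restrict h).Nonpos Θ := fun A₀ A₁ hA => by
  have := hM _ _ (h.map_subtype hA)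
  rwa [Submodule.finrank_map_subtype_eq, Submodule.finrank_map_subtype_eq] at this

theorem IsSub.comap_mkQ (h : M.IsSub U₀ U₁) {A₀ : Submodule ℂ (V₀ ⧸ U₀)}
    {A₁ : Submodule ℂ (V₁ ⧸ U₁)} (hA : (M.quot h).IsSub A₀ A₁) :
    M.IsSub (A₀.comap U₀.mkQ) (A₁.comap U₁.mkQ) :=
  ⟨fun i _ hw => hA.a_mem i _ hw, fun i _ hw => hA.b_mem i _ hw, fun _ hw => hA.c_mem _ hw,
    fun _ hw => hA.d_mem _ hw⟩

theorem finrank_comap_mkQ {V : Type} [AddCommGroup V] [Module ℂ V] [FiniteDimensional ℂ V]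
    (U : Submodule ℂ V) (A : Submodule ℂ (V ⧸ U)) :
    finrank ℂ (A.comap U.mkQ) = finrank ℂ A + finrank ℂ U := by
  have hU : U ≤ A.comap U.mkQ := by
    intro u hu
    rw [Submodule.mem_comap, Submodule.mkQ_apply, (Submodule.Quotient.mk_eq_zero _).2 hu]
    exact A.zero_mem
  let g : A.comap U.mkQ →ₗ[ℂ] V ⧸ U := U.mkQ ∘ₗ (A.comap U.mkQ).subtype
  have hr : LinearMap.range g = A := by
    rw [LinearMap.range_comp, Submodule.range_subtype,
      Submodule.map_comap_eq_of_surjective (Submodule.mkQ_surjective U)]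
  have hk : LinearMap.ker g = U.comap (A.comap U.mkQ).subtype := by
    rw [LinearMap.ker_comp, Submodule.ker_mkQ]
  have := LinearMap.finrank_range_add_finrank_ker g
  rw [hr, hk, (Submodule.comapSubtypeEquivOfLe hU).finrank_eq] at this
  exact this.symm

theorem frameMem_comap_mkQ {v : V₀ ⊕ V₁} (hv : FrameMem v U₀ U₁) (A₀ : Submodule ℂ (V₀ ⧸ U₀))
    (A₁ : Submodule ℂ (V₁ ⧸ U₁)) : FrameMem v (A₀.comap U₀.mkQ) (A₁.comap U₁.mkQ) := by
  rcases v with w | u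
  · change U₀.mkQ w ∈ A₀
    rw [Submodule.mkQ_apply, (Submodule.Quotient.mk_eq_zero _).2 hv]
    exact A₀.zero_mem
  · change U₁.mkQ u ∈ A₁
    rw [Submodule.mkQ_apply, (Submodule.Quotient.mk_eq_zero _).2 hv]
    exact A₁.zero_mem

theorem exists_frame_restrict {v : V₀ ⊕ V₁} (hv : FrameMem v U₀ U₁) :
    ∃ v' : U₀ ⊕ U₁, v'.map U₀.subtype U₁.subtype = v := by
  rcases v with w | u
  · exact ⟨Sum.inl ⟨w, hv⟩, rfl⟩
  · exact ⟨Sum.inr ⟨u, hv⟩, rfl⟩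

/-- A subrepresentation that contains the framing vector and has maximal weight among these. -/
structure IsMaxFramed (Θ : ℝ × ℝ) (M : LinRep V₀ V₁) (v : V₀ ⊕ V₁) (U₀ : Submodule ℂ V₀)
    (U₁ : Submodule ℂ V₁) : Prop where
  isSub : M.IsSub U₀ U₁
  mem : FrameMem v U₀ U₁
  max : ∀ A₀ A₁, M.IsSub A₀ A₁ → FrameMem v A₀ A₁ →
    wt Θ (finrank ℂ A₀) (finrank ℂ A₁) ≤ wt Θ (finrank ℂ U₀) (finrank ℂ U₁)

theorem IsMaxFramed.swap {Θ : ℝ × ℝ} {v : V₀ ⊕ V₁} (h : IsMaxFramed Θ M v U₀ U₁) :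
    IsMaxFramed Θ.swap M.swap v.swap U₁ U₀ :=
  ⟨h.isSub.swap, by have := h.mem; cases v <;> exact this, fun A₀ A₁ hA hv => by
    rw [wt_swap, wt_swap]
    exact h.max A₁ A₀ hA.swap (by cases v <;> exact hv)⟩

variable [FiniteDimensional ℂ V₀] [FiniteDimensional ℂ V₁]

theorem exists_isMaxFramed (Θ : ℝ × ℝ) (M : LinRep V₀ V₁) (v : V₀ ⊕ V₁) :
    ∃ U₀ U₁, IsMaxFramed Θ M v U₀ U₁ := by
  let P : Set (ℕ × ℕ) := {p | ∃ U₀ U₁, M.IsSub U₀ U₁ ∧ FrameMem v U₀ U₁ ∧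
    p = (finrank ℂ U₀, finrank ℂ U₁)}
  have hfin : P.Finite := by
    refine (Set.finite_Iic ((finrank ℂ V₀, finrank ℂ V₁) : ℕ × ℕ)).subset ?_
    rintro _ ⟨U₀, U₁, -, -, rfl⟩
    exact ⟨Submodule.finrank_le _, Submodule.finrank_le _⟩
  have hne : P.Nonempty := ⟨_, ⊤, ⊤, ⟨fun _ _ _ => trivial, fun _ _ _ => trivial,
    fun _ _ => trivial, fun _ _ => trivial⟩, by cases v <;> trivial, rfl⟩
  obtain ⟨_, ⟨U₀, U₁, h1, h2, rfl⟩, hmax⟩ :=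
    Set.exists_max_image P (fun p => wt Θ p.1 p.2) hfin hne
  exact ⟨U₀, U₁, h1, h2, fun A₀ A₁ hA hv => hmax _ ⟨A₀, A₁, hA, hv, rfl⟩⟩

theorem IsMaxFramed.semi {Θ : ℝ × ℝ} {v : V₀ ⊕ V₁} (h : IsMaxFramed Θ M v U₀ U₁)
    (hM : M.Nonpos Θ) {v' : U₀ ⊕ U₁} (hv' : v'.map U₀.subtype U₁.subtype = v) :
    (M.restrict h.isSub).Semi Θ v' := by
  refine ⟨hM.restrict _, fun A₀ A₁ hA hv => ?_⟩
  have := h.max _ _ (h.isSub.map_subtype hA) (by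
    subst hv'
    rcases v' with w | u
    · exact ⟨w, hv, rfl⟩
    · exact ⟨u, hv, rfl⟩)
  rwa [Submodule.finrank_map_subtype_eq, Submodule.finrank_map_subtype_eq] at this

/-- A subrepresentation of positive weight in the quotient would pull back to a framed one of larger
weight. Thus probes remain exact on the quotient. -/
theorem IsMaxFramed.quot_nonpos {Θ : ℝ × ℝ} {v : V₀ ⊕ V₁} (h : IsMaxFramed Θ M v U₀ U₁) :
    (M.quot h.isSub).Nonpos Θ := fun A₀ A₁ hA => by
  have := h.max _ _ (h.isSub.comap_mkQ hA) (frameMem_comap_mkQ h.mem A₀ A₁)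
  rw [finrank_comap_mkQ, finrank_comap_mkQ] at this
  simp only [wt, Nat.cast_add] at this ⊢
  linarith

end SubQuot

/-- The probe `(pt, n)` is exact and generated by the framing on `Θ`-semistable
representations. -/
structure Adm (Θ : ℝ × ℝ) (pt : Bool) (n : ℕ) : Prop where
  inj : ∀ {V₀ V₁ : Type} [AddCommGroup V₀] [Module ℂ V₀] [AddCommGroup V₁] [Module ℂ V₁]
    [FiniteDimensional ℂ V₀] [FiniteDimensional ℂ V₁] {M : LinRep V₀ V₁},
    M.Nonpos Θ → M.DiffInj pt n
  gen : ∀ {V₀ V₁ : Type} [AddCommGroup V₀] [Module ℂ V₀] [AddCommGroup V₁] [Module ℂ V₁]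
    [FiniteDimensional ℂ V₀] [FiniteDimensional ℂ V₁] {M : LinRep V₀ V₁} {v : V₀ ⊕ V₁},
    M.Semi Θ v → M.Generated v pt n
  pos : pt = false → 0 < n

/-- The dimension of the probe as a linear form in the dimension vector. -/
def form (pt : Bool) (n : ℕ) (x y : ℤ) : ℤ := n * y - (if pt then (n : ℤ) + 1 else (n : ℤ) - 1) * x

theorem Adm.finrank_probe [FiniteDimensional ℂ V₀] [FiniteDimensional ℂ V₁] {Θ : ℝ × ℝ}
    {pt : Bool} {n : ℕ} (hA : Adm Θ pt n) {M : LinRep V₀ V₁} (hM : M.Nonpos Θ) :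
    (finrank ℂ (M.probe pt n) : ℤ) = form pt n (finrank ℂ V₀) (finrank ℂ V₁) := by
  have h := (hA.inj hM).finrank_probe
  unfold form
  cases pt with
  | true =>
    rw [finrank_bdry_true] at h
    zify at h
    rw [if_pos rfl]
    linarith
  | false =>
    obtain ⟨m, rfl⟩ : ∃ m, n = m + 1 := ⟨n - 1, by have := hA.pos rfl; omega⟩
    rw [finrank_bdry_false] at h
    zify at h
    push_cast at h ⊢
    linarith

/-- The framed representation is isomorphic to its twist by `s`. -/
def Stabilized (s : Fin 5 → ℂ) (M : LinRep V₀ V₁) (v : V₀ ⊕ V₁) : Prop :=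
  ∃ g₀ g₁, IsTw s M M g₀ g₁ ∧ v.map g₀ g₁ = v

theorem map_swap {v : V₀ ⊕ V₁} {v' : V₀' ⊕ V₁'} {g₀ : V₀ → V₀'} {g₁ : V₁ → V₁'}
    (h : v.map g₀ g₁ = v') : v.swap.map g₁ g₀ = v'.swap := by
  subst h; cases v <;> rfl

theorem Stabilized.swap {s : Fin 5 → ℂ} {M : LinRep V₀ V₁} {v : V₀ ⊕ V₁}
    (h : M.Stabilized s v) : M.swap.Stabilized (swapT s) v.swap := by
  obtain ⟨g₀, g₁, hg, hv⟩ := h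
  exact ⟨g₁, g₀, hg.swap, map_swap hv⟩

/-! ### Comparison of framed representations with equal support -/

section Comparison

variable [FiniteDimensional ℂ V₀] [FiniteDimensional ℂ V₁] [FiniteDimensional ℂ V₀']
  [FiniteDimensional ℂ V₁']

theorem finrank_span_val {s : Fin 5 → ℂ} (hs : Generic s) {M : LinRep V₀ V₁} {v : V₀ ⊕ V₁}
    (h : M.Stabilized s v) (pt : Bool) (n : ℕ) :
    finrank ℂ (Submodule.span ℂ (Set.range (M.val v pt n))) =
      Nat.card {e // M.val v pt n e ≠ 0} := by
  obtain ⟨g₀, g₁, hg, hv⟩ := h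
  exact (M.isVal v pt n).finrank_span (probeMap_val hg hv pt n) hs

/-- Let `f` be a homomorphism from a framed representation `M'` to a semistable one with the same
vanishing monomials. On a maximal framed subrepresentation of `M'`, the probe of `f` is an
isomorphism. -/
theorem Adm.comparison {Θ : ℝ × ℝ} {pt : Bool} {n : ℕ} (hA : Adm Θ pt n) {s : Fin 5 → ℂ}
    (hs : Generic s) {M : LinRep V₀ V₁} {v : V₀ ⊕ V₁} {M' : LinRep V₀' V₁'} {v' : V₀' ⊕ V₁'}
    (hM : M.Semi Θ v) (hM' : M'.Nonpos Θ) (hMs : M.Stabilized s v) (hMs' : M'.Stabilized s v')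
    {f₀ : V₀' →ₗ[ℂ] V₀} {f₁ : V₁' →ₗ[ℂ] V₁} (hf : IsTw 1 M' M f₀ f₁) (hfv : v'.map f₀ f₁ = v)
    (hval : ∀ e, M.val v pt n e = 0 → M'.val v' pt n e = 0)
    {Y₀ : Submodule ℂ V₀'} {Y₁ : Submodule ℂ V₁'} (hY : IsMaxFramed Θ M' v' Y₀ Y₁) :
    form pt n (finrank ℂ Y₀) (finrank ℂ Y₁) = form pt n (finrank ℂ V₀) (finrank ℂ V₁) ∧
      form pt n (finrank ℂ (Y₀ ⊓ LinearMap.ker f₀ : Submodule ℂ V₀'))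
        (finrank ℂ (Y₁ ⊓ LinearMap.ker f₁ : Submodule ℂ V₁')) = 0 := by
  obtain ⟨y, hy⟩ := exists_frame_restrict hY.mem
  have hYsemi := hY.semi hM' hy
  have hKsub : M'.IsSub (Y₀ ⊓ LinearMap.ker f₀) (Y₁ ⊓ LinearMap.ker f₁) := by
    refine ⟨fun i w hw => ⟨hY.isSub.a_mem i w hw.1, ?_⟩, fun i w hw => ⟨hY.isSub.b_mem i w hw.1, ?_⟩,
      fun w hw => ⟨hY.isSub.c_mem w hw.1, ?_⟩, fun w hw => ⟨hY.isSub.d_mem w hw.1, ?_⟩⟩ <;>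
    have h0 := LinearMap.mem_ker.1 hw.2 <;> refine LinearMap.mem_ker.2 ?_
    · rw [hf.a, h0, map_zero, smul_zero]
    · rw [hf.b, h0, map_zero, smul_zero]
    · rw [hf.c, h0, map_zero, smul_zero]
    · rw [hf.d, h0, map_zero, smul_zero]
  set Y := M'.restrict hY.isSub
  set K := M'.restrict hKsub
  have hi := subtype_isTw hY.isSub
  have hiinj : Function.Injective (probeMap hi pt n) :=
    probeMap_injective hi (mkQ_isTw hY.isSub) Y₀.injective_subtype Y₁.injective_subtype
      (by rw [Submodule.ker_mkQ, Submodule.range_subtype]) (fun u => by simp)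
      (hA.inj hY.quot_nonpos)
  have hfi : IsTw 1 Y M (f₀ ∘ₗ Y₀.subtype) (f₁ ∘ₗ Y₁.subtype) :=
    ⟨fun k w => hf.a k w, fun k w => hf.b k w, fun w => hf.c w, fun w => hf.d w⟩
  have hk : IsTw 1 K Y (Submodule.inclusion inf_le_left) (Submodule.inclusion inf_le_left) :=
    isTw_one (fun _ _ => rfl) (fun _ _ => rfl) (fun _ => rfl) (fun _ => rfl)
  have hkinj : Function.Injective (probeMap hk pt n) := by
    refine probeMap_injective hk hfi (Submodule.inclusion_injective _)
      (Submodule.inclusion_injective _) (fun w hw => ?_) (fun u => u.2.2) (hA.inj hM.nonpos)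
    exact ⟨⟨w.1, w.2, hw⟩, rfl⟩
  -- The subrepresentation `Y` is semistable, so its probe is spanned by its own monomials, which
  -- map to those of `M'`.
  have hrange : LinearMap.range (probeMap hi pt n) =
      Submodule.span ℂ (Set.range (M'.val v' pt n)) := by
    rw [← Submodule.map_top, ← (hA.gen hYsemi).span_val, Submodule.map_span, ← Set.range_comp]
    congr 2
    ext e
    exact (probeMap_val hi hy pt n e).trans (by rw [mon_one, one_smul])
  -- One inclusion of supports is the hypothesis; the other holds because `f` carries monomials to
  -- monomials.
  have hcard : Nat.card {e // M'.val v' pt n e ≠ 0} = Nat.card {e // M.val v pt n e ≠ 0} := by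
    refine Nat.card_congr (Equiv.subtypeEquivRight fun e => not_congr ⟨fun h => ?_, hval e⟩)
    have := probeMap_val hf hfv pt n e
    rw [h, map_zero, mon_one, one_smul] at this
    exact this.symm
  have hdim : finrank ℂ (Y.probe pt n) = finrank ℂ (M.probe pt n) := by
    rw [← LinearMap.finrank_range_of_inj hiinj, hrange, finrank_span_val hs hMs', hcard,
      ← finrank_span_val hs hMs, (hA.gen hM).span_val, finrank_top]
  have hfis : LinearMap.range (probeMap hfi pt n) = ⊤ := by
    rw [eq_top_iff, ← (hA.gen hM).span_val, Submodule.span_le]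
    rintro _ ⟨e, rfl⟩
    refine ⟨Y.val y pt n e, ?_⟩
    rw [probeMap_val hfi (v' := v) (by rw [← hfv, ← hy, Sum.map_map]; rfl), mon_one, one_smul]
  have hfiinj : Function.Injective (probeMap hfi pt n) :=
    (LinearMap.injective_iff_surjective_of_finrank_eq_finrank hdim).2
      (LinearMap.range_eq_top.1 hfis)
  -- The probe of the kernel `K` embeds in that of `Y`, which embeds in that of `M`, and the
  -- composite is zero.
  have hK0 : finrank ℂ (K.probe pt n) = 0 := by
    rw [finrank_zero_iff]
    refine subsingleton_of_forall_eq 0 fun x => hkinj (hfiinj ?_)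
    rw [map_zero, map_zero]
    obtain ⟨F, rfl⟩ := Submodule.Quotient.mk_surjective _ x
    rw [probeMap_mk, probeMap_mk, tupleMap_one, tupleMap_one]
    rw [show (fun i => (f₁ ∘ₗ Y₁.subtype) ((Submodule.inclusion inf_le_left) (F i))) = 0 from
      funext fun i => (F i).2.2]
    rfl
  constructor
  · rw [← hA.finrank_probe hYsemi.nonpos, ← hA.finrank_probe hM.nonpos, hdim]
  · rw [← hA.finrank_probe (hM'.restrict hKsub), hK0]
    rfl

end Comparison

end LinRep

/-- A probe of representations or, if `sw`, of representations with exchanged vertices. -/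
structure Probe where
  sw : Bool
  pt : Bool
  n : ℕ

namespace Probe

variable {V₀ V₁ : Type} [AddCommGroup V₀] [Module ℂ V₀] [AddCommGroup V₁] [Module ℂ V₁]
variable {V₀' V₁' : Type} [AddCommGroup V₀'] [Module ℂ V₀'] [AddCommGroup V₁'] [Module ℂ V₁']

/-- The probe is exact and generated by the framing on `Θ`-semistable representations. -/
def Adm (p : Probe) (Θ : ℝ × ℝ) : Prop :=
  LinRep.Adm (if p.sw then Θ.swap else Θ) p.pt p.n

/-- The dimension of the probe as a linear form in the dimension vector. -/
def form (p : Probe) (x y : ℤ) : ℤ :=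
  if p.sw then LinRep.form p.pt p.n y x else LinRep.form p.pt p.n x y

/-- The monomials with nonzero image in the probe. -/
def supp (p : Probe) (M : LinRep V₀ V₁) (v : V₀ ⊕ V₁) : Set (Fin 5 → ℕ) :=
  {e | if p.sw then M.swap.val v.swap p.pt p.n e ≠ 0 else M.val v p.pt p.n e ≠ 0}

/-- The dimension vector can be read off from the two probes. -/
def Unimodular (p p' : Probe) : Prop :=
  ∀ x y : ℤ, p.form x y = 0 → p'.form x y = 0 → x = 0 ∧ y = 0

theorem form_sub (p : Probe) (x y x' y' : ℤ) :
    p.form (x - x') (y - y') = p.form x y - p.form x' y' := by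
  unfold form LinRep.form
  split_ifs <;> ring

end Probe

namespace LinRep

variable {V₀ V₁ : Type} [AddCommGroup V₀] [Module ℂ V₀] [AddCommGroup V₁] [Module ℂ V₁]
variable {V₀' V₁' : Type} [AddCommGroup V₀'] [Module ℂ V₀'] [AddCommGroup V₁'] [Module ℂ V₁']

theorem mon_swapT (s : Fin 5 → ℂ) (e : Fin 5 → ℕ) :
    mon (swapT s) e = mon s ![e 2, e 3, e 0, e 1, e 4] := by
  simp [mon, swapT, Fin.prod_univ_succ]
  ring

theorem generic_swapT {s : Fin 5 → ℂ} (hs : Generic s) : Generic (swapT s) := by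
  intro e e' h
  rw [mon_swapT, mon_swapT] at h
  have key := hs _ _ h
  intro i j
  have := key (![2, 3, 0, 1, 4] i) (![2, 3, 0, 1, 4] j)
  fin_cases i <;> fin_cases j <;> simpa using this

variable [FiniteDimensional ℂ V₀] [FiniteDimensional ℂ V₁] [FiniteDimensional ℂ V₀']
  [FiniteDimensional ℂ V₁']

theorem comparison {Θ : ℝ × ℝ} {p : Probe} (hp : p.Adm Θ) {s : Fin 5 → ℂ}
    (hs : Generic s) {M : LinRep V₀ V₁} {v : V₀ ⊕ V₁} {M' : LinRep V₀' V₁'} {v' : V₀' ⊕ V₁'}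
    (hM : M.Semi Θ v) (hM' : M'.Nonpos Θ) (hMs : M.Stabilized s v) (hMs' : M'.Stabilized s v')
    {f₀ : V₀' →ₗ[ℂ] V₀} {f₁ : V₁' →ₗ[ℂ] V₁} (hf : IsTw 1 M' M f₀ f₁) (hfv : v'.map f₀ f₁ = v)
    (hsupp : p.supp M' v' ⊆ p.supp M v)
    {Y₀ : Submodule ℂ V₀'} {Y₁ : Submodule ℂ V₁'} (hY : IsMaxFramed Θ M' v' Y₀ Y₁) :
    p.form (finrank ℂ Y₀) (finrank ℂ Y₁) = p.form (finrank ℂ V₀) (finrank ℂ V₁) ∧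
      p.form (finrank ℂ (Y₀ ⊓ LinearMap.ker f₀ : Submodule ℂ V₀'))
        (finrank ℂ (Y₁ ⊓ LinearMap.ker f₁ : Submodule ℂ V₁')) = 0 := by
  obtain ⟨sw, pt, n⟩ := p
  cases sw with
  | false =>
    exact Adm.comparison (hA := hp) hs hM hM' hMs hMs' hf hfv
      (fun e he => by_contra fun h => hsupp (show M'.val v' pt n e ≠ 0 from h) he) hY
  | true =>
    have hf' := hf.swap
    rw [swapT_one] at hf'
    exact Adm.comparison (hA := hp) (generic_swapT hs) hM.swap hM'.swap hMs.swap hMs'.swap hf'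
      (map_swap hfv)
      (fun e he => by_contra fun h => hsupp (show M'.swap.val v'.swap pt n e ≠ 0 from h) he)
      hY.swap

/-- Both dimension forms vanish on the dimension vector of the kernel and on the difference of those
of source and target; by unimodularity both vectors are zero. -/
theorem bijective_of_supp {Θ : ℝ × ℝ} {p p' : Probe} (hp : p.Adm Θ) (hp' : p'.Adm Θ)
    (hpp : p.Unimodular p') {s : Fin 5 → ℂ}
    (hs : Generic s) {M : LinRep V₀ V₁} {v : V₀ ⊕ V₁} {M' : LinRep V₀' V₁'} {v' : V₀' ⊕ V₁'}
    (hM : M.Semi Θ v) (hM' : M'.Nonpos Θ) (hMs : M.Stabilized s v) (hMs' : M'.Stabilized s v')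
    {f₀ : V₀' →ₗ[ℂ] V₀} {f₁ : V₁' →ₗ[ℂ] V₁} (hf : IsTw 1 M' M f₀ f₁) (hfv : v'.map f₀ f₁ = v)
    (hsupp : p.supp M' v' ⊆ p.supp M v) (hsupp' : p'.supp M' v' ⊆ p'.supp M v)
    {Y₀ : Submodule ℂ V₀'} {Y₁ : Submodule ℂ V₁'} (hY : IsMaxFramed Θ M' v' Y₀ Y₁) :
    Function.Bijective (f₀ ∘ₗ Y₀.subtype) ∧ Function.Bijective (f₁ ∘ₗ Y₁.subtype) := by
  obtain ⟨h1, h2⟩ := comparison hp hs hM hM' hMs hMs' hf hfv hsupp hY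
  obtain ⟨h1', h2'⟩ := comparison hp' hs hM hM' hMs hMs' hf hfv hsupp' hY
  obtain ⟨k0, k1⟩ := hpp _ _ h2 h2'
  obtain ⟨d0, d1⟩ := hpp _ _ ((p.form_sub _ _ _ _).trans (sub_eq_zero.2 h1))
    ((p'.form_sub _ _ _ _).trans (sub_eq_zero.2 h1'))
  have aux : ∀ {A B : Type} [AddCommGroup A] [Module ℂ A] [AddCommGroup B] [Module ℂ B]
      [FiniteDimensional ℂ A] [FiniteDimensional ℂ B] (f : A →ₗ[ℂ] B) (Y : Submodule ℂ A),
      (finrank ℂ (Y ⊓ LinearMap.ker f : Submodule ℂ A) : ℤ) = 0 →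
      (finrank ℂ Y : ℤ) - finrank ℂ B = 0 → Function.Bijective (f ∘ₗ Y.subtype) := by
    intro A B _ _ _ _ _ _ f Y hk hd
    have hbot : Y ⊓ LinearMap.ker f = ⊥ := Submodule.finrank_eq_zero.1 (by exact_mod_cast hk)
    have hinj : Function.Injective (f ∘ₗ Y.subtype) := by
      rw [← LinearMap.ker_eq_bot, LinearMap.ker_eq_bot']
      intro y hy
      have : (y : A) ∈ Y ⊓ LinearMap.ker f := ⟨y.2, hy⟩
      rw [hbot] at this
      exact Subtype.ext this
    exact ⟨hinj, (LinearMap.injective_iff_surjective_of_finrank_eq_finrank (by omega)).1 hinj⟩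
  exact ⟨aux f₀ Y₀ k0 d0, aux f₁ Y₁ k1 d1⟩

end LinRep

/-! ### Choice of two probes off the walls -/

namespace LinRep

theorem Adm.of_false {Θ : ℝ × ℝ} {k : ℕ} (hk : 0 < k) (h1 : Θ.2 < 0)
    (hgen : (k + 1 : ℝ) * Θ.1 + k * Θ.2 < 0)
    (hinj : k = 1 ∨ 0 < (k - 1 : ℝ) * Θ.1 + (k - 2 : ℝ) * Θ.2) : Adm Θ false k where
  inj hM := by
    rcases hinj with rfl | h
    · exact diffInj_false_one _
    rcases Nat.lt_or_ge k 2 with h' | h'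
    · obtain rfl : k = 1 := by omega
      exact diffInj_false_one _
    obtain ⟨m, rfl⟩ := Nat.exists_eq_add_of_le' h'
    refine hM.diffInj_false h1 ?_
    push_cast at h
    convert h using 2 <;> ring
  gen hM := by
    obtain ⟨m, rfl⟩ := Nat.exists_eq_add_of_le' hk
    refine hM.generated_false h1 ?_
    push_cast at hgen
    convert hgen using 2
    ring
  pos _ := hk

theorem Adm.of_true {Θ : ℝ × ℝ} {k : ℕ} (h0 : 0 < Θ.1) (h1 : Θ.2 < 0)
    (hgen : (k - 1 : ℝ) * Θ.1 + k * Θ.2 < 0)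
    (hinj : 0 < (k + 1 : ℝ) * Θ.1 + (k + 2 : ℝ) * Θ.2) : Adm Θ true k where
  inj hM := hM.diffInj_true h1 hinj
  gen hM := hM.generated_true h0 hgen
  pos h := by simp at h

/-- In this chamber the whole representation has nonpositive weight only if it is zero. -/
theorem Adm.of_pos {Θ : ℝ × ℝ} (h0 : 0 < Θ.1) (h1 : 0 < Θ.2) : Adm Θ false 1 where
  inj _ := diffInj_false_one _
  gen {V₀ V₁} _ _ _ _ _ _ M v hM := by
    have h := hM.nonpos ⊤ ⊤ ⟨fun _ _ _ => trivial, fun _ _ _ => trivial, fun _ _ => trivial,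
      fun _ _ => trivial⟩
    rw [wt, finrank_top, finrank_top] at h
    have hV : finrank ℂ V₁ = 0 := by
      by_contra hne
      have : (0 : ℝ) < finrank ℂ V₁ := by exact_mod_cast Nat.pos_of_ne_zero hne
      have : (0 : ℝ) ≤ finrank ℂ V₀ := by positivity
      nlinarith [mul_nonneg h0.le this]
    have := finrank_zero_iff.1 hV
    intro N _ _ _
    exact Subsingleton.elim _ _
  pos _ := one_pos

/-- Generation bounds the index of a probe from one side and injectivity from the other. Since `Θ`
lies strictly between two consecutive walls, exactly the room for two consecutive indices is used,
and their forms have determinant ±1. -/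
theorem exists_adm_pair {Θ : ℝ × ℝ} (h0 : 0 < Θ.1) (h1 : Θ.2 < 0)
    (hA : ∀ m : ℕ, (m + 1 : ℝ) * Θ.1 + m * Θ.2 ≠ 0)
    (hB : ∀ m : ℕ, (m : ℝ) * Θ.1 + (m + 1) * Θ.2 ≠ 0) (hC : Θ.1 + Θ.2 ≠ 0) :
    ∃ pt n n', Adm Θ pt n ∧ Adm Θ pt n' ∧
      ∀ x y, form pt n x y = 0 → form pt n' x y = 0 → x = 0 ∧ y = 0 := by
  classical
  rcases lt_or_gt_of_ne hC with hC | hC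
  -- The least such `k` locates the chamber; it is not `0` as `Θ.1 > 0`. Failure at `k - 1` is
  -- strict because `Θ` is on no wall.
  · have hex : ∃ k : ℕ, (k + 1 : ℝ) * Θ.1 + k * Θ.2 < 0 := by
      obtain ⟨k, hk⟩ := exists_nat_gt (Θ.1 / -(Θ.1 + Θ.2))
      refine ⟨k, ?_⟩
      rw [div_lt_iff₀ (by linarith)] at hk
      linarith
    obtain ⟨j, hj⟩ : ∃ j, Nat.find hex = j + 1 := Nat.exists_eq_succ_of_ne_zero fun h => by
      have := Nat.find_spec hex
      rw [h] at this
      norm_num at this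
      linarith
    have hs := Nat.find_spec hex
    rw [hj] at hs
    have hm := lt_of_le_of_ne (not_lt.1 (Nat.find_min hex (m := j) (by omega))) (hA j).symm
    push_cast at hs
    refine ⟨false, j + 1, j + 2, .of_false (by omega) h1 (by push_cast; linarith) (.inr ?_),
      .of_false (by omega) h1 (by push_cast; linarith) (.inr (by push_cast; linarith)),
      fun x y hx hy => ?_⟩
    · push_cast; linarith
    · simp only [form, Bool.false_eq_true, ↓reduceIte] at hx hy
      push_cast at hx hy
      constructor
      · linear_combination ((j : ℤ) + 2) * hx - (j + 1) * hy
      · linear_combination ((j : ℤ) + 1) * hx - j * hy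
  · have hex : ∃ k : ℕ, 0 ≤ (k : ℝ) * Θ.1 + (k + 1) * Θ.2 := by
      obtain ⟨k, hk⟩ := exists_nat_gt (-Θ.2 / (Θ.1 + Θ.2))
      refine ⟨k, ?_⟩
      rw [div_lt_iff₀ (by linarith)] at hk
      linarith
    obtain ⟨j, hj⟩ : ∃ j, Nat.find hex = j + 1 := Nat.exists_eq_succ_of_ne_zero fun h => by
      have := Nat.find_spec hex
      rw [h] at this
      norm_num at this
      linarith
    have hs := lt_of_le_of_ne (Nat.find_spec hex) (hB _).symm
    rw [hj] at hs
    have hm := not_le.1 (Nat.find_min hex (m := j) (by omega))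
    push_cast at hs
    -- Here `j` can be `0`. The probe of index `0` is the zero space with form `-x`: its injectivity
    -- forces `V₀ = 0`.
    refine ⟨true, j + 1, j, .of_true h0 h1 (by push_cast; linarith) (by push_cast; linarith),
      .of_true h0 h1 (by linarith) (by linarith), fun x y hx hy => ?_⟩
    simp only [form, ↓reduceIte] at hx hy
    push_cast at hx hy
    constructor
    · linear_combination (j : ℤ) * hx - (j + 1) * hy
    · linear_combination ((j : ℤ) + 1) * hx - (j + 2) * hy

end LinRep

theorem exists_probes {Θ : ℝ × ℝ} (hΘ : Θ ∉ walls) (hΘ0 : Θ ≠ 0) :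
    ∃ p p' : Probe, p.Adm Θ ∧ p'.Adm Θ ∧ p.Unimodular p' := by
  have hA : Θ.1 ≠ Θ.2 → ∀ m : ℕ, (m + 1 : ℝ) * Θ.1 + m * Θ.2 ≠ 0 := fun hne m h => hΘ <| by
    have : ((m + 1 : ℕ) : ℝ) * Θ.1 + (((m + 1 : ℕ) : ℝ) - 1) * Θ.2 = 0 := by
      push_cast; linarith
    rcases lt_or_gt_of_ne hne with h' | h'
    · exact .inl (.inl (.inl (.inl (.inl ⟨h', m + 1, by omega, this⟩))))
    · exact .inl (.inl (.inr ⟨h', m + 1, by omega, this⟩))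
  have hB : Θ.1 ≠ Θ.2 → ∀ m : ℕ, (m : ℝ) * Θ.1 + (m + 1) * Θ.2 ≠ 0 := fun hne m h => hΘ <| by
    rcases lt_or_gt_of_ne hne with h' | h'
    · exact .inl (.inl (.inl (.inl (.inr ⟨h', m, h⟩))))
    · exact .inl (.inr ⟨h', m, h⟩)
  have hC : Θ.1 ≠ Θ.2 → Θ.1 + Θ.2 ≠ 0 := fun hne h => hΘ <| by
    rcases lt_or_gt_of_ne hne with h' | h'
    · exact .inl (.inl (.inl (.inr ⟨h', h⟩)))
    · exact .inr ⟨h', h⟩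
  have h0 : Θ.1 ≠ 0 := fun h => by
    by_cases hne : Θ.1 = Θ.2
    · exact hΘ0 (Prod.ext h (hne ▸ h))
    · exact hA hne 0 (by simp [h])
  have h1 : Θ.2 ≠ 0 := fun h => by
    by_cases hne : Θ.1 = Θ.2
    · exact hΘ0 (Prod.ext (hne.trans h) h)
    · exact hB hne 0 (by simp [h])
  have huni : Probe.Unimodular ⟨false, false, 1⟩ ⟨true, false, 1⟩ := fun x y hx hy => by
    simp [Probe.form, LinRep.form] at hx hy
    exact ⟨hy, hx⟩
  rcases lt_or_gt_of_ne h0 with h0 | h0 <;> rcases lt_or_gt_of_ne h1 with h1 | h1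
  -- For `(false, 1)` there are no relations, so the two probes are `V₁` and `V₀` themselves.
  · exact ⟨⟨false, false, 1⟩, ⟨true, false, 1⟩,
      LinRep.Adm.of_false one_pos h1 (by push_cast; linarith) (.inl rfl),
      LinRep.Adm.of_false (Θ := Θ.swap) one_pos h0 (by simp; linarith) (.inl rfl), huni⟩
  · obtain ⟨pt, n, n', h, h', hu⟩ := LinRep.exists_adm_pair (Θ := Θ.swap) h1 h0
      (fun m h => hB (by linarith) m (by simp at h; linarith))
      (fun m h => hA (by linarith) m (by simp at h; linarith))
      (fun h => hC (by linarith) (by simp at h; linarith))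
    exact ⟨⟨true, pt, n⟩, ⟨true, pt, n'⟩, h, h', fun x y hx hy => (hu y x hx hy).symm⟩
  · obtain ⟨pt, n, n', h, h', hu⟩ := LinRep.exists_adm_pair h0 h1 (hA (by linarith))
      (hB (by linarith)) (hC (by linarith))
    exact ⟨⟨false, pt, n⟩, ⟨false, pt, n'⟩, h, h', hu⟩
  · exact ⟨⟨false, false, 1⟩, ⟨true, false, 1⟩, LinRep.Adm.of_pos h0 h1,
      LinRep.Adm.of_pos (Θ := Θ.swap) h1 h0, huni⟩

/-! ### Direct sums, extensions and sections -/

namespace LinRep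

variable {V₀ V₁ : Type} [AddCommGroup V₀] [Module ℂ V₀] [AddCommGroup V₁] [Module ℂ V₁]
variable {V₀' V₁' : Type} [AddCommGroup V₀'] [Module ℂ V₀'] [AddCommGroup V₁'] [Module ℂ V₁']
variable {V₀'' V₁'' : Type} [AddCommGroup V₀''] [Module ℂ V₀''] [AddCommGroup V₁'']
  [Module ℂ V₁'']

theorem IsTw.b_one {M : LinRep V₀ V₁} {M' : LinRep V₀' V₁'}
    {f₀ : V₀ →ₗ[ℂ] V₀'} {f₁ : V₁ →ₗ[ℂ] V₁'} (h : IsTw 1 M M' f₀ f₁) (k u) :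
    f₀ (M.b k u) = M'.b k (f₁ u) := by
  rw [h.b]; fin_cases k <;> simp

theorem IsTw.c_one {M : LinRep V₀ V₁} {M' : LinRep V₀' V₁'}
    {f₀ : V₀ →ₗ[ℂ] V₀'} {f₁ : V₁ →ₗ[ℂ] V₁'} (h : IsTw 1 M M' f₀ f₁) (w) :
    f₀ (M.c w) = M'.c (f₀ w) := by
  rw [h.c]; simp

theorem IsTw.d_one {M : LinRep V₀ V₁} {M' : LinRep V₀' V₁'}
    {f₀ : V₀ →ₗ[ℂ] V₀'} {f₁ : V₁ →ₗ[ℂ] V₁'} (h : IsTw 1 M M' f₀ f₁) (u) :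
    f₁ (M.d u) = M'.d (f₁ u) := by
  rw [h.d]; simp

theorem IsTw.comp_one {M : LinRep V₀ V₁} {M' : LinRep V₀' V₁'} {M'' : LinRep V₀'' V₁''}
    {f₀ : V₀ →ₗ[ℂ] V₀'} {f₁ : V₁ →ₗ[ℂ] V₁'} {g₀ : V₀' →ₗ[ℂ] V₀''} {g₁ : V₁' →ₗ[ℂ] V₁''}
    (hg : IsTw 1 M' M'' g₀ g₁) (hf : IsTw 1 M M' f₀ f₁) :
    IsTw 1 M M'' (g₀ ∘ₗ f₀) (g₁ ∘ₗ f₁) :=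
  isTw_one (fun k w => by simp [hf.a_one, hg.a_one]) (fun k w => by simp [hf.b_one, hg.b_one])
    (fun w => by simp [hf.c_one, hg.c_one]) (fun w => by simp [hf.d_one, hg.d_one])

theorem IsTw.symm_one {M : LinRep V₀ V₁} {M' : LinRep V₀' V₁'} {e₀ : V₀ ≃ₗ[ℂ] V₀'}
    {e₁ : V₁ ≃ₗ[ℂ] V₁'} (h : IsTw 1 M M' (e₀ : V₀ →ₗ[ℂ] V₀') (e₁ : V₁ →ₗ[ℂ] V₁')) :
    IsTw 1 M' M (e₀.symm : V₀' →ₗ[ℂ] V₀) (e₁.symm : V₁' →ₗ[ℂ] V₁) := by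
  refine isTw_one (fun k w => ?_) (fun k w => ?_) (fun w => ?_) (fun w => ?_)
  · exact e₁.injective (by simpa using (h.a_one k (e₀.symm w)).symm)
  · exact e₀.injective (by simpa using (h.b_one k (e₁.symm w)).symm)
  · exact e₀.injective (by simpa using (h.c_one (e₀.symm w)).symm)
  · exact e₁.injective (by simpa using (h.d_one (e₁.symm w)).symm)

/-- The direct sum of two representations. -/
def prod (M : LinRep V₀ V₁) (M' : LinRep V₀' V₁') : LinRep (V₀ × V₀') (V₁ × V₁') where
  a i := (M.a i).prodMap (M'.a i)
  b i := (M.b i).prodMap (M'.b i)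
  c := M.c.prodMap M'.c
  d := M.d.prodMap M'.d
  rel_a i w := Prod.ext (M.rel_a i w.1) (M'.rel_a i w.2)
  rel_b i w := Prod.ext (M.rel_b i w.1) (M'.rel_b i w.2)
  rel_da i w := Prod.ext (M.rel_da i w.1) (M'.rel_da i w.2)
  rel_cb i w := Prod.ext (M.rel_cb i w.1) (M'.rel_cb i w.2)

section Prod

variable (M : LinRep V₀ V₁) (M' : LinRep V₀' V₁')

theorem fst_isTw :
    IsTw 1 (M.prod M') M (LinearMap.fst ℂ V₀ V₀') (LinearMap.fst ℂ V₁ V₁') :=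
  isTw_one (fun _ _ => rfl) (fun _ _ => rfl) (fun _ => rfl) (fun _ => rfl)

theorem snd_isTw :
    IsTw 1 (M.prod M') M' (LinearMap.snd ℂ V₀ V₀') (LinearMap.snd ℂ V₁ V₁') :=
  isTw_one (fun _ _ => rfl) (fun _ _ => rfl) (fun _ => rfl) (fun _ => rfl)

theorem inl_isTw :
    IsTw 1 M (M.prod M') (LinearMap.inl ℂ V₀ V₀') (LinearMap.inl ℂ V₁ V₁') :=
  isTw_one (fun k _ => Prod.ext rfl (map_zero (M'.a k)).symm)
    (fun k _ => Prod.ext rfl (map_zero (M'.b k)).symm)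
    (fun _ => Prod.ext rfl (map_zero M'.c).symm) (fun _ => Prod.ext rfl (map_zero M'.d).symm)

theorem inr_isTw :
    IsTw 1 M' (M.prod M') (LinearMap.inr ℂ V₀ V₀') (LinearMap.inr ℂ V₁ V₁') :=
  isTw_one (fun k _ => Prod.ext (map_zero (M.a k)).symm rfl)
    (fun k _ => Prod.ext (map_zero (M.b k)).symm rfl)
    (fun _ => Prod.ext (map_zero M.c).symm rfl) (fun _ => Prod.ext (map_zero M.d).symm rfl)

variable {M M'}

theorem probe_prod (pt : Bool) (n : ℕ) (y : (M.prod M').probe pt n) :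
    probeMap (inl_isTw M M') pt n (probeMap (fst_isTw M M') pt n y) +
      probeMap (inr_isTw M M') pt n (probeMap (snd_isTw M M') pt n y) = y := by
  obtain ⟨F, rfl⟩ := Submodule.Quotient.mk_surjective _ y
  simp only [probeMap_mk, tupleMap_one, ← Submodule.Quotient.mk_add]
  congr 1
  ext i <;> simp

/-- The probe of a direct sum is the direct sum of the probes, so with equal supports the sum with
diagonal framing acquires no new monomials. -/
theorem val_prod_eq_zero {v : V₀ ⊕ V₁} {v' : V₀' ⊕ V₁'} {w : (V₀ × V₀') ⊕ (V₁ × V₁')}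
    (hv : w.map Prod.fst Prod.fst = v) (hv' : w.map Prod.snd Prod.snd = v') {pt : Bool} {n : ℕ}
    {e : Fin 5 → ℕ} (h : M.val v pt n e = 0) (h' : M'.val v' pt n e = 0) :
    (M.prod M').val w pt n e = 0 := by
  rw [← probe_prod pt n ((M.prod M').val w pt n e), probeMap_val (fst_isTw M M') hv,
    probeMap_val (snd_isTw M M') hv', h, h']
  simp

theorem supp_prod_subset {p : Probe} {v : V₀ ⊕ V₁} {v' : V₀' ⊕ V₁'}
    {w : (V₀ × V₀') ⊕ (V₁ × V₁')} (hv : w.map Prod.fst Prod.fst = v)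
    (hv' : w.map Prod.snd Prod.snd = v') (h : p.supp M v = p.supp M' v') :
    p.supp (M.prod M') w ⊆ p.supp M v := by
  obtain ⟨sw, pt, n⟩ := p
  intro e he
  by_contra h1
  have h2 := h ▸ h1
  cases sw with
  | false => exact he (val_prod_eq_zero hv hv' (not_not.1 h1) (not_not.1 h2))
  | true =>
    exact he (val_prod_eq_zero (M := M.swap) (M' := M'.swap) (map_swap hv) (map_swap hv')
      (not_not.1 h1) (not_not.1 h2))

theorem Stabilized.prod {s : Fin 5 → ℂ} {v : V₀} {v' : V₀'}
    (h : M.Stabilized s (Sum.inl v)) (h' : M'.Stabilized s (Sum.inl v')) :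
    (M.prod M').Stabilized s (Sum.inl (v, v')) := by
  obtain ⟨g₀, g₁, hg, hv⟩ := h
  obtain ⟨g₀', g₁', hg', hv'⟩ := h'
  exact ⟨g₀.prodMap g₀', g₁.prodMap g₁',
    ⟨fun k w => Prod.ext (hg.a k w.1) (hg'.a k w.2), fun k w => Prod.ext (hg.b k w.1) (hg'.b k w.2),
      fun w => Prod.ext (hg.c w.1) (hg'.c w.2), fun w => Prod.ext (hg.d w.1) (hg'.d w.2)⟩,
    congrArg Sum.inl (Prod.ext (Sum.inl.inj hv) (Sum.inl.inj hv'))⟩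

end Prod

theorem finrank_map_add_finrank_comap {A B C : Type} [AddCommGroup A] [Module ℂ A]
    [AddCommGroup B] [Module ℂ B] [AddCommGroup C] [Module ℂ C] [FiniteDimensional ℂ B]
    {i : A →ₗ[ℂ] B} {p : B →ₗ[ℂ] C} (hi : Function.Injective i)
    (h : LinearMap.range i = LinearMap.ker p) (U : Submodule ℂ B) :
    finrank ℂ (U.map p) + finrank ℂ (U.comap i) = finrank ℂ U := by
  have h1 := LinearMap.finrank_range_add_finrank_ker (p ∘ₗ U.subtype)
  rw [LinearMap.range_comp, Submodule.range_subtype] at h1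
  have h2 : (LinearMap.ker (p ∘ₗ U.subtype)).map U.subtype = (U.comap i).map i := by
    rw [LinearMap.ker_comp, Submodule.map_comap_subtype, Submodule.map_comap_eq, h, inf_comm]
  rw [← h1, ← Submodule.finrank_map_subtype_eq U, h2,
    (Submodule.equivMapOfInjective i hi (U.comap i)).finrank_eq]

variable [FiniteDimensional ℂ V₀] [FiniteDimensional ℂ V₁] [FiniteDimensional ℂ V₀']
  [FiniteDimensional ℂ V₁'] [FiniteDimensional ℂ V₀''] [FiniteDimensional ℂ V₁'']

theorem Nonpos.extension {Θ : ℝ × ℝ} {M' : LinRep V₀' V₁'} {M : LinRep V₀ V₁}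
    {M'' : LinRep V₀'' V₁''} (h' : M'.Nonpos Θ) (h'' : M''.Nonpos Θ)
    {i₀ : V₀' →ₗ[ℂ] V₀} {i₁ : V₁' →ₗ[ℂ] V₁} {p₀ : V₀ →ₗ[ℂ] V₀''} {p₁ : V₁ →ₗ[ℂ] V₁''}
    (hi : IsTw 1 M' M i₀ i₁) (hp : IsTw 1 M M'' p₀ p₁)
    (hi₀ : Function.Injective i₀) (hi₁ : Function.Injective i₁)
    (h₀ : LinearMap.range i₀ = LinearMap.ker p₀) (h₁ : LinearMap.range i₁ = LinearMap.ker p₁) :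
    M.Nonpos Θ := by
  intro U₀ U₁ hU
  have k' := h' (U₀.comap i₀) (U₁.comap i₁) ⟨
    fun k w hw => by rw [Submodule.mem_comap, hi.a_one]; exact hU.a_mem k _ hw,
    fun k w hw => by rw [Submodule.mem_comap, hi.b_one]; exact hU.b_mem k _ hw,
    fun w hw => by rw [Submodule.mem_comap, hi.c_one]; exact hU.c_mem _ hw,
    fun w hw => by rw [Submodule.mem_comap, hi.d_one]; exact hU.d_mem _ hw⟩
  have k'' := h'' (U₀.map p₀) (U₁.map p₁) ⟨
    fun k w hw => by
      obtain ⟨w, hw, rfl⟩ := hw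
      exact ⟨_, hU.a_mem k _ hw, hp.a_one k w⟩,
    fun k w hw => by
      obtain ⟨w, hw, rfl⟩ := hw
      exact ⟨_, hU.b_mem k _ hw, hp.b_one k w⟩,
    fun w hw => by
      obtain ⟨w, hw, rfl⟩ := hw
      exact ⟨_, hU.c_mem _ hw, hp.c_one w⟩,
    fun w hw => by
      obtain ⟨w, hw, rfl⟩ := hw
      exact ⟨_, hU.d_mem _ hw, hp.d_one w⟩⟩
  rw [← finrank_map_add_finrank_comap hi₀ h₀ U₀, ← finrank_map_add_finrank_comap hi₁ h₁ U₁]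
  simp only [wt, Nat.cast_add] at k' k'' ⊢
  linarith

theorem Nonpos.prod {Θ : ℝ × ℝ} {M : LinRep V₀ V₁} {M' : LinRep V₀' V₁'} (h : M.Nonpos Θ)
    (h' : M'.Nonpos Θ) : (M.prod M').Nonpos Θ :=
  h.extension h' (inl_isTw M M') (snd_isTw M M') LinearMap.inl_injective LinearMap.inl_injective
    (LinearMap.range_inl ℂ V₀ V₀') (LinearMap.range_inl ℂ V₁ V₁')

section Section

variable {Θ : ℝ × ℝ} {p p' : Probe} (hp : p.Adm Θ) (hp' : p'.Adm Θ) (hpp : p.Unimodular p')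
  {s : Fin 5 → ℂ} (hs : Generic s) {M : LinRep V₀ V₁} {M' : LinRep V₀' V₁'}

include hp hp' hpp hs

/-- A maximal framed subrepresentation of `M'` maps isomorphically to `M`; the section is the
inverse followed by the inclusion. -/
theorem exists_section_of_supp {v : V₀} {v' : V₀'} (hM : M.Semi Θ (Sum.inl v))
    (hM' : M'.Nonpos Θ) (hMs : M.Stabilized s (Sum.inl v)) (hMs' : M'.Stabilized s (Sum.inl v'))
    {f₀ : V₀' →ₗ[ℂ] V₀} {f₁ : V₁' →ₗ[ℂ] V₁} (hf : IsTw 1 M' M f₀ f₁) (hfv : f₀ v' = v)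
    (hsupp : p.supp M' (Sum.inl v') ⊆ p.supp M (Sum.inl v))
    (hsupp' : p'.supp M' (Sum.inl v') ⊆ p'.supp M (Sum.inl v)) :
    ∃ σ₀ σ₁, IsTw 1 M M' σ₀ σ₁ ∧ (∀ w, f₀ (σ₀ w) = w) ∧ (∀ u, f₁ (σ₁ u) = u) ∧ σ₀ v = v' := by
  obtain ⟨Y₀, Y₁, hY⟩ := exists_isMaxFramed Θ M' (Sum.inl v')
  obtain ⟨b₀, b₁⟩ := bijective_of_supp hp hp' hpp hs hM hM' hMs hMs' hf (congrArg Sum.inl hfv)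
    hsupp hsupp' hY
  set e₀ := LinearEquiv.ofBijective _ b₀ with he₀
  set e₁ := LinearEquiv.ofBijective _ b₁ with he₁
  have he : IsTw 1 (M'.restrict hY.isSub) M (e₀ : Y₀ →ₗ[ℂ] V₀) (e₁ : Y₁ →ₗ[ℂ] V₁) :=
    hf.comp_one (subtype_isTw hY.isSub)
  refine ⟨_, _, (subtype_isTw hY.isSub).comp_one he.symm_one, fun w => e₀.apply_symm_apply w,
    fun u => e₁.apply_symm_apply u, ?_⟩
  have : e₀ ⟨v', hY.mem⟩ = v := hfv
  exact congrArg Subtype.val (e₀.symm_apply_eq.2 this.symm)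

theorem exists_bijective_of_supp {v : V₀} {v' : V₀'} (hM : M.Semi Θ (Sum.inl v))
    (hM' : M'.Semi Θ (Sum.inl v')) (hMs : M.Stabilized s (Sum.inl v))
    (hMs' : M'.Stabilized s (Sum.inl v'))
    (hsupp : p.supp M (Sum.inl v) = p.supp M' (Sum.inl v'))
    (hsupp' : p'.supp M (Sum.inl v) = p'.supp M' (Sum.inl v')) :
    ∃ f₀ f₁, IsTw 1 M M' f₀ f₁ ∧ Function.Bijective f₀ ∧ Function.Bijective f₁ ∧ f₀ v = v' := by
  obtain ⟨σ₀, σ₁, hσ, -, -, hσv⟩ := exists_section_of_supp hp hp' hpp hs hM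
    (hM.nonpos.prod hM'.nonpos) hMs (hMs.prod hMs') (fst_isTw M M') rfl
    (supp_prod_subset rfl rfl hsupp) (supp_prod_subset rfl rfl hsupp')
  have hf := (snd_isTw M M').comp_one hσ
  have hfv : (LinearMap.snd ℂ V₀ V₀' ∘ₗ σ₀) v = v' := by
    rw [LinearMap.comp_apply, hσv]; rfl
  -- The section of `M.prod M'` composed with the second projection is a framed homomorphism to
  -- `M'`; the comparison is now applied to it, with the whole of the semistable `M` as maximal
  -- subrepresentation.
  have hY : IsMaxFramed Θ M (Sum.inl v) ⊤ ⊤ :=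
    ⟨⟨fun _ _ _ => trivial, fun _ _ _ => trivial, fun _ _ => trivial, fun _ _ => trivial⟩, trivial,
      fun A₀ A₁ hA hv => by
        rw [finrank_top, finrank_top]
        exact hM.framed A₀ A₁ hA hv⟩
  obtain ⟨b₀, b₁⟩ := bijective_of_supp hp hp' hpp hs hM' hM.nonpos hMs' hMs hf
    (congrArg Sum.inl hfv) hsupp.le hsupp'.le hY
  have htop : ∀ {V : Type} [AddCommGroup V] [Module ℂ V],
      Function.Bijective (⊤ : Submodule ℂ V).subtype := fun {V} _ _ =>
    ⟨Subtype.val_injective, fun w => ⟨⟨w, trivial⟩, rfl⟩⟩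
  exact ⟨_, _, hf, (Function.Bijective.of_comp_iff _ htop).1 b₀,
    (Function.Bijective.of_comp_iff _ htop).1 b₁, hfv⟩

end Section

/-! ### Self-extensions and bounds on supports -/

section Deformation

variable {Θ : ℝ × ℝ} {s : Fin 5 → ℂ} {M : LinRep V₀ V₁} {v : V₀ ⊕ V₁} {M' : LinRep V₀' V₁'}
  {v' : V₀' ⊕ V₁'}

/-- A self-extension of a framed representation, together with compatible isomorphisms to the
twists. -/
structure TwistedDeformation (s : Fin 5 → ℂ) (M : LinRep V₀ V₁) (v : V₀ ⊕ V₁)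
    (M' : LinRep V₀' V₁') (v' : V₀' ⊕ V₁') where
  i₀ : V₀ →ₗ[ℂ] V₀'
  i₁ : V₁ →ₗ[ℂ] V₁'
  p₀ : V₀' →ₗ[ℂ] V₀
  p₁ : V₁' →ₗ[ℂ] V₁
  g₀ : V₀ →ₗ[ℂ] V₀
  g₁ : V₁ →ₗ[ℂ] V₁
  h₀ : V₀' →ₗ[ℂ] V₀'
  h₁ : V₁' →ₗ[ℂ] V₁'
  i_isTw : IsTw 1 M M' i₀ i₁
  p_isTw : IsTw 1 M' M p₀ p₁
  g_isTw : IsTw s M M g₀ g₁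
  h_isTw : IsTw s M' M' h₀ h₁
  inj₀ : Function.Injective i₀
  inj₁ : Function.Injective i₁
  surj₀ : Function.Surjective p₀
  surj₁ : Function.Surjective p₁
  exact₀ : LinearMap.range i₀ = LinearMap.ker p₀
  exact₁ : LinearMap.range i₁ = LinearMap.ker p₁
  comm₀ : ∀ w, i₀ (g₀ w) = h₀ (i₀ w)
  comm₁ : ∀ u, i₁ (g₁ u) = h₁ (i₁ u)
  p_frame : v'.map p₀ p₁ = v
  g_frame : v.map g₀ g₁ = v
  h_frame : v'.map h₀ h₁ = v'

/-- The deformation with exchanged vertices. -/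
def TwistedDeformation.swap (D : TwistedDeformation s M v M' v') :
    TwistedDeformation (swapT s) M.swap v.swap M'.swap v'.swap where
  i₀ := D.i₁
  i₁ := D.i₀
  p₀ := D.p₁
  p₁ := D.p₀
  g₀ := D.g₁
  g₁ := D.g₀
  h₀ := D.h₁
  h₁ := D.h₀
  i_isTw := by simpa only [swapT_one] using D.i_isTw.swap
  p_isTw := by simpa only [swapT_one] using D.p_isTw.swap
  g_isTw := D.g_isTw.swap
  h_isTw := D.h_isTw.swap
  inj₀ := D.inj₁
  inj₁ := D.inj₀
  surj₀ := D.surj₁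
  surj₁ := D.surj₀
  exact₀ := D.exact₁
  exact₁ := D.exact₀
  comm₀ := D.comm₁
  comm₁ := D.comm₀
  p_frame := map_swap D.p_frame
  g_frame := map_swap D.g_frame
  h_frame := map_swap D.h_frame

/-- Exactness places the probe of `M` inside that of the extension, as the kernel of the reduction;
a monomial that vanishes on `M` lands there. -/
theorem Adm.val_eq_zero_of_deformation {pt : Bool} {n : ℕ} (hA : Adm Θ pt n) (hs : Generic s)
    (hM : M.Semi Θ v) (D : TwistedDeformation s M v M' v') {e : Fin 5 → ℕ}
    (he : M.val v pt n e = 0) : M'.val v' pt n e = 0 := by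
  have hlen : frameLen v n = frameLen v' n := by rw [← D.p_frame, frameLen_map]
  refine (M.isVal v pt n).eq_zero_of_deformation (probeMap_val D.g_isTw D.g_frame pt n) hs
    (hA.gen hM).span_val (hlen ▸ M'.isVal v' pt n) (probeMap_val D.h_isTw D.h_frame pt n)
    (ε := probeMap D.i_isTw pt n)
    (probeMap_injective D.i_isTw D.p_isTw D.inj₀ D.inj₁ D.exact₀.ge
      (fun u => D.exact₁.le ⟨u, rfl⟩) (hA.inj hM.nonpos)) (fun k l y => ?_) (fun y => ?_)
    (fun e he => ?_) e he
  · rw [probeMap_opX]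
    fin_cases k <;> fin_cases l <;> simp
  · obtain ⟨F, rfl⟩ := Submodule.Quotient.mk_surjective _ y
    simp only [probeMap_mk, tupleMap_one]
    congr 1
    ext j
    simp only [tupleMap_apply, map_smul, D.comm₁]
  · refine ker_probeMap_le D.i_isTw D.p_isTw D.surj₀ D.exact₁.ge pt n ?_
    rw [LinearMap.mem_ker, probeMap_val D.p_isTw D.p_frame, he, smul_zero]

theorem supp_subset_of_deformation {p : Probe} (hp : p.Adm Θ) (hs : Generic s)
    (hM : M.Semi Θ v) (D : TwistedDeformation s M v M' v') : p.supp M' v' ⊆ p.supp M v := by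
  obtain ⟨sw, pt, n⟩ := p
  intro e he
  by_contra h
  cases sw with
  | false => exact he (Adm.val_eq_zero_of_deformation hp hs hM D (not_not.1 h))
  | true =>
    exact he (Adm.val_eq_zero_of_deformation hp (generic_swapT hs) hM.swap D.swap (not_not.1 h))

end Deformation

theorem finrank_probe_le (M : LinRep V₀ V₁) (pt : Bool) (n : ℕ) :
    finrank ℂ (M.probe pt n) ≤ n * finrank ℂ V₁ := by
  refine (Submodule.finrank_quotient_le _).trans ?_
  simp [Module.finrank_pi_fintype]

theorem le_of_val_ne_zero {s : Fin 5 → ℂ} (hs : Generic s) {M : LinRep V₀ V₁} {v : V₀ ⊕ V₁}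
    (h : M.Stabilized s v) {pt : Bool} {n : ℕ} {e : Fin 5 → ℕ} (he : M.val v pt n e ≠ 0)
    (i : Fin 5) : e i ≤ n + 1 + n * finrank ℂ V₁ := by
  obtain ⟨g₀, g₁, hg, hv⟩ := h
  have h1 := ((M.isVal v pt n).degree_lt (probeMap_val hg hv pt n) hs he).trans_le
    (M.finrank_probe_le pt n)
  have h2 := ((M.isVal v pt n).deg e he).2
  have h3 : frameLen v n ≤ n + 1 := by cases v <;> simp [frameLen]
  fin_cases i <;> simp <;> omega

theorem le_of_mem_supp {p : Probe} {s : Fin 5 → ℂ} (hs : Generic s) {M : LinRep V₀ V₁}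
    {v : V₀ ⊕ V₁} (h : M.Stabilized s v) {e : Fin 5 → ℕ} (he : e ∈ p.supp M v) (i : Fin 5) :
    e i ≤ p.n + 1 + p.n * (finrank ℂ V₀ + finrank ℂ V₁) := by
  obtain ⟨sw, pt, n⟩ := p
  cases sw with
  | false =>
    have := le_of_val_ne_zero hs h (show M.val v pt n e ≠ 0 from he) i
    dsimp only
    nlinarith
  | true =>
    have := le_of_val_ne_zero (generic_swapT hs) h.swap
      (show M.swap.val v.swap pt n e ≠ 0 from he) i
    dsimp only
    nlinarith

/-- Scaling the arrows multiplies each monomial by a nonzero constant, so it cannot change which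
ones vanish. -/
theorem supp_of_isTw_id {p : Probe} {s : Fin 5 → ℂ} (hs : ∀ i, s i ≠ 0) {M M' : LinRep V₀ V₁}
    (h : IsTw s M M' LinearMap.id LinearMap.id) (v : V₀ ⊕ V₁) : p.supp M' v ⊆ p.supp M v := by
  obtain ⟨sw, pt, n⟩ := p
  have key : ∀ {A B : Type} [AddCommGroup A] [Module ℂ A] [AddCommGroup B] [Module ℂ B]
      {s : Fin 5 → ℂ}, (∀ i, s i ≠ 0) → ∀ {N N' : LinRep A B},
      IsTw s N N' LinearMap.id LinearMap.id → ∀ v e, N.val v pt n e = 0 → N'.val v pt n e = 0 := by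
    intro A B _ _ _ _ s hs N N' h v e he
    have := probeMap_val h (v := v) (v' := v) (by cases v <;> rfl) pt n e
    rw [he, map_zero] at this
    exact (smul_eq_zero.1 this.symm).resolve_left
      (Finset.prod_ne_zero_iff.2 fun i _ => pow_ne_zero _ (hs i))
  intro e he
  by_contra h1
  cases sw with
  | false => exact he (key hs h v e (not_not.1 h1))
  | true =>
    refine he (key (fun i => ?_) h.swap v.swap e (not_not.1 h1))
    fin_cases i <;> exact hs _

end LinRep

/-! ### A generic element of the Calabi-Yau torus -/

theorem eq_of_prod_pow_eq {a b c d a' b' c' d' : ℕ}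
    (h : 2 ^ a * 3 ^ b * 5 ^ c * 7 ^ d = 2 ^ a' * 3 ^ b' * 5 ^ c' * 7 ^ d') :
    a = a' ∧ b = b' ∧ c = c' ∧ d = d' := by
  have key : ∀ p : ℕ, ∀ a b c d : ℕ, (2 ^ a * 3 ^ b * 5 ^ c * 7 ^ d).factorization p =
      a * (Nat.factorization 2 p) + b * (Nat.factorization 3 p) + c * (Nat.factorization 5 p) +
        d * (Nat.factorization 7 p) := by
    intro p a b c d
    rw [Nat.factorization_mul (by positivity) (by positivity),
      Nat.factorization_mul (by positivity) (by positivity),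
      Nat.factorization_mul (by positivity) (by positivity)]
    simp [Nat.factorization_pow]
  have h2 := Nat.Prime.factorization Nat.prime_two
  have h3 := Nat.Prime.factorization Nat.prime_three
  have h5 := Nat.Prime.factorization Nat.prime_five
  have h7 := Nat.Prime.factorization (by norm_num : Nat.Prime 7)
  have hp : ∀ p, _ := fun p => congrArg (fun n => n.factorization p) h
  simp only [key, h2, h3, h5, h7, Finsupp.single_apply] at hp
  exact ⟨by simpa using hp 2, by simpa using hp 3, by simpa using hp 5, by simpa using hp 7⟩

/-- The weights are four primes and the inverse of their product 210. Clearing denominators, unique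
factorization recovers each of the first four exponents up to the shift by the last. -/
theorem exists_generic : ∃ t : T, t ∈ T₀ ∧ Generic (fun i => (t.1 i.castSucc : ℂ)) := by
  let u : ℂˣ := Units.mk0 (1 / 210) (by norm_num)
  let t : T := ⟨![Units.mk0 2 two_ne_zero, Units.mk0 3 three_ne_zero,
    Units.mk0 5 (by norm_num), Units.mk0 7 (by norm_num), u, u], rfl⟩
  refine ⟨t, ?_, fun e e' h => ?_⟩
  · change _ * _ * _ * _ * _ = _
    ext
    simp [t, u]
    norm_num
  · simp only [mon, Fin.prod_univ_five, t, u] at h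
    simp [Fin.castSucc, Fin.castAdd, Fin.castLE] at h
    have h' : (2 : ℂ) ^ (e 0 + e' 4) * 3 ^ (e 1 + e' 4) * 5 ^ (e 2 + e' 4) * 7 ^ (e 3 + e' 4) =
        2 ^ (e' 0 + e 4) * 3 ^ (e' 1 + e 4) * 5 ^ (e' 2 + e 4) * 7 ^ (e' 3 + e 4) := by
      have h210 : ∀ n : ℕ, (210 : ℂ) ^ n = 2 ^ n * 3 ^ n * 5 ^ n * 7 ^ n := fun n => by
        rw [← mul_pow, ← mul_pow, ← mul_pow]; norm_num
      rw [← div_eq_mul_inv, ← div_eq_mul_inv, div_eq_div_iff (pow_ne_zero _ (by norm_num))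
        (pow_ne_zero _ (by norm_num)), h210, h210] at h
      simp only [pow_add]
      linear_combination h
    obtain ⟨h0, h1, h2, h3⟩ := eq_of_prod_pow_eq (by exact_mod_cast h')
    intro i j
    fin_cases i <;> fin_cases j <;> simp <;> omega

/-! ### From families of matrices to linear representations and back -/

namespace FramedRep

variable {R : Type} [CommRing R] [Algebra ℂ R] {d₀ d₁ : ℕ}

/-- A family of representations as a representation on complex vector spaces. -/
def toLinRep (x : FramedRep R d₀ d₁) : LinRep (Fin d₀ → R) (Fin d₁ → R) where
  a i := (x.a i).mulVecLin.restrictScalars ℂ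
  b i := (x.b i).mulVecLin.restrictScalars ℂ
  c := x.c.mulVecLin.restrictScalars ℂ
  d := x.d.mulVecLin.restrictScalars ℂ
  rel_a i w := by simp [Matrix.mulVec_mulVec, ← Matrix.mul_assoc, x.rel_a]
  rel_b i w := by simp [Matrix.mulVec_mulVec, ← Matrix.mul_assoc, x.rel_b]
  rel_da i w := by simp [Matrix.mulVec_mulVec, x.rel_da]
  rel_cb i w := by simp [Matrix.mulVec_mulVec, x.rel_cb]

theorem isTw_of_intertwine {x y : FramedRep R d₀ d₁} {q : T} {g₀ : Matrix (Fin d₀) (Fin d₀) R}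
    {g₁ : Matrix (Fin d₁) (Fin d₁) R} (ha : ∀ i, g₁ * x.a i = (y.scale q).a i * g₀)
    (hb : ∀ i, g₀ * x.b i = (y.scale q).b i * g₁) (hc : g₀ * x.c = (y.scale q).c * g₀)
    (hd : g₁ * x.d = (y.scale q).d * g₁) :
    LinRep.IsTw (fun i => (q.1 i.castSucc : ℂ)) x.toLinRep y.toLinRep
      (g₀.mulVecLin.restrictScalars ℂ) (g₁.mulVecLin.restrictScalars ℂ) := by
  have hq : q.1 4 = q.1 5 := q.2
  refine ⟨fun k w => ?_, fun k w => ?_, fun w => ?_, fun w => ?_⟩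
  · have := congrArg (· *ᵥ w) (ha k)
    simp only [← Matrix.mulVec_mulVec, scale, Matrix.smul_mulVec] at this
    refine Eq.trans this ?_
    fin_cases k <;> rfl
  · have := congrArg (· *ᵥ w) (hb k)
    simp only [← Matrix.mulVec_mulVec, scale, Matrix.smul_mulVec] at this
    refine Eq.trans this ?_
    fin_cases k <;> rfl
  · have := congrArg (· *ᵥ w) hc
    simp only [← Matrix.mulVec_mulVec, scale, Matrix.smul_mulVec] at this
    exact this
  · have := congrArg (· *ᵥ w) hd
    simp only [← Matrix.mulVec_mulVec, scale, Matrix.smul_mulVec, ← hq] at this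
    exact this

theorem stabilized_of_iso {x : FramedRep R d₀ d₁} {q : T} (h : Iso x (x.scale q)) :
    x.toLinRep.Stabilized (fun i => (q.1 i.castSucc : ℂ)) (Sum.inl x.v) := by
  obtain ⟨g₀, g₁, ha, hb, hc, hd, hv⟩ := h
  exact ⟨_, _, isTw_of_intertwine ha hb hc hd, congrArg Sum.inl hv⟩

theorem scale_isTw (q : T) (x : FramedRep R d₀ d₁) :
    LinRep.IsTw (fun i => (q.1 i.castSucc : ℂ)) (x.scale q).toLinRep x.toLinRep
      LinearMap.id LinearMap.id := by
  have h := isTw_of_intertwine (x := x.scale q) (y := x) (q := q) (g₀ := 1) (g₁ := 1)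
    (fun _ => by rw [Matrix.one_mul, Matrix.mul_one])
    (fun _ => by rw [Matrix.one_mul, Matrix.mul_one])
    (by rw [Matrix.one_mul, Matrix.mul_one]) (by rw [Matrix.one_mul, Matrix.mul_one])
  rwa [Matrix.mulVecLin_one, Matrix.mulVecLin_one] at h

theorem IsSemistable.semi {Θ : ℝ × ℝ} {x : FramedRep ℂ d₀ d₁} (h : x.IsSemistable Θ) :
    x.toLinRep.Semi Θ (Sum.inl x.v) := by
  have hsub : ∀ {U₀ U₁}, x.toLinRep.IsSub U₀ U₁ → x.IsSubrep U₀ U₁ := fun h =>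
    ⟨h.a_mem, h.b_mem, h.c_mem, h.d_mem⟩
  refine ⟨fun U₀ U₁ hU => ?_, fun U₀ U₁ hU hv => ?_⟩
  · by_cases hbot : U₀ = ⊥ ∧ U₁ = ⊥
    · obtain ⟨rfl, rfl⟩ := hbot
      simp [wt]
    · exact h.sub _ _ (hsub hU) hbot
  · have htop : wt Θ (finrank ℂ (Fin d₀ → ℂ)) (finrank ℂ (Fin d₁ → ℂ)) =
        weight Θ (⊤ : Submodule ℂ (Fin d₀ → ℂ)) (⊤ : Submodule ℂ (Fin d₁ → ℂ)) := by
      rw [weight, finrank_top, finrank_top, wt]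
    rw [htop]
    by_cases h' : U₀ = ⊤ ∧ U₁ = ⊤
    · rw [h'.1, h'.2]; rfl
    · exact h.framed _ _ (hsub hU) hv h'

theorem IsSemistableFamily.semi {Θ : ℝ × ℝ} {x : FramedRep ℂ d₀ d₁}
    (h : x.IsSemistableFamily Θ) : x.toLinRep.Semi Θ (Sum.inl x.v) :=
  (h (AlgHom.id ℂ ℂ)).semi

/-- The matrix over `R` of a linear map on `ℂ^m`. -/
def extendScalars {m : ℕ} (σ : (Fin m → ℂ) →ₗ[ℂ] (Fin m → R)) : Matrix (Fin m) (Fin m) R :=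
  Matrix.of fun i j => σ (Pi.single j 1) i

theorem extendScalars_mulVec {m : ℕ} (σ : (Fin m → ℂ) →ₗ[ℂ] (Fin m → R)) (w : Fin m → ℂ) :
    extendScalars σ *ᵥ (fun i => algebraMap ℂ R (w i)) = σ w := by
  ext i
  conv_rhs => rw [pi_eq_sum_univ' w, map_sum]
  simp only [Finset.sum_apply, map_smul, Pi.smul_apply]
  simp only [Matrix.mulVec, dotProduct, extendScalars, Matrix.of_apply, Algebra.smul_def, mul_comm]

theorem extendScalars_mul {m n : ℕ} {σ : (Fin m → ℂ) →ₗ[ℂ] (Fin m → R)}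
    {τ : (Fin n → ℂ) →ₗ[ℂ] (Fin n → R)} {A : Matrix (Fin n) (Fin m) ℂ}
    {B : Matrix (Fin n) (Fin m) R} (h : ∀ w, τ (A *ᵥ w) = B *ᵥ σ w) :
    extendScalars τ * A.map (Algebra.ofId ℂ R) = B * extendScalars σ := by
  refine Matrix.ext_of_mulVec_single fun j => ?_
  have hj : (Pi.single j 1 : Fin m → R) = fun i => algebraMap ℂ R ((Pi.single j 1 : Fin m → ℂ) i) := by
    ext i
    by_cases hij : i = j
    · subst hij; simp
    · simp [hij]
  have hA : (A.map (Algebra.ofId ℂ R)) *ᵥ (Pi.single j 1 : Fin m → R) =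
      fun i => algebraMap ℂ R ((A *ᵥ Pi.single j 1) i) := by
    ext i
    simp [Algebra.ofId_apply]
  rw [← Matrix.mulVec_mulVec, ← Matrix.mulVec_mulVec, hA, extendScalars_mulVec, h, hj,
    extendScalars_mulVec]

/-- A complex-linear homomorphism into a family extends uniquely to an `R`-linear one from the
constant family. With `R = ℂ` this compares points, with dual numbers it trivializes a tangent
vector. -/
theorem iso_of_isTw {x : FramedRep ℂ d₀ d₁} {y : FramedRep R d₀ d₁}
    {σ₀ : (Fin d₀ → ℂ) →ₗ[ℂ] (Fin d₀ → R)} {σ₁ : (Fin d₁ → ℂ) →ₗ[ℂ] (Fin d₁ → R)}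
    (h : LinRep.IsTw 1 x.toLinRep y.toLinRep σ₀ σ₁) (hv : σ₀ x.v = y.v)
    (h₀ : IsUnit (extendScalars σ₀)) (h₁ : IsUnit (extendScalars σ₁)) :
    Iso (x.map (Algebra.ofId ℂ R)) y := by
  refine ⟨h₀.unit, h₁.unit, fun i => ?_, fun i => ?_, ?_, ?_, ?_⟩
  · exact extendScalars_mul (h.a_one i)
  · exact extendScalars_mul (h.b_one i)
  · exact extendScalars_mul h.c_one
  · exact extendScalars_mul h.d_one
  · rw [← hv]
    exact extendScalars_mulVec σ₀ x.v

theorem isUnit_extendScalars_of_bijective {m : ℕ} {σ : (Fin m → ℂ) →ₗ[ℂ] (Fin m → ℂ)}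
    (h : Function.Bijective σ) : IsUnit (extendScalars σ) := by
  rw [Matrix.isUnit_iff_isUnit_det]
  have : extendScalars σ = LinearMap.toMatrix' σ := by
    ext i j
    simp [extendScalars, LinearMap.toMatrix'_apply]
  rw [this, LinearMap.det_toMatrix']
  exact LinearEquiv.isUnit_det' (LinearEquiv.ofBijective σ h)

/-- A section of the reduction gives a matrix that is the identity modulo `ε`, and `ε` is nilpotent.
-/
theorem isUnit_extendScalars_of_fst {m : ℕ} {σ : (Fin m → ℂ) →ₗ[ℂ] (Fin m → DualNumber ℂ)}
    (h : ∀ w i, (σ w i).fst = w i) : IsUnit (extendScalars σ) := by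
  rw [Matrix.isUnit_iff_isUnit_det, TrivSqZeroExt.isUnit_iff_isUnit_fst]
  have : (extendScalars σ).map (TrivSqZeroExt.fstHom ℂ ℂ ℂ) = 1 := by
    ext i j
    simp [extendScalars, h, Matrix.one_apply, Pi.single_apply]
  have h2 := (TrivSqZeroExt.fstHom ℂ ℂ ℂ).map_det (extendScalars σ)
  rw [AlgHom.mapMatrix_apply, this, Matrix.det_one] at h2
  rw [show (extendScalars σ).det.fst = 1 from h2]
  exact isUnit_one

section Torus

variable {Θ : ℝ × ℝ} {p p' : Probe} (hp : p.Adm Θ) (hp' : p'.Adm Θ) (hpp : p.Unimodular p')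
  {t : T} (ht : Generic fun i => (t.1 i.castSucc : ℂ))

include hp hp' hpp ht

theorem iso_of_supp_eq {x y : FramedRep ℂ d₀ d₁} (hx : x.IsSemistableFamily Θ)
    (hy : y.IsSemistableFamily Θ) (hxt : Iso x (x.scale t)) (hyt : Iso y (y.scale t))
    (h : p.supp x.toLinRep (Sum.inl x.v) = p.supp y.toLinRep (Sum.inl y.v))
    (h' : p'.supp x.toLinRep (Sum.inl x.v) = p'.supp y.toLinRep (Sum.inl y.v)) : Iso x y := by
  obtain ⟨f₀, f₁, hf, b₀, b₁, hv⟩ := LinRep.exists_bijective_of_supp hp hp' hpp ht hx.semi hy.semi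
    (stabilized_of_iso hxt) (stabilized_of_iso hyt) h h'
  exact iso_of_isTw hf hv (isUnit_extendScalars_of_bijective b₀)
    (isUnit_extendScalars_of_bijective b₁)

end Torus

/-- The coordinatewise reduction modulo `ε`. -/
def reduce (m : ℕ) : (Fin m → DualNumber ℂ) →ₗ[ℂ] (Fin m → ℂ) :=
  LinearMap.pi fun i => (TrivSqZeroExt.fstHom ℂ ℂ ℂ).toLinearMap ∘ₗ LinearMap.proj i

theorem reduce_apply {m : ℕ} (w : Fin m → DualNumber ℂ) (i : Fin m) :
    reduce m w i = (w i).fst := rfl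

/-- The coordinatewise multiplication by `ε`. -/
def mulEps (m : ℕ) : (Fin m → ℂ) →ₗ[ℂ] (Fin m → DualNumber ℂ) :=
  LinearMap.pi fun i => TrivSqZeroExt.inrHom ℂ ℂ ∘ₗ LinearMap.proj i

theorem mulEps_apply {m : ℕ} (w : Fin m → ℂ) (i : Fin m) :
    mulEps m w i = TrivSqZeroExt.inr (w i) := rfl

theorem reduce_mulVec {m n : ℕ} (A : Matrix (Fin m) (Fin n) (DualNumber ℂ))
    (w : Fin n → DualNumber ℂ) :
    reduce m (A *ᵥ w) = A.map (TrivSqZeroExt.fstHom ℂ ℂ ℂ) *ᵥ reduce n w := by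
  ext i
  simp [reduce_apply, Matrix.mulVec, dotProduct, TrivSqZeroExt.fst_sum]

theorem mulEps_mulVec {m n : ℕ} (A : Matrix (Fin m) (Fin n) (DualNumber ℂ)) (w : Fin n → ℂ) :
    mulEps m (A.map (TrivSqZeroExt.fstHom ℂ ℂ ℂ) *ᵥ w) = A *ᵥ mulEps n w := by
  ext i
  · simp [mulEps_apply, Matrix.mulVec, dotProduct, TrivSqZeroExt.fst_sum]
  · simp [mulEps_apply, Matrix.mulVec, dotProduct, TrivSqZeroExt.snd_sum, mul_comm]

theorem mulEps_injective (m : ℕ) : Function.Injective (mulEps m) := fun _ _ h =>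
  funext fun i => TrivSqZeroExt.inr_injective (congrFun h i)

theorem reduce_surjective (m : ℕ) : Function.Surjective (reduce m) := fun w =>
  ⟨fun i => TrivSqZeroExt.inl (w i), rfl⟩

theorem range_mulEps (m : ℕ) : LinearMap.range (mulEps m) = LinearMap.ker (reduce m) := by
  apply le_antisymm
  · rintro _ ⟨w, rfl⟩
    rfl
  · intro w hw
    exact ⟨fun i => (w i).snd, funext fun i =>
      TrivSqZeroExt.ext (congrFun (LinearMap.mem_ker.1 hw) i).symm rfl⟩

section Deformation

variable (x : FramedRep (DualNumber ℂ) d₀ d₁)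

theorem reduce_isTw :
    LinRep.IsTw 1 x.toLinRep (x.map (TrivSqZeroExt.fstHom ℂ ℂ ℂ)).toLinRep
      (reduce d₀) (reduce d₁) :=
  LinRep.isTw_one (fun k w => reduce_mulVec (x.a k) w) (fun k w => reduce_mulVec (x.b k) w)
    (fun w => reduce_mulVec x.c w) (fun w => reduce_mulVec x.d w)

theorem mulEps_isTw :
    LinRep.IsTw 1 (x.map (TrivSqZeroExt.fstHom ℂ ℂ ℂ)).toLinRep x.toLinRep
      (mulEps d₀) (mulEps d₁) :=
  LinRep.isTw_one (fun k w => mulEps_mulVec (x.a k) w) (fun k w => mulEps_mulVec (x.b k) w)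
    (fun w => mulEps_mulVec x.c w) (fun w => mulEps_mulVec x.d w)

variable {x}

/-- Over ℂ, the family is an extension of its reduction by itself, via multiplication by `ε` and
reduction. The gauge transformation witnessing fixedness is `ℂ[ε]`-linear, hence compatible with
both. -/
theorem nonempty_twistedDeformation {t : T} (h : Iso x (x.scale t)) :
    Nonempty (LinRep.TwistedDeformation (fun i => (t.1 i.castSucc : ℂ))
      (x.map (TrivSqZeroExt.fstHom ℂ ℂ ℂ)).toLinRep
      (Sum.inl (x.map (TrivSqZeroExt.fstHom ℂ ℂ ℂ)).v) x.toLinRep (Sum.inl x.v)) := by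
  obtain ⟨g₀, g₁, ha, hb, hc, hd, hv⟩ := h
  have hs := map_scale (TrivSqZeroExt.fstHom ℂ ℂ ℂ) t x
  refine ⟨{ i₀ := mulEps d₀, i₁ := mulEps d₁, p₀ := reduce d₀, p₁ := reduce d₁
            g₀ := (g₀.val.map (TrivSqZeroExt.fstHom ℂ ℂ ℂ)).mulVecLin.restrictScalars ℂ
            g₁ := (g₁.val.map (TrivSqZeroExt.fstHom ℂ ℂ ℂ)).mulVecLin.restrictScalars ℂ
            h₀ := g₀.val.mulVecLin.restrictScalars ℂ, h₁ := g₁.val.mulVecLin.restrictScalars ℂ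
            i_isTw := mulEps_isTw x, p_isTw := reduce_isTw x
            g_isTw := isTw_of_intertwine (fun i => ?_) (fun i => ?_) ?_ ?_
            h_isTw := isTw_of_intertwine ha hb hc hd
            inj₀ := mulEps_injective d₀, inj₁ := mulEps_injective d₁
            surj₀ := reduce_surjective d₀, surj₁ := reduce_surjective d₁
            exact₀ := range_mulEps d₀, exact₁ := range_mulEps d₁
            comm₀ := mulEps_mulVec g₀.val, comm₁ := mulEps_mulVec g₁.val
            p_frame := rfl
            g_frame := congrArg Sum.inl ?_
            h_frame := congrArg Sum.inl hv }⟩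
  · rw [← hs]; exact map_intertwine _ (ha i)
  · rw [← hs]; exact map_intertwine _ (hb i)
  · rw [← hs]; exact map_intertwine _ hc
  · rw [← hs]; exact map_intertwine _ hd
  · exact (reduce_mulVec g₀.val x.v).symm.trans (congrArg (reduce d₀) hv)

theorem iso_constant_of_iso_scale {Θ : ℝ × ℝ} {p p' : Probe} (hp : p.Adm Θ) (hp' : p'.Adm Θ)
    (hpp : p.Unimodular p') {t : T} (ht : Generic fun i => (t.1 i.castSucc : ℂ))
    (hx : x.IsSemistableFamily Θ) (h : Iso x (x.scale t)) :
    Iso ((x.map (TrivSqZeroExt.fstHom ℂ ℂ ℂ)).map (Algebra.ofId ℂ (DualNumber ℂ))) x := by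
  obtain ⟨D⟩ := nonempty_twistedDeformation h
  have hM := (hx (TrivSqZeroExt.fstHom ℂ ℂ ℂ)).semi
  have : FiniteDimensional ℂ (DualNumber ℂ) := inferInstanceAs (FiniteDimensional ℂ (ℂ × ℂ))
  obtain ⟨σ₀, σ₁, hσ, h₀, h₁, hv⟩ := LinRep.exists_section_of_supp hp hp' hpp ht hM
    (hM.nonpos.extension hM.nonpos (mulEps_isTw x) (reduce_isTw x) (mulEps_injective d₀)
      (mulEps_injective d₁) (range_mulEps d₀) (range_mulEps d₁))
    ⟨D.g₀, D.g₁, D.g_isTw, D.g_frame⟩ (stabilized_of_iso h) (reduce_isTw x) rfl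
    (LinRep.supp_subset_of_deformation hp ht hM D) (LinRep.supp_subset_of_deformation hp' ht hM D)
  exact iso_of_isTw hσ hv (isUnit_extendScalars_of_fst fun w i => congrFun (h₀ w) i)
    (isUnit_extendScalars_of_fst fun w i => congrFun (h₁ w) i)

end Deformation

end FramedRep

/-! ### Fixed points and fixed tangent vectors of the moduli space -/

section Moduli

variable {Θ : ℝ × ℝ} {d₀ d₁ : ℕ} {R : Type} [CommRing R] [Algebra ℂ R]

/-- The class of a semistable family. -/
def Moduli.mk (x : FramedRep R d₀ d₁) (hx : x.IsSemistableFamily Θ) : Moduli Θ d₀ d₁ R :=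
  Quotient.mk (isoSetoid Θ d₀ d₁ R) ⟨x, hx⟩

theorem Moduli.mk_eq_mk {x y : FramedRep R d₀ d₁} {hx : x.IsSemistableFamily Θ}
    {hy : y.IsSemistableFamily Θ} : Moduli.mk x hx = Moduli.mk y hy ↔ FramedRep.Iso x y :=
  Quotient.eq (r := isoSetoid Θ d₀ d₁ R)

theorem Moduli.exists_mk (z : Moduli Θ d₀ d₁ R) :
    ∃ (x : FramedRep R d₀ d₁) (hx : x.IsSemistableFamily Θ), Moduli.mk x hx = z := by
  obtain ⟨x, rfl⟩ := Quotient.exists_rep z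
  exact ⟨x.1, x.2, rfl⟩

theorem iso_scale_of_smul_eq {x : FramedRep R d₀ d₁} {hx : x.IsSemistableFamily Θ} {t : T}
    (h : t • Moduli.mk x hx = Moduli.mk x hx) : FramedRep.Iso x (x.scale t) :=
  (Moduli.mk_eq_mk.1 h).symm

theorem forall_Tbar₀_smul_eq_iff {z : Moduli Θ d₀ d₁ R} :
    (∀ t : Tbar₀, t • z = z) ↔ ∀ q ∈ T₀, q • z = z := by
  refine ⟨fun h q hq => h ⟨QuotientGroup.mk q, q, hq, rfl⟩, fun h q => ?_⟩
  obtain ⟨_, q, hq, rfl⟩ := q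
  exact h q hq

end Moduli

section FixedPoints

variable {Θ : ℝ × ℝ} {d₀ d₁ : ℕ} {p p' : Probe} (hp : p.Adm Θ) (hp' : p'.Adm Θ)
  (hpp : p.Unimodular p') {t : T} (ht₀ : t ∈ T₀) (ht : Generic fun i => (t.1 i.castSucc : ℂ))

include hp hp' hpp ht₀ ht

/-- The torus is commutative, so the translate by `q` is again fixed by `t`, and it has the same
supports; supports determine points fixed by `t`. -/
theorem smul_eq_of_mem_fixedPoints {z : Points Θ d₀ d₁}
    (hz : z ∈ MulAction.fixedPoints Tbar₀ (Points Θ d₀ d₁)) (q : T) : q • z = z := by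
  have hz' := forall_Tbar₀_smul_eq_iff.1 hz
  obtain ⟨x, hx, rfl⟩ := z.exists_mk
  have h1 := iso_scale_of_smul_eq (hz' t ht₀)
  have h2 : FramedRep.Iso (x.scale q) ((x.scale q).scale t) := by
    rw [← FramedRep.scale_mul, mul_comm, FramedRep.scale_mul]
    exact h1.scale q
  have hle : ∀ (p : Probe) (q : T) (x : FramedRep ℂ d₀ d₁),
      p.supp x.toLinRep (Sum.inl x.v) ⊆ p.supp (x.scale q).toLinRep (Sum.inl x.v) :=
    fun p q x => LinRep.supp_of_isTw_id (fun i => Units.ne_zero _) (FramedRep.scale_isTw q x) _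
  have heq : ∀ p : Probe, p.supp (x.scale q).toLinRep (Sum.inl (x.scale q).v) =
      p.supp x.toLinRep (Sum.inl x.v) := fun p => by
    refine (hle p q⁻¹ (x.scale q)).trans_eq ?_ |>.antisymm (hle p q x)
    rw [← FramedRep.scale_mul, inv_mul_cancel, FramedRep.scale_one]
    rfl
  exact Moduli.mk_eq_mk.2 (FramedRep.iso_of_supp_eq hp hp' hpp ht (hx.scale q) hx h2 h1 (heq p)
    (heq p'))

theorem finite_fixedPoints : (MulAction.fixedPoints Tbar₀ (Points Θ d₀ d₁)).Finite := by
  choose r hr hrz using fun z : Points Θ d₀ d₁ => z.exists_mk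
  have hiso : ∀ z ∈ MulAction.fixedPoints Tbar₀ (Points Θ d₀ d₁),
      FramedRep.Iso (r z) ((r z).scale t) := fun z hz => by
    refine iso_scale_of_smul_eq (hx := hr z) ?_
    rw [hrz]
    exact forall_Tbar₀_smul_eq_iff.1 hz t ht₀
  -- A finite box of exponents that contains every support, so the pair of supports injects the
  -- fixed points into a finite set.
  let A : Probe → Set (Fin 5 → ℕ) := fun p => Set.Iic fun _ => p.n + 1 + p.n * (d₀ + d₁)
  have hA : ∀ (p : Probe), ∀ z ∈ MulAction.fixedPoints Tbar₀ (Points Θ d₀ d₁),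
      p.supp (r z).toLinRep (Sum.inl (r z).v) ∈ 𝒫 (A p) := fun p z hz e he i => by
    have := LinRep.le_of_mem_supp ht (FramedRep.stabilized_of_iso (hiso z hz)) he i
    rwa [finrank_fin_fun, finrank_fin_fun] at this
  refine Set.Finite.of_injOn (f := fun z => (p.supp (r z).toLinRep (Sum.inl (r z).v),
    p'.supp (r z).toLinRep (Sum.inl (r z).v))) (t := 𝒫 (A p) ×ˢ 𝒫 (A p'))
    (fun z hz => ⟨hA p z hz, hA p' z hz⟩) (fun z hz w hw h => ?_)
    ((Set.finite_Iic _).finite_subsets.prod (Set.finite_Iic _).finite_subsets)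
  rw [← hrz z, ← hrz w]
  exact Moduli.mk_eq_mk.2 (FramedRep.iso_of_supp_eq hp hp' hpp ht (hr z) (hr w) (hiso z hz)
    (hiso w hw) (congrArg Prod.fst h) (congrArg Prod.snd h))

theorem eq_zeroTangent_of_fixed {z : Points Θ d₀ d₁} {ξ : Moduli Θ d₀ d₁ (DualNumber ℂ)}
    (hξ : ξ ∈ tangentSpace z) (h : ∀ t : Tbar₀, t • ξ = ξ) : ξ = zeroTangent z := by
  have h' := forall_Tbar₀_smul_eq_iff.1 h
  obtain ⟨x, hx, rfl⟩ := ξ.exists_mk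
  obtain rfl : Moduli.mk _ (hx.map (TrivSqZeroExt.fstHom ℂ ℂ ℂ)) = z := hξ
  exact (Moduli.mk_eq_mk (hx := (hx.map _).map _).2 (FramedRep.iso_constant_of_iso_scale hp hp' hpp
    ht hx (iso_scale_of_smul_eq (h' t ht₀)))).symm

end FixedPoints

end LocalConifold

open LocalConifold in
theorem proposition3p1 (Θ : ℝ × ℝ) (hΘ : Θ ∉ walls) (hΘ0 : Θ ≠ 0) (d₀ d₁ : ℕ) :
    MulAction.fixedPoints Tbar₀ (Points Θ d₀ d₁) = MulAction.fixedPoints Tbar (Points Θ d₀ d₁) ∧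
    (MulAction.fixedPoints Tbar₀ (Points Θ d₀ d₁)).Finite ∧
    ∀ p ∈ MulAction.fixedPoints Tbar₀ (Points Θ d₀ d₁), ∀ ξ ∈ tangentSpace p,
      (∀ t : Tbar₀, t • ξ = ξ) → ξ = zeroTangent p := by
  obtain ⟨p, p', hp, hp', hpp⟩ := exists_probes hΘ hΘ0
  obtain ⟨t, ht₀, ht⟩ := exists_generic
  refine ⟨Set.Subset.antisymm (fun z hz q => ?_) (fun z hz q => hz q.1),
    finite_fixedPoints hp hp' hpp ht₀ ht,
    fun z _ ξ hξ h => eq_zeroTangent_of_fixed hp hp' hpp ht₀ ht hξ h⟩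
  obtain ⟨q, rfl⟩ := QuotientGroup.mk_surjective q
  exact smul_eq_of_mem_fixedPoints hp hp' hpp ht₀ ht hz q
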